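/- Let $K$ be a field with $\operatorname{char} K\neq 2$. Let $\Lambda=\Lambda(x_i\mid i\ge 0)$ be the Grassmann algebra, $\partial_i$ its superderivative with $\partial_i(x_j)=\delta_{ij}$, identify $x_i$ with the left multiplication by it, and put $$v_i=\partial_i+x_ix_{i+1}(\partial_{i+3}+x_{i+3}x_{i+4}(\partial_{i+6}+\cdots))\in\operatorname{End}\Lambda,\qquad i\ge 0 .$$ Let $\mathbf A=\operatorname{Alg}(v_0,v_1,v_2)\subset\operatorname{End}\Lambda$ be the associative algebra with unit generated by $v_0,v_1,v_2$. Let $\tilde H_\infty$ be the Poisson superalgebra of all formal infinite sums of the unit and the monomials $x^\alpha y^\beta$ with $\max\alpha<\max\beta$ in odd Grassmann letters $x_i,y_i$ ($i\ge0$), with bracket determined by $\{y_i,x_j\}=\delta_{ij}$, $\{x_i,x_j\}=\{y_i,y_j\}=0$, put $V_i=y_i+x_ix_{i+1}(y_{i+3}+x_{i+3}x_{i+4}(y_{i+6}+\cdots))$, and let $\mathbf P=\operatorname{Poisson}(V_0,V_1,V_2)\subset\tilde H_\infty$ be the Poisson subsuperalgebra with unit generated by $V_0,V_1,V_2$. The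 standard monomials are, of the first type, $x_0^{*}\cdots x_{n-3}^{*}v_n$ ($n\ge0$, each $*\in\{0,1\}$) except $x_0x_1^*v_4$ and $x_0x_1^*x_2^*x_3x_4^*v_7$; of the second type, $x_1v_3,\ x_2v_4,\ x_3v_5$ and $x_0^*\cdots x_{n-5}^*x_{n-2}v_n$ ($n\ge 6$) except $x_0x_1^*x_2^*x_5v_7$ and $x_0x_1^*x_2^*x_3x_4^*x_5x_8v_{10}$; $n$ is called the length. Let $\mathbf A^m$ be the span of all at most $m$-fold products of standard monomials ($\mathbf A^{-1}=0$), $\mathbf A_m=\mathbf A^m/\mathbf A^{m-1}$, $\operatorname{gr}\mathbf A=\bigoplus_{m\ge 0}\mathbf A_m$, and let $\mathbf P_m\subset\mathbf P$ be the span of the $m$-fold products of the monomials $x^\alpha V_n$ corresponding to the standard monomials $x^\alpha v_n$. (0) A basis of $\mathbf P$ is given by the unit and the monomials $$x_0^{\alpha_0}\cdots x_{n-2}^{\alpha_{n-2}}V_0^{\beta_0}\cdots V_{n-1}^{\beta_{n-1}}V_n,\qquad \alpha_i,\beta_i\in\{0,1\},\ n\ge 0,\qquad(*)$$ subject to the following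 restrictions (letters with negative index are regarded as having exponent $0$): * if $\beta_{n-1}=\beta_{n-2}=1$, the $\alpha_i$ are arbitrary; * if $\beta_{n-1}=1,\ \beta_{n-2}=0$, at least one of $\alpha_{n-4},\alpha_{n-3},\alpha_{n-2}$ is zero; * if $\beta_{n-1}=0,\ \beta_{n-2}=1$, at least one of $\alpha_{n-3},\alpha_{n-2}$ is zero; * if $\beta_{n-1}=\beta_{n-2}=0$, either $\alpha_{n-2}=0$ or $\alpha_{n-3}=\alpha_{n-4}=0$; * if $\beta_{n-1}=\dots=\beta_0=0$, the monomial corresponds to a standard monomial; * the following finitely many monomials, all of length $n\le 10$, are excluded (a set of letters is said to occur if all of them have exponent one): $n=2$ and $x_0$ occurs; $n=3$, $\beta_2=1$ and $x_0,x_1$ occur; $n=4$ and either $\beta_3=0$ and $x_0$ occurs, or $\beta_3=1$ and $x_0,x_1,x_2$ occur; $n=5$ and either $\beta_3=0$ and $x_0,x_3$ occur, or $\beta_3=1,\beta_4=0$ and $x_0,x_1,x_3$ occur, or $\beta_3=\beta_4=1$ and $x_0,x_1,x_2,x_3$ occur; $n=7$, $\beta_3=\beta_6=0$ and either $\beta_5=0$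 and $x_0,x_3$ or $x_0,x_5$ occur, or $\beta_5=1$ and $x_0,x_3,x_5$ occur; $n=10$, $\beta_3=\beta_5=\beta_6=\beta_7=\beta_8=\beta_9=0$ and $x_0,x_3,x_5,x_8$ occur. The monomials $(*)$ that obey these restrictions are exactly those that are, up to the order of the letters, products of monomials $x^\alpha V_j$ corresponding to standard monomials of pairwise distinct lengths. Moreover $\mathbf P=\bigoplus_{m\ge0}\mathbf P_m$. (i) A basis of $\mathbf A$ consists of the unit and the monomials $x_0^{\alpha_0}\cdots x_{n-2}^{\alpha_{n-2}}v_0^{\beta_0}\cdots v_{n-1}^{\beta_{n-1}}v_n$ that obey the same restrictions. (ii) $\{\mathbf A^m\}_{m\ge 0}$ is an exhaustive filtration of $\mathbf A$, and for $m\ge1$, $\mathbf A^m$ modulo $\mathbf A^{m-1}$ is spanned by the products $w_1\cdots w_m$ of standard monomials of strictly decreasing lengths. (iii) For every $m\ge 0$ there is a natural isomorphism of vector spaces $\rho_m:\mathbf A_m\to\mathbf P_m$, sending the class of a product $w_1\cdots w_m$ of standard monomials to the product of the corresponding elements of $\mathbf P$ (with each $v_j$ replaced by $V_j$). (iv) For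 homogeneous $a\in\mathbf A^n$, $b\in\mathbf A^m$ one has $[a,b]=ab-(-1)^{|a||b|}ba\in\mathbf A^{n+m-1}$ (where $\mathbf A^{-1}=0$), and there is a unique bilinear bracket on $\operatorname{gr}\mathbf A$ such that $\{\bar a,\bar b\}$ is the class of $[a,b]$ modulo $\mathbf A^{n+m-2}$ for all such $a,b$. With it $\operatorname{gr}\mathbf A$ is a Poisson superalgebra, and the $\rho_m$ constitute an isomorphism of Poisson superalgebras $\operatorname{gr}\mathbf A\cong\mathbf P$. -/

import Mathlib

open scoped DirectSum

noncomputable section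

namespace PivotAlg

/-! ### Superalgebra vocabulary -/

/-- The sign `(-1)^{|a||b|}` for parities `|a| = i` and `|b| = j`. -/
def ssign (K : Type*) [Field K] (i j : ZMod 2) : K := (-1) ^ (i.val * j.val)

/-- `A`, with unit `one`, product `mul`, bracket `br` and homogeneous parts `par 0` (even) and
`par 1` (odd), is a Poisson superalgebra over a field of characteristic different from two.
The last Lie axiom is the one that has to be added in characteristic three; it follows from the
others in all other characteristics. -/
structure IsPoissonSuperalgebra {K A : Type*} [Field K] [AddCommGroup A] [Module K A]
    (one : A) (mul br : A →ₗ[K] A →ₗ[K] A) (par : ZMod 2 → Submodule K A) : Prop where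
  isCompl : IsCompl (par 0) (par 1)
  one_mem : one ∈ par 0
  mul_mem : ∀ i j a b, a ∈ par i → b ∈ par j → mul a b ∈ par (i + j)
  one_mul : ∀ a, mul one a = a
  mul_one : ∀ a, mul a one = a
  mul_assoc : ∀ a b c, mul (mul a b) c = mul a (mul b c)
  mul_supercomm : ∀ i j a b, a ∈ par i → b ∈ par j → mul a b = ssign K i j • mul b a
  br_mem : ∀ i j a b, a ∈ par i → b ∈ par j → br a b ∈ par (i + j)
  br_antisupercomm : ∀ i j a b, a ∈ par i → b ∈ par j → br a b = -(ssign K i j • br b a)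
  jacobi : ∀ i j a b c, a ∈ par i → b ∈ par j →
    br a (br b c) = br (br a b) c + ssign K i j • br b (br a c)
  br_br_self : ∀ a, a ∈ par 1 → br a (br a a) = 0
  leibniz : ∀ j k a b c, b ∈ par j → c ∈ par k →
    br (mul a b) c = mul a (br b c) + ssign K j k • mul (br a c) b

/-- The family `f` is a basis of the subspace `S`. -/
def IsBasisOf (K : Type*) {ι E : Type*} [Field K] [AddCommGroup E] [Module K E]
    (f : ι → E) (S : Submodule K E) : Prop :=
  LinearIndependent K f ∧ Submodule.span K (Set.range f) = S

/-! ### Combinatorics of the monomials -/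

/-- `x^α v_n` is a standard monomial (`α` is the set of indices of the Grassmann letters).
First type: `x_0^* ⋯ x_{n-3}^* v_n`; second type: `x_0^* ⋯ x_{n-5}^* x_{n-2} v_n`, `n ≥ 3`;
the conditions after these exclude the false monomials. -/
def Standard (n : ℕ) (α : Finset ℕ) : Prop :=
  ((∀ i ∈ α, i + 3 ≤ n) ∧ ¬(n = 4 ∧ 0 ∈ α) ∧ ¬(n = 7 ∧ 0 ∈ α ∧ 3 ∈ α)) ∨
  ((3 ≤ n ∧ n - 2 ∈ α ∧ ∀ i ∈ α, i ≠ n - 2 → i + 5 ≤ n) ∧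
    ¬(n = 5 ∧ 0 ∈ α) ∧ ¬(n = 7 ∧ 0 ∈ α) ∧ ¬(n = 10 ∧ 0 ∈ α ∧ 3 ∈ α ∧ 5 ∈ α))

/-- Exponents of a monomial `x_0^{α_0} ⋯ x_{n-2}^{α_{n-2}} v_0^{β_0} ⋯ v_{n-1}^{β_{n-1}} v_n`,
all `α_i, β_i ∈ {0, 1}`, given by the sets `α`, `β` of the indices with exponent one. -/
@[ext] structure Mono where
  n : ℕ
  α : Finset ℕ
  β : Finset ℕ
  hα : ∀ i ∈ α, i + 2 ≤ n
  hβ : ∀ j ∈ β, j < n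

/-- `At s n k`: the exponent with index `n - k` is one (letters with a negative index do not
exist, so their exponent counts as zero). -/
def At (s : Finset ℕ) (n k : ℕ) : Prop := k ≤ n ∧ n - k ∈ s

/-- The finitely many exceptional monomials. -/
def Mono.Excluded (m : Mono) : Prop :=
  (m.n = 2 ∧ 0 ∈ m.α) ∨
  (m.n = 3 ∧ 2 ∈ m.β ∧ {0, 1} ⊆ m.α) ∨
  (m.n = 4 ∧ 3 ∉ m.β ∧ 0 ∈ m.α) ∨
  (m.n = 4 ∧ 3 ∈ m.β ∧ {0, 1, 2} ⊆ m.α) ∨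
  (m.n = 5 ∧ 3 ∉ m.β ∧ {0, 3} ⊆ m.α) ∨
  (m.n = 5 ∧ 3 ∈ m.β ∧ 4 ∉ m.β ∧ {0, 1, 3} ⊆ m.α) ∨
  (m.n = 5 ∧ 3 ∈ m.β ∧ 4 ∈ m.β ∧ {0, 1, 2, 3} ⊆ m.α) ∨
  (m.n = 7 ∧ m.β ⊆ {0, 1, 2, 4} ∧ ({0, 3} ⊆ m.α ∨ {0, 5} ⊆ m.α)) ∨
  (m.n = 7 ∧ m.β ⊆ {0, 1, 2, 4, 5} ∧ 5 ∈ m.β ∧ {0, 3, 5} ⊆ m.α) ∨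
  (m.n = 10 ∧ m.β ⊆ {0, 1, 2, 4} ∧ {0, 3, 5, 8} ⊆ m.α)

/-- The restrictions on the exponents of the basis monomials. -/
structure Mono.Admissible (m : Mono) : Prop where
  /-- `β_{n-1} = 1`, `β_{n-2} = 0`: one of `α_{n-4}, α_{n-3}, α_{n-2}` is zero. -/
  one_zero : At m.β m.n 1 → ¬At m.β m.n 2 → ¬(At m.α m.n 4 ∧ At m.α m.n 3 ∧ At m.α m.n 2)
  /-- `β_{n-1} = 0`, `β_{n-2} = 1`: one of `α_{n-3}, α_{n-2}` is zero. -/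
  zero_one : ¬At m.β m.n 1 → At m.β m.n 2 → ¬(At m.α m.n 3 ∧ At m.α m.n 2)
  /-- `β_{n-1} = β_{n-2} = 0`: either `α_{n-2} = 0` or `α_{n-3} = α_{n-4} = 0`. -/
  zero_zero : ¬At m.β m.n 1 → ¬At m.β m.n 2 →
    ¬At m.α m.n 2 ∨ (¬At m.α m.n 3 ∧ ¬At m.α m.n 4)
  /-- `β_{n-1} = ⋯ = β_0 = 0`: the standard monomials. -/
  standard : m.β = ∅ → Standard m.n m.α
  not_excluded : ¬m.Excluded

/-- Up to reordering of the letters, the monomial is a product of standard monomials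
`x^{s j} v_j`, one for each of the letters `v_j` that occur in it. -/
def Mono.IsStandardProduct (m : Mono) : Prop :=
  ∃ s : ℕ → Finset ℕ, (∀ j ∈ insert m.n m.β, Standard j (s j)) ∧
    (∀ j ∈ insert m.n m.β, ∀ k ∈ insert m.n m.β, j ≠ k → Disjoint (s j) (s k)) ∧
    m.α = (insert m.n m.β).biUnion s

/-- The product of the letters `x i`, `i ∈ α`, in increasing order, followed by the product of the
letters `v j`, `j ∈ β`, in increasing order, and by `v n`. -/
def monoProd {E : Type*} [Mul E] [One E] (x v : ℕ → E) (n : ℕ) (α β : Finset ℕ) : E :=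
  ((α.sort (· ≤ ·)).map x ++ (β.sort (· ≤ ·)).map v ++ [v n]).prod

/-- The unit together with the admissible monomials. -/
def basisFamily {E : Type*} [Mul E] [One E] (x v : ℕ → E) :
    Option {m : Mono // m.Admissible} → E
  | none => 1
  | some m => monoProd x v m.1.n m.1.α m.1.β

/-- Indices of the letters in the coefficient of `∂_{i+3k}` in the pivot element `v_i`:
`x_i x_{i+1} x_{i+3} x_{i+4} ⋯ x_{i+3k-3} x_{i+3k-2}`. -/
def pivotTail (i k : ℕ) : Finset ℕ := (Finset.range k).biUnion fun l => {i + 3 * l, i + 3 * l + 1}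

/-! ### The associated graded algebra of a filtered algebra -/

section Graded

variable {K E : Type*} [Field K] [Ring E] [Algebra K E] (F : ℕ → Submodule K E)

/-- The previous term of the filtration, which is zero for `m = 0`. -/
def filtPred (m : ℕ) : Submodule K E := if m = 0 then ⊥ else F (m - 1)

/-- The quotient of two consecutive terms of the filtration. -/
def GrPiece (m : ℕ) := F m ⧸ (filtPred F m).submoduleOf (F m)

instance (m : ℕ) : AddCommGroup (GrPiece F m) :=
  inferInstanceAs (AddCommGroup (F m ⧸ (filtPred F m).submoduleOf (F m)))
instance (m : ℕ) : Module K (GrPiece F m) :=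
  inferInstanceAs (Module K (F m ⧸ (filtPred F m).submoduleOf (F m)))

/-- The associated graded space. -/
abbrev Gr := ⨁ m, GrPiece F m

/-- The class of an element of the `m`th term of the filtration in the `m`th component. -/
def pieceCls (m : ℕ) : F m →ₗ[K] GrPiece F m :=
  Submodule.mkQ ((filtPred F m).submoduleOf (F m))

theorem pieceCls_eq_zero {m : ℕ} {a : F m} : pieceCls F m a = 0 ↔ a.1 ∈ filtPred F m :=
  Submodule.Quotient.mk_eq_zero _

theorem pieceCls_surjective (m : ℕ) : Function.Surjective (pieceCls F m) :=
  Submodule.mkQ_surjective _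

/-- A linear map on the `m`th component, given on representatives. -/
def pieceLift {N : Type*} [AddCommGroup N] [Module K N] (m : ℕ) (g : F m →ₗ[K] N)
    (hg : ∀ a : F m, a.1 ∈ filtPred F m → g a = 0) : GrPiece F m →ₗ[K] N :=
  Submodule.liftQ ((filtPred F m).submoduleOf (F m)) g fun a ha => LinearMap.mem_ker.mpr (hg a ha)

theorem pieceLift_cls {N : Type*} [AddCommGroup N] [Module K N] (m : ℕ) (g : F m →ₗ[K] N)
    (hg : ∀ a : F m, a.1 ∈ filtPred F m → g a = 0) (a : F m) :
    pieceLift F m g hg (pieceCls F m a) = g a := rfl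

/-- The class in the associated graded space of an element of the `m`th term of the filtration. -/
def cls (m : ℕ) : F m →ₗ[K] Gr F := (DirectSum.lof K ℕ (GrPiece F) m).comp (pieceCls F m)

theorem filtPred_mul_left (hF : ∀ m n a b, a ∈ F m → b ∈ F n → a * b ∈ F (m + n))
    {m n : ℕ} {a b : E} (ha : a ∈ filtPred F m)
    (hb : b ∈ F n) : a * b ∈ filtPred F (m + n) := by
  unfold filtPred at *
  split_ifs at ha with h
  · rw [(Submodule.mem_bot K).mp ha, zero_mul]; exact Submodule.zero_mem _
  · rw [if_neg (by omega), show m + n - 1 = m - 1 + n by omega]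
    exact hF _ _ _ _ ha hb

theorem filtPred_mul_right (hF : ∀ m n a b, a ∈ F m → b ∈ F n → a * b ∈ F (m + n))
    {m n : ℕ} {a b : E} (ha : a ∈ F m)
    (hb : b ∈ filtPred F n) : a * b ∈ filtPred F (m + n) := by
  unfold filtPred at *
  split_ifs at hb with h
  · rw [(Submodule.mem_bot K).mp hb, mul_zero]; exact Submodule.zero_mem _
  · rw [if_neg (by omega), show m + n - 1 = m + (n - 1) by omega]
    exact hF _ _ _ _ ha hb

/-- The multiplication of two terms of the filtration. -/
def filtMul (hF : ∀ m n a b, a ∈ F m → b ∈ F n → a * b ∈ F (m + n))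
    (m n : ℕ) : F m →ₗ[K] F n →ₗ[K] F (m + n) :=
  LinearMap.mk₂ K (fun a b => ⟨a.1 * b.1, hF _ _ _ _ a.2 b.2⟩)
    (fun a a' b => Subtype.ext (add_mul a.1 a'.1 b.1))
    (fun c a b => Subtype.ext (smul_mul_assoc c a.1 b.1))
    (fun a b b' => Subtype.ext (mul_add a.1 b.1 b'.1))
    (fun c a b => Subtype.ext (mul_smul_comm c a.1 b.1))

/-- The multiplication induced on the quotients: the product of the classes of `a` and `b` is the
class of `ab`. -/
def pieceMul (hF : ∀ m n a b, a ∈ F m → b ∈ F n → a * b ∈ F (m + n))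
    (m n : ℕ) : GrPiece F m →ₗ[K] GrPiece F n →ₗ[K] GrPiece F (m + n) :=
  pieceLift F m
    { toFun := fun a => pieceLift F n ((pieceCls F (m + n)).comp (filtMul F hF m n a))
        (fun b hb => (pieceCls_eq_zero F).mpr (filtPred_mul_right F hF a.2 hb))
      map_add' := fun a a' => by
        ext z
        obtain ⟨b, rfl⟩ := pieceCls_surjective F n z
        simp [pieceLift_cls]
      map_smul' := fun c a => by
        ext z
        obtain ⟨b, rfl⟩ := pieceCls_surjective F n z
        simp [pieceLift_cls] }
    (fun a ha => by
      ext z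
      obtain ⟨b, rfl⟩ := pieceCls_surjective F n z
      exact (pieceCls_eq_zero F).mpr (filtPred_mul_left F hF ha b.2))

/-- The multiplication of the associated graded algebra. -/
def grMul (hF : ∀ m n a b, a ∈ F m → b ∈ F n → a * b ∈ F (m + n))
    : Gr F →ₗ[K] Gr F →ₗ[K] Gr F :=
  DirectSum.toModule K ℕ _ fun m => LinearMap.flip <|
    DirectSum.toModule K ℕ _ fun n => LinearMap.flip <|
      (pieceMul F hF m n).compr₂ (DirectSum.lof K ℕ (GrPiece F) (m + n))

theorem grMul_cls (hF : ∀ m n a b, a ∈ F m → b ∈ F n → a * b ∈ F (m + n))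
    (m n : ℕ) (a : F m) (b : F n) :
    grMul F hF (cls F m a) (cls F n b) = cls F (m + n) ⟨a.1 * b.1, hF _ _ _ _ a.2 b.2⟩ := by
  simp only [grMul, cls, LinearMap.comp_apply, DirectSum.toModule_lof, LinearMap.flip_apply,
    LinearMap.compr₂_apply]
  rfl

end Graded

/-! ### The Grassmann algebra, the pivot elements and the associative hull -/

variable (K : Type*) [Field K]

/-- The underlying vector space of the Grassmann algebra `Λ = Λ(x_i | i ≥ 0)`. -/
def Lam := ExteriorAlgebra K (ℕ →₀ K)

instance : AddCommGroup (Lam K) := inferInstanceAs (AddCommGroup (ExteriorAlgebra K (ℕ →₀ K)))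
instance : Module K (Lam K) := inferInstanceAs (Module K (ExteriorAlgebra K (ℕ →₀ K)))

/-- The generator `x_i` of `Λ`. -/
def gen (i : ℕ) : ExteriorAlgebra K (ℕ →₀ K) := ExteriorAlgebra.ι K (Finsupp.single i 1)

/-- The letter `x_i`, identified with the left multiplication by it. -/
def xOp (i : ℕ) : Module.End K (Lam K) :=
  (LinearMap.mulLeft K (gen K i) :
    ExteriorAlgebra K (ℕ →₀ K) →ₗ[K] ExteriorAlgebra K (ℕ →₀ K))

/-- The superderivative `∂_i` of `Λ`, that is the contraction with the `i`th coordinate. -/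
def dOp (i : ℕ) : Module.End K (Lam K) :=
  CliffordAlgebra.contractLeft (Q := (0 : QuadraticForm K (ℕ →₀ K))) (Finsupp.lapply i)

theorem dOp_one (i : ℕ) : dOp K i (1 : ExteriorAlgebra K (ℕ →₀ K)) = 0 :=
  CliffordAlgebra.contractLeft_one _ _

theorem dOp_xOp (i j : ℕ) (f : Lam K) :
    dOp K i (xOp K j f) = (if i = j then f else 0) - xOp K j (dOp K i f) := by
  refine (CliffordAlgebra.contractLeft_ι_mul (Q := (0 : QuadraticForm K (ℕ →₀ K))) _ _ f).trans ?_
  refine congrArg₂ (fun a b : Lam K => a - b) ?_ rfl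
  rw [Finsupp.lapply_apply, Finsupp.single_apply]
  by_cases h : i = j
  · rw [if_pos h.symm, if_pos h]; exact one_smul K f
  · rw [if_neg (Ne.symm h), if_neg h]; exact zero_smul K f

theorem dOp_eventually_zero (f : Lam K) : ∃ N, ∀ i, N ≤ i → dOp K i f = 0 := by
  induction f using CliffordAlgebra.left_induction with
  | algebraMap r => exact ⟨0, fun i _ => CliffordAlgebra.contractLeft_algebraMap _ _ r⟩
  | add x y hx hy =>
    obtain ⟨N, hN⟩ := hx
    obtain ⟨M, hM⟩ := hy
    refine ⟨max N M, fun i hi => ?_⟩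
    exact (map_add (dOp K i) (x : Lam K) (y : Lam K)).trans
      ((congrArg₂ (fun a b : Lam K => a + b) (hN i (le_trans (le_max_left _ _) hi))
        (hM i (le_trans (le_max_right _ _) hi))).trans (add_zero _))
  | ι_mul x m hx =>
    obtain ⟨N, hN⟩ := hx
    refine ⟨max N (m.support.sup id + 1), fun i hi => ?_⟩
    have h0 : m i = 0 := by
      by_contra hne
      have := Finset.le_sup (f := id) (Finsupp.mem_support_iff.mpr hne)
      simp only [id] at this
      omega
    have h1 := hN i (le_trans (le_max_left _ _) hi)
    refine (CliffordAlgebra.contractLeft_ι_mul (Q := (0 : QuadraticForm K (ℕ →₀ K)))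
      _ _ x).trans ?_
    rw [Finsupp.lapply_apply, h0, zero_smul, zero_sub]
    exact neg_eq_zero.mpr
      ((congrArg (fun a : CliffordAlgebra (0 : QuadraticForm K (ℕ →₀ K)) => CliffordAlgebra.ι _ m * a) h1).trans (mul_zero _))

/-- The product of the letters `x_i`, `i ∈ s`, in increasing order, as an operator. -/
def xProd (s : Finset ℕ) : Module.End K (Lam K) := ((s.sort (· ≤ ·)).map (xOp K)).prod

theorem pivot_finite (i : ℕ) (f : Lam K) :
    (Function.support fun k => xProd K (pivotTail i k) (dOp K (i + 3 * k) f)).Finite := by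
  obtain ⟨N, hN⟩ := dOp_eventually_zero K f
  refine (Set.finite_Iio N).subset fun k hk => ?_
  by_contra h
  simp only [Set.mem_Iio, not_lt] at h
  exact hk (by simp [hN (i + 3 * k) (by omega)])

/-- The pivot element
`v_i = ∂_i + x_i x_{i+1} (∂_{i+3} + x_{i+3} x_{i+4} (∂_{i+6} + ⋯))`;
on each element of `Λ` only finitely many terms of the sum are nonzero. -/
def pivot (i : ℕ) : Module.End K (Lam K) where
  toFun f := ∑ᶠ k, xProd K (pivotTail i k) (dOp K (i + 3 * k) f)
  map_add' f g := by
    simp only [map_add]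
    exact finsum_add_distrib (pivot_finite K i f) (pivot_finite K i g)
  map_smul' c f := by
    simp only [map_smul, RingHom.id_apply]
    exact (smul_finsum' c (pivot_finite K i f)).symm

/-- The associative hull: the unital associative algebra generated by `v_0, v_1, v_2`. -/
def hull : Subalgebra K (Module.End K (Lam K)) :=
  Algebra.adjoin K {pivot K 0, pivot K 1, pivot K 2}

/-- The homogeneous parts of `Λ`: the span of the products of an even (odd) number of letters. -/
def lamPar (i : ZMod 2) : Submodule K (Lam K) :=
  CliffordAlgebra.evenOdd (0 : QuadraticForm K (ℕ →₀ K)) i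

/-- The endomorphisms of `Λ` of parity `i`. -/
def endPar (i : ZMod 2) : Submodule K (Module.End K (Lam K)) where
  carrier := {φ | ∀ j, ∀ f ∈ lamPar K j, φ f ∈ lamPar K (i + j)}
  add_mem' h₁ h₂ j f hf := Submodule.add_mem _ (h₁ j f hf) (h₂ j f hf)
  zero_mem' _ _ _ := Submodule.zero_mem _
  smul_mem' c _ h j f hf := Submodule.smul_mem _ c (h j f hf)

/-- The supercommutator `ab - (-1)^{|a||b|} ba` of `a`, `b` with parities `p`, `q`. -/
def scomm (p q : ZMod 2) (a b : Module.End K (Lam K)) : Module.End K (Lam K) :=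
  a * b - ssign K p q • (b * a)

/-- The monomial `x^α v_n` in `End Λ`. -/
def aMon (w : ℕ × Finset ℕ) : Module.End K (Lam K) := monoProd (xOp K) (pivot K) w.1 w.2 ∅

/-- The span of all at most `m`-fold products of standard monomials. -/
def filt (m : ℕ) : Submodule K (Module.End K (Lam K)) :=
  Submodule.span K {a | ∃ l : List (ℕ × Finset ℕ), l.length ≤ m ∧
    (∀ w ∈ l, Standard w.1 w.2) ∧ a = (l.map (aMon K)).prod}

/-- The span of the `m`-fold products of standard monomials of strictly decreasing lengths. -/
def decr (m : ℕ) : Submodule K (Module.End K (Lam K)) :=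
  Submodule.span K {a | ∃ l : List (ℕ × Finset ℕ), l.length = m ∧
    (∀ w ∈ l, Standard w.1 w.2) ∧ l.Pairwise (fun w w' => w'.1 < w.1) ∧
    a = (l.map (aMon K)).prod}

theorem filt_mono {m n : ℕ} (h : m ≤ n) : filt K m ≤ filt K n :=
  Submodule.span_mono fun _ ⟨l, hl, hs, ha⟩ => ⟨l, hl.trans h, hs, ha⟩

theorem one_mem_filt : (1 : Module.End K (Lam K)) ∈ filt K 0 :=
  Submodule.subset_span ⟨[], by simp, by simp, by simp⟩

theorem filt_mul {m n : ℕ} {a b : Module.End K (Lam K)} (ha : a ∈ filt K m) (hb : b ∈ filt K n) :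
    a * b ∈ filt K (m + n) := by
  have h : filt K m * filt K n ≤ filt K (m + n) := by
    rw [filt, filt, Submodule.span_mul_span]
    refine Submodule.span_mono ?_
    rintro _ ⟨_, ⟨l, hl, hs, rfl⟩, _, ⟨l', hl', hs', rfl⟩, rfl⟩
    refine ⟨l ++ l', by simp; omega, fun w hw => ?_, by simp⟩
    rcases List.mem_append.mp hw with h | h
    · exact hs w h
    · exact hs' w h
  exact h (Submodule.mul_mem_mul ha hb)

/-! ### The associated graded superalgebra of the hull -/

/-- The associated graded space of the hull. -/
abbrev HullGr := Gr (filt K)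

/-- The multiplication of the associated graded algebra of the hull. -/
def hullGrMul : HullGr K →ₗ[K] HullGr K →ₗ[K] HullGr K :=
  grMul (filt K) fun _ _ _ _ ha hb => filt_mul K ha hb

/-- The unit of the associated graded algebra of the hull. -/
def hullGrOne : HullGr K := cls (filt K) 0 ⟨1, one_mem_filt K⟩

/-- The homogeneous parts of the associated graded algebra of the hull as a superalgebra. -/
def hullGrPar (i : ZMod 2) : Submodule K (HullGr K) :=
  ⨆ m, ((endPar K i).submoduleOf (filt K m)).map (cls (filt K) m)

/-- `br` is the bracket induced by the supercommutator: `{ā, b̄} = [a, b]` modulo the `n+m-2`nd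
term of the filtration, for homogeneous `a`, `b` in its `n`th and `m`th terms. -/
def IsInducedBracket (br : HullGr K →ₗ[K] HullGr K →ₗ[K] HullGr K) : Prop :=
  ∀ (n m : ℕ) (p q : ZMod 2) (a : filt K n) (b : filt K m) (c : filt K (n + m - 1)),
    a.1 ∈ endPar K p → b.1 ∈ endPar K q → c.1 = scomm K p q a.1 b.1 →
      br (cls (filt K) n a) (cls (filt K) m b) = cls (filt K) (n + m - 1) c

/-! ### The completed Poisson superalgebra and its subalgebra -/

/-- All formal infinite sums `∑ f(α, β) x^α y^β` in Grassmann letters `x_i, y_i`, `i ≥ 0`, where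
`x^α` and `y^β` are the products of the letters in increasing order. -/
def Ser := Finset ℕ × Finset ℕ → K

instance : AddCommGroup (Ser K) := inferInstanceAs (AddCommGroup (Finset ℕ × Finset ℕ → K))
instance : Module K (Ser K) := inferInstanceAs (Module K (Finset ℕ × Finset ℕ → K))

/-- The number of pairs `(s, t)`, `s ∈ S`, `t ∈ T` with `s > t`. -/
def inv (S T : Finset ℕ) : ℕ := ((S ×ˢ T).filter fun p => p.2 < p.1).card

/-- For disjoint exponents, the sign in `x^α y^β · x^α' y^β' = ± x^{α ∪ α'} y^{β ∪ β'}`. -/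
def serSign (a b : Finset ℕ × Finset ℕ) : K :=
  (-1) ^ (inv a.1 b.1 + inv a.2 b.2 + a.2.card * b.1.card)

theorem sum₂_add {K : Type*} [Field K] (A B : Finset (Finset ℕ)) (u v : Finset ℕ → Finset ℕ → K) :
    ∑ s ∈ A, ∑ t ∈ B, (u s t + v s t) = (∑ s ∈ A, ∑ t ∈ B, u s t) + ∑ s ∈ A, ∑ t ∈ B, v s t := by
  simp only [Finset.sum_add_distrib]

theorem sum₂_mul {K : Type*} [Field K] (c : K) (A B : Finset (Finset ℕ)) (u : Finset ℕ → Finset ℕ → K) :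
    ∑ s ∈ A, ∑ t ∈ B, c * u s t = c * ∑ s ∈ A, ∑ t ∈ B, u s t := by
  simp only [Finset.mul_sum]

/-- The associative product of formal sums. -/
def serMul : Ser K →ₗ[K] Ser K →ₗ[K] Ser K :=
  LinearMap.mk₂ K
    (fun f g ab => ∑ s ∈ ab.1.powerset, ∑ t ∈ ab.2.powerset,
      serSign K (s, t) (ab.1 \ s, ab.2 \ t) * f (s, t) * g (ab.1 \ s, ab.2 \ t))
    (fun f f' g => funext fun ab => by
      refine Eq.trans ?_ (sum₂_add _ _ _ _)
      refine Finset.sum_congr rfl fun s _ => Finset.sum_congr rfl fun t _ => ?_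
      exact (congrArg (· * _) (mul_add _ (f (s, t)) (f' (s, t)))).trans (add_mul _ _ _))
    (fun c f g => funext fun ab => by
      refine Eq.trans ?_ (sum₂_mul c _ _ _)
      refine Finset.sum_congr rfl fun s _ => Finset.sum_congr rfl fun t _ => ?_
      exact (congrArg (· * _) (mul_left_comm _ c (f (s, t)))).trans (mul_assoc _ _ _))
    (fun f g g' => funext fun ab => by
      refine Eq.trans ?_ (sum₂_add _ _ _ _)
      exact Finset.sum_congr rfl fun s _ => Finset.sum_congr rfl fun t _ => mul_add _ (g _) (g' _))
    (fun c f g => funext fun ab => by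
      refine Eq.trans ?_ (sum₂_mul c _ _ _)
      refine Finset.sum_congr rfl fun s _ => Finset.sum_congr rfl fun t _ => ?_
      exact mul_left_comm _ c (g _))

instance : Mul (Ser K) := ⟨fun f g => serMul K f g⟩

/-- The monomial `x^α y^β`. -/
def serMono (a : Finset ℕ × Finset ℕ) : Ser K := fun b => if b = a then 1 else 0

instance : One (Ser K) := ⟨serMono K (∅, ∅)⟩

/-- The partial (left) superderivative with respect to `x_i`. -/
def dx (i : ℕ) : Ser K →ₗ[K] Ser K where
  toFun f ab := if i ∈ ab.1 then 0 else
    (-1) ^ (ab.1.filter (· < i)).card * f (insert i ab.1, ab.2)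
  map_add' f g := funext fun ab => by
    by_cases h : i ∈ ab.1
    · exact (if_pos h).trans
        ((congrArg₂ (· + ·) (if_pos h) (if_pos h)).trans (add_zero _)).symm
    · exact (if_neg h).trans ((mul_add _ (f (insert i ab.1, ab.2)) (g (insert i ab.1, ab.2))).trans
        (congrArg₂ (· + ·) (if_neg h) (if_neg h)).symm)
  map_smul' c f := funext fun ab => by
    by_cases h : i ∈ ab.1
    · exact (if_pos h).trans ((congrArg (c * ·) (if_pos h)).trans (mul_zero c)).symm
    · exact (if_neg h).trans ((mul_left_comm _ c (f (insert i ab.1, ab.2))).trans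
        (congrArg (c * ·) (if_neg h)).symm)

/-- The partial (left) superderivative with respect to `y_i`. -/
def dy (i : ℕ) : Ser K →ₗ[K] Ser K where
  toFun f ab := if i ∈ ab.2 then 0 else
    (-1) ^ (ab.1.card + (ab.2.filter (· < i)).card) * f (ab.1, insert i ab.2)
  map_add' f g := funext fun ab => by
    by_cases h : i ∈ ab.2
    · exact (if_pos h).trans
        ((congrArg₂ (· + ·) (if_pos h) (if_pos h)).trans (add_zero _)).symm
    · exact (if_neg h).trans ((mul_add _ (f (ab.1, insert i ab.2)) (g (ab.1, insert i ab.2))).trans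
        (congrArg₂ (· + ·) (if_neg h) (if_neg h)).symm)
  map_smul' c f := funext fun ab => by
    by_cases h : i ∈ ab.2
    · exact (if_pos h).trans ((congrArg (c * ·) (if_pos h)).trans (mul_zero c)).symm
    · exact (if_neg h).trans ((mul_left_comm _ c (f (ab.1, insert i ab.2))).trans
        (congrArg (c * ·) (if_neg h)).symm)

/-- The linear map that multiplies a homogeneous `f` by `(-1)^{|f| - 1}`. -/
def parSign : Ser K →ₗ[K] Ser K where
  toFun f ab := (-1) ^ (ab.1.card + ab.2.card + 1) * f ab
  map_add' f g := funext fun ab => mul_add _ (f ab) (g ab)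
  map_smul' c f := funext fun ab => mul_left_comm _ c (f ab)

/-- The `i`th term `(-1)^{|f|-1} (∂f/∂x_i ∂g/∂y_i + ∂f/∂y_i ∂g/∂x_i)` of the Poisson bracket. -/
def brTerm (i : ℕ) : Ser K →ₗ[K] Ser K →ₗ[K] Ser K :=
  (serMul K).compl₁₂ (dx K i ∘ₗ parSign K) (dy K i) +
    (serMul K).compl₁₂ (dy K i ∘ₗ parSign K) (dx K i)

/-- The Poisson bracket `{f, g} = (-1)^{|f|-1} ∑_i (∂f/∂x_i ∂g/∂y_i + ∂f/∂y_i ∂g/∂x_i)`.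
In the coefficient of `x^α y^β` only the terms with `i ≤ max β` are summed; on the completion
`hTilde` the remaining terms vanish, see `brTerm_eq_zero`. -/
def serBr : Ser K →ₗ[K] Ser K →ₗ[K] Ser K :=
  LinearMap.mk₂ K
    (fun f g ab => ∑ i ∈ Finset.range (ab.2.sup id + 1), brTerm K i f g ab)
    (fun f f' g => funext fun ab => by
      refine Eq.trans (Finset.sum_congr rfl fun i _ => ?_) Finset.sum_add_distrib
      rw [map_add, LinearMap.add_apply]
      rfl)
    (fun c f g => funext fun ab => by
      refine Eq.trans (Finset.sum_congr rfl fun i _ => ?_) (Finset.mul_sum _ _ c).symm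
      rw [map_smul, LinearMap.smul_apply]
      rfl)
    (fun f g g' => funext fun ab => by
      refine Eq.trans (Finset.sum_congr rfl fun i _ => ?_) Finset.sum_add_distrib
      rw [map_add]
      rfl)
    (fun c f g => funext fun ab => by
      refine Eq.trans (Finset.sum_congr rfl fun i _ => ?_) (Finset.mul_sum _ _ c).symm
      rw [map_smul]
      rfl)

/-- The exponents allowed in the completion: `max α < max β`, or both are empty. -/
def Below (a : Finset ℕ × Finset ℕ) : Prop :=
  (a.1 = ∅ ∧ a.2 = ∅) ∨ ∃ j ∈ a.2, ∀ i ∈ a.1, i < j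

/-- The completion: the formal sums of the monomials `x^α y^β` with `max α < max β`, and the
unit. -/
def hTilde : Submodule K (Ser K) where
  carrier := {f | ∀ a, f a ≠ 0 → Below a}
  add_mem' {f g} hf hg a h := by
    by_cases h0 : f a = 0
    · refine hg a fun h1 => h ?_
      change f a + g a = 0
      rw [h0, h1, add_zero]
    · exact hf a h0
  zero_mem' _ h := absurd rfl h
  smul_mem' c f hf a h := hf a fun h0 => h (by change c * f a = 0; rw [h0, mul_zero])

theorem serMul_ne_zero {f g : Ser K} {ab : Finset ℕ × Finset ℕ} (h : serMul K f g ab ≠ 0) :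
    ∃ s ⊆ ab.1, ∃ t ⊆ ab.2, f (s, t) ≠ 0 ∧ g (ab.1 \ s, ab.2 \ t) ≠ 0 := by
  change (∑ s ∈ ab.1.powerset, ∑ t ∈ ab.2.powerset, _ * f (s, t) * g (ab.1 \ s, ab.2 \ t)) ≠ 0 at h
  obtain ⟨s, hs, h⟩ := Finset.exists_ne_zero_of_sum_ne_zero h
  obtain ⟨t, ht, h⟩ := Finset.exists_ne_zero_of_sum_ne_zero h
  exact ⟨s, Finset.mem_powerset.mp hs, t, Finset.mem_powerset.mp ht,
    right_ne_zero_of_mul (left_ne_zero_of_mul h), right_ne_zero_of_mul h⟩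

theorem dx_ne_zero {i : ℕ} {f : Ser K} {a : Finset ℕ × Finset ℕ} (h : dx K i f a ≠ 0) :
    f (insert i a.1, a.2) ≠ 0 := by
  change (if _ then _ else _) ≠ (0 : K) at h
  split_ifs at h
  · exact absurd rfl h
  · exact right_ne_zero_of_mul h

theorem dy_ne_zero {i : ℕ} {f : Ser K} {a : Finset ℕ × Finset ℕ} (h : dy K i f a ≠ 0) :
    f (a.1, insert i a.2) ≠ 0 := by
  change (if _ then _ else _) ≠ (0 : K) at h
  split_ifs at h
  · exact absurd rfl h
  · exact right_ne_zero_of_mul h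

theorem below_of_dx {i : ℕ} {f : Ser K} (hf : f ∈ hTilde K) {a : Finset ℕ × Finset ℕ}
    (h : dx K i f a ≠ 0) : ∃ j ∈ a.2, i < j ∧ ∀ k ∈ a.1, k < j := by
  rcases hf _ (dx_ne_zero K h) with h | ⟨j, hj, h⟩
  · exact absurd h.1 (Finset.insert_ne_empty _ _)
  · exact ⟨j, hj, h i (Finset.mem_insert_self _ _), fun k hk => h k (Finset.mem_insert_of_mem hk)⟩

theorem parSign_mem {f : Ser K} (hf : f ∈ hTilde K) : parSign K f ∈ hTilde K :=
  fun a h => hf a (right_ne_zero_of_mul h)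

theorem one_mem_hTilde : (1 : Ser K) ∈ hTilde K := by
  intro a h
  change (if a = (∅, ∅) then (1 : K) else 0) ≠ 0 at h
  split_ifs at h with h0
  · subst h0; exact Or.inl ⟨rfl, rfl⟩
  · exact absurd rfl h

theorem serMul_mem {f g : Ser K} (hf : f ∈ hTilde K) (hg : g ∈ hTilde K) :
    serMul K f g ∈ hTilde K := by
  intro ab h
  obtain ⟨s, hs, t, ht, h1, h2⟩ := serMul_ne_zero K h
  have hsplit : ∀ i ∈ ab.1, i ∈ s ∨ i ∈ ab.1 \ s := fun i hi => by
    by_cases h : i ∈ s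
    · exact Or.inl h
    · exact Or.inr (Finset.mem_sdiff.mpr ⟨hi, h⟩)
  rcases hf _ h1 with ⟨e1, e2⟩ | ⟨j, hj, hj'⟩
  · simp only at e1 e2
    subst e1 e2
    simpa using hg _ h2
  · rcases hg _ h2 with ⟨e1, e2⟩ | ⟨k, hk, hk'⟩
    · refine Or.inr ⟨j, ht hj, fun i hi => ?_⟩
      rcases hsplit i hi with h | h
      · exact hj' i h
      · simp only at e1
        rw [e1] at h
        exact absurd h (Finset.notMem_empty _)
    · rcases le_total j k with hjk | hjk
      · refine Or.inr ⟨k, (Finset.mem_sdiff.mp hk).1, fun i hi => ?_⟩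
        rcases hsplit i hi with h | h
        · exact lt_of_lt_of_le (hj' i h) hjk
        · exact hk' i h
      · refine Or.inr ⟨j, ht hj, fun i hi => ?_⟩
        rcases hsplit i hi with h | h
        · exact hj' i h
        · exact lt_of_lt_of_le (hk' i h) hjk

theorem brTerm_ne_zero {f g : Ser K} (hf : f ∈ hTilde K) (hg : g ∈ hTilde K) {i : ℕ}
    {ab : Finset ℕ × Finset ℕ} (h : brTerm K i f g ab ≠ 0) :
    ∃ j ∈ ab.2, i < j ∧ ∀ k ∈ ab.1, k < j := by
  have key : ∀ (s t s' t' : Finset ℕ) (f g : Ser K), f ∈ hTilde K → g ∈ hTilde K →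
      (∀ k ∈ ab.1, k ∈ s ∨ k ∈ s') → t ⊆ ab.2 → t' ⊆ ab.2 →
      dx K i f (s, t) ≠ 0 → dy K i g (s', t') ≠ 0 → ∃ j ∈ ab.2, i < j ∧ ∀ k ∈ ab.1, k < j := by
    intro s t s' t' f g hf hg hss ht ht' h1 h2
    obtain ⟨j, hj, hij, hj'⟩ := below_of_dx K hf h1
    rcases hg _ (dy_ne_zero K h2) with ⟨_, e⟩ | ⟨l, hl, hl'⟩
    · exact absurd e (Finset.insert_ne_empty _ _)
    · rcases le_or_gt l j with hlj | hlj
      · refine ⟨j, ht hj, hij, fun k hk => ?_⟩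
        rcases hss k hk with h | h
        · exact hj' k h
        · exact lt_of_lt_of_le (hl' k h) hlj
      · have hlt : l ∈ t' := by
          rcases Finset.mem_insert.mp hl with h | h
          · omega
          · exact h
        refine ⟨l, ht' hlt, hij.trans hlj, fun k hk => ?_⟩
        rcases hss k hk with h | h
        · exact (hj' k h).trans hlj
        · exact hl' k h
  have hsplit : ∀ s : Finset ℕ, ∀ k ∈ ab.1, k ∈ s ∨ k ∈ ab.1 \ s := fun s k hk => by
    by_cases h : k ∈ s
    · exact Or.inl h
    · exact Or.inr (Finset.mem_sdiff.mpr ⟨hk, h⟩)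
  change serMul K (dx K i (parSign K f)) (dy K i g) ab +
    serMul K (dy K i (parSign K f)) (dx K i g) ab ≠ 0 at h
  by_cases h0 : serMul K (dx K i (parSign K f)) (dy K i g) ab = 0
  · rw [h0, zero_add] at h
    obtain ⟨s, _, t, ht, h1, h2⟩ := serMul_ne_zero K h
    exact key _ _ _ _ _ _ hg (parSign_mem K hf) (fun k hk => (hsplit s k hk).symm)
      Finset.sdiff_subset ht h2 h1
  · obtain ⟨s, _, t, ht, h1, h2⟩ := serMul_ne_zero K h0
    exact key _ _ _ _ _ _ (parSign_mem K hf) hg (hsplit s) ht Finset.sdiff_subset h1 h2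

/-- The terms of the bracket that are left out in `serBr` vanish on the completion. -/
theorem brTerm_eq_zero {f g : Ser K} (hf : f ∈ hTilde K) (hg : g ∈ hTilde K) {i : ℕ}
    {ab : Finset ℕ × Finset ℕ} (hi : i ∉ Finset.range (ab.2.sup id + 1)) :
    brTerm K i f g ab = 0 := by
  by_contra h
  obtain ⟨j, hj, hij, _⟩ := brTerm_ne_zero K hf hg h
  have := Finset.le_sup (f := id) hj
  simp only [id, Finset.mem_range] at this hi
  omega

theorem serBr_mem {f g : Ser K} (hf : f ∈ hTilde K) (hg : g ∈ hTilde K) :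
    serBr K f g ∈ hTilde K := by
  intro ab h
  change (∑ i ∈ Finset.range (ab.2.sup id + 1), brTerm K i f g ab) ≠ 0 at h
  obtain ⟨i, _, h⟩ := Finset.exists_ne_zero_of_sum_ne_zero h
  obtain ⟨j, hj, _, h⟩ := brTerm_ne_zero K hf hg h
  exact Or.inr ⟨j, hj, h⟩

/-- The letter `x_i`. -/
def serX (i : ℕ) : Ser K := serMono K ({i}, ∅)

open Classical in
/-- The pivot element `V_i = y_i + x_i x_{i+1} (y_{i+3} + x_{i+3} x_{i+4} (y_{i+6} + ⋯))`. -/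
def serV (i : ℕ) : Ser K := fun ab => if ∃ k, ab = (pivotTail i k, {i + 3 * k}) then 1 else 0

theorem serV_mem (i : ℕ) : serV K i ∈ hTilde K := by
  intro ab h
  unfold serV at h
  split_ifs at h with h0
  · obtain ⟨k, rfl⟩ := h0
    refine Or.inr ⟨i + 3 * k, Finset.mem_singleton_self _, fun l hl => ?_⟩
    simp only [pivotTail, Finset.mem_biUnion, Finset.mem_range, Finset.mem_insert,
      Finset.mem_singleton] at hl
    obtain ⟨a, ha, hl⟩ := hl
    omega
  · exact absurd rfl h

/-- `S` is closed under the operations of a Poisson algebra with unit and contains the pivot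
elements `V_0, V_1, V_2`. -/
def IsPoissonClosed (S : Submodule K (Ser K)) : Prop :=
  1 ∈ S ∧ serV K 0 ∈ S ∧ serV K 1 ∈ S ∧ serV K 2 ∈ S ∧
    ∀ f ∈ S, ∀ g ∈ S, serMul K f g ∈ S ∧ serBr K f g ∈ S

/-- The Poisson subalgebra generated by `V_0, V_1, V_2`. -/
def poisson : Submodule K (Ser K) := sInf {S | IsPoissonClosed K S}

theorem poisson_closed : IsPoissonClosed K (poisson K) := by
  refine ⟨?_, ?_, ?_, ?_, fun f hf g hg => ⟨?_, ?_⟩⟩ <;>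
    refine Submodule.mem_sInf.mpr fun S hS => ?_
  · exact hS.1
  · exact hS.2.1
  · exact hS.2.2.1
  · exact hS.2.2.2.1
  · exact (hS.2.2.2.2 f (Submodule.mem_sInf.mp hf S hS) g (Submodule.mem_sInf.mp hg S hS)).1
  · exact (hS.2.2.2.2 f (Submodule.mem_sInf.mp hf S hS) g (Submodule.mem_sInf.mp hg S hS)).2

theorem poisson_le_hTilde : poisson K ≤ hTilde K :=
  sInf_le ⟨one_mem_hTilde K, serV_mem K 0, serV_mem K 1, serV_mem K 2,
    fun _ hf _ hg => ⟨serMul_mem K hf hg, serBr_mem K hf hg⟩⟩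

/-- The unit of the Poisson subalgebra. -/
def pOne : poisson K := ⟨1, (poisson_closed K).1⟩

/-- The associative product of the Poisson subalgebra. -/
def pMul : poisson K →ₗ[K] poisson K →ₗ[K] poisson K :=
  LinearMap.mk₂ K (fun f g => ⟨serMul K f g, ((poisson_closed K).2.2.2.2 f f.2 g g.2).1⟩)
    (fun f f' g => Subtype.ext (by simp)) (fun c f g => Subtype.ext (by simp))
    (fun f g g' => Subtype.ext (by simp)) (fun c f g => Subtype.ext (by simp))

/-- The bracket of the Poisson subalgebra. -/
def pBr : poisson K →ₗ[K] poisson K →ₗ[K] poisson K :=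
  LinearMap.mk₂ K (fun f g => ⟨serBr K f g, ((poisson_closed K).2.2.2.2 f f.2 g g.2).2⟩)
    (fun f f' g => Subtype.ext (by simp)) (fun c f g => Subtype.ext (by simp))
    (fun f g g' => Subtype.ext (by simp)) (fun c f g => Subtype.ext (by simp))

/-- The formal sums of monomials of parity `i`. -/
def serPar (i : ZMod 2) : Submodule K (Ser K) where
  carrier := {f | ∀ a, f a ≠ 0 → ((a.1.card + a.2.card : ℕ) : ZMod 2) = i}
  add_mem' {f g} hf hg a h := by
    by_cases h0 : f a = 0
    · refine hg a fun h1 => h ?_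
      change f a + g a = 0
      rw [h0, h1, add_zero]
    · exact hf a h0
  zero_mem' _ h := absurd rfl h
  smul_mem' c f hf a h := hf a fun h0 => h (by change c * f a = 0; rw [h0, mul_zero])

/-- The homogeneous parts of the Poisson subalgebra. -/
def pPar (i : ZMod 2) : Submodule K (poisson K) := (serPar K i).submoduleOf (poisson K)

/-- The monomial `x^α V_n`. -/
def pMon (w : ℕ × Finset ℕ) : Ser K := monoProd (serX K) (serV K) w.1 w.2 ∅

/-- The span of the `m`-fold products of the monomials `x^α V_n` that correspond to the standard
monomials. -/
def pPiece (m : ℕ) : Submodule K (Ser K) :=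
  Submodule.span K {f | ∃ l : List (ℕ × Finset ℕ), l.length = m ∧
    (∀ w ∈ l, Standard w.1 w.2) ∧ f = (l.map (pMon K)).prod}

end PivotAlg

end

open PivotAlg

/-! Degrees. Let $v_n$ have degree `deg n` and $x_n$ degree `-deg n`. The recursion for `deg` makes
$v_n=\partial_n+x_nx_{n+1}v_{n+3}$ homogeneous, and the false monomials turn out to be exactly those
of the two shapes with negative degree (`standard_iff`). A standard monomial is thus given by a
shape and one inequality. Both survive the two operations that occur in a bracket: replacing a
letter $x_{n+3r}$ by the corresponding tail of $v_n$, and multiplying by $[v_n,v_k]=u\,x^Cv_L$. So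
the span of the standard monomials is closed under brackets (`PivotSys.br_stdMon_mem`). Conversely,
suitable brackets produce every standard monomial from $v_0,v_1,v_2$ (`PivotSys.stdMon_mem_of_gen`).

Pairs. These computations use only relations shared by the operators with the supercommutator and
the formal sums with the Poisson bracket (`PivotSys`). They are therefore carried out once, in the
product of the two algebras, where a pair stands for an operator and its symbol. The space `symSpan
m` is spanned by the pairs of $m$-fold products of standard monomials and by the pairs $(a,0)$ with
$a\in\mathbf A^{m-1}$. Modulo the latter, factors supercommute, and two factors of equal length
multiply to zero, since $v_n^2=x_{n+1}v_{n+3}$ while $V_n^2=0$. Hence every product reduces to a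
multiple of a pair $(x^\alpha v^\beta,x^\alpha V^\beta)$, where $\alpha$ is a disjoint union of
standard exponents (`ordProd_wMon`, `symSpan_eq`). That these exponents are the admissible ones is
finite combinatorics: each letter $x_i$ has to be assigned to a factor able to carry it
(`Mono.admissible_iff`).

Independence. For arbitrary $\alpha,\beta$ the monomials are linearly independent in both algebras;
a chain of left ideals peels off the largest $v_n$ (`linearIndependent_of_chain`). This yields both
bases. It also shows that for a pair in `symSpan m` the operator lies in $\mathbf A^{m-1}$ if and
only if the symbol is zero. The projections of `symSpan m` to $\mathbf A_m$ and to $\mathbf P_m$ are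
thus surjections with the same kernel, and this gives $\rho_m$ (`exists_symbolEquiv`).

Bracket. By the Leibniz rule the bracket of an $l$-fold and an $l'$-fold product is a combination of
$(l+l'-1)$-fold products, with the same coefficients in both components (`eBr_wProd`). So the symbol
of a supercommutator is the Poisson bracket of the symbols. The Jacobi identity in $\mathbf P$ is
inherited from the operators: the Jacobi expression of three pairs lies two degrees lower and has
operator component zero, so its symbol vanishes (`serBr_jacobi`). The structure on
$\operatorname{gr}\mathbf A$ is then transported from $\mathbf P$. -/

noncomputable section

namespace PivotAlg

/-! ### Degrees of the standard monomials -/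

/-- The degree with respect to `v_0` of `v_n` (the letter `x_n` has the opposite degree). -/
def deg : ℕ → ℕ
  | 0 => 1
  | 1 => 0
  | 2 => 0
  | n + 3 => 2 * deg n + deg (n + 1)

theorem deg_add_three (n : ℕ) : deg (n + 3) = 2 * deg n + deg (n + 1) := rfl

/-- The recursion says `2 * deg n = deg (n + 3) - deg (n + 1)`, so the doubled sum telescopes. -/
theorem two_mul_sum_deg (n : ℕ) : 2 * ∑ i ∈ Finset.range n, deg i = deg (n + 2) + deg (n + 1) := by
  induction n with
  | zero => rfl
  | succ n ih => rw [Finset.sum_range_succ, mul_add, ih, deg_add_three]; ring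

/-- The sequence begins 1, 0, 0, 2, 0, 2, 4, 2, 8, 10, 12, and its failure to be monotone before
index 7 is the origin of the finitely many exceptions. From there on the recursion propagates
monotonicity. -/
theorem deg_le_deg_succ {n : ℕ} (hn : 7 ≤ n) : deg n ≤ deg (n + 1) := by
  induction n using Nat.strong_induction_on with
  | _ n ih =>
    by_cases h : n < 10
    · interval_cases n <;> decide
    · obtain ⟨m, rfl⟩ : ∃ m, n = m + 3 := ⟨n - 3, by omega⟩
      rw [show m + 3 + 1 = m + 1 + 3 by ring, deg_add_three, deg_add_three]
      have := ih m (by omega) (by omega)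
      have := ih (m + 1) (by omega) (by omega)
      omega

theorem sum_deg_union_le (s t : Finset ℕ) :
    ∑ i ∈ s ∪ t, deg i ≤ ∑ i ∈ s, deg i + ∑ i ∈ t, deg i := by
  rw [← Finset.sum_union_inter]; omega

theorem sum_deg_le {s t : Finset ℕ} (h : s ⊆ t) : (∑ i ∈ s, deg i) ≤ (∑ i ∈ t, deg i) :=
  Finset.sum_le_sum_of_subset h

/-- The shape of the standard monomials of the first and of the second type. -/
def Shape (n : ℕ) (α : Finset ℕ) : Prop :=
  (∀ i ∈ α, i + 3 ≤ n) ∨ (3 ≤ n ∧ n - 2 ∈ α ∧ ∀ i ∈ α, i ≠ n - 2 → i + 5 ≤ n)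

/-- For $n\ge 8$ all letters $x_0,\dots,x_{n-3}$ together weigh half of `deg n + deg (n - 1)`, which
is at most `deg n`. Below 8 this crude bound fails only for $n=4$ and $n=7$, the lengths of the
false monomials. -/
theorem sum_deg_le_of_first {n : ℕ} {α : Finset ℕ} (h : ∀ i ∈ α, i + 3 ≤ n)
    (h4 : ¬(n = 4 ∧ 0 ∈ α)) (h7 : ¬(n = 7 ∧ 0 ∈ α ∧ 3 ∈ α)) : (∑ i ∈ α, deg i) ≤ deg n := by
  have hs : α ⊆ Finset.range (n - 2) := fun i hi => by
    have := h i hi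
    simp; omega
  by_cases hn : n < 8
  · have h' := sum_deg_le hs
    interval_cases n <;> try exact h'.trans (by decide)
    · have h0 : 0 ∉ α := by simpa using h4
      refine (sum_deg_le (t := {1}) fun i hi => ?_).trans (by decide)
      have := h i hi
      have : i ≠ 0 := fun h => h0 (h ▸ hi)
      simp; omega
    · by_cases h0 : 0 ∈ α
      · have h3 : 3 ∉ α := by simpa [h0] using h7
        refine (sum_deg_le (t := {0, 1, 2, 4}) fun i hi => ?_).trans (by decide)
        have := h i hi
        have : i ≠ 3 := fun h => h3 (h ▸ hi)
        simp; omega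
      · refine (sum_deg_le (t := {1, 2, 3, 4}) fun i hi => ?_).trans (by decide)
        have := h i hi
        have : i ≠ 0 := fun h => h0 (h ▸ hi)
        simp; omega
  · have h1 := two_mul_sum_deg (n - 2)
    have h2 := deg_le_deg_succ (n := n - 1) (by omega)
    have h3 := sum_deg_le hs
    rw [show n - 2 + 2 = n by omega, show n - 2 + 1 = n - 1 by omega] at h1
    rw [show n - 1 + 1 = n by omega] at h2
    omega

/-- For $n\ge 12$ the block $x_0\cdots x_{n-5}$ weighs half of `deg (n - 2) + deg (n - 3)`, and `deg
(n - 2)` is at most three times `deg (n - 3)` by the recursion and monotonicity. The crude bound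
fails only for $n=5,7,10$. -/
theorem sum_deg_le_of_second {n : ℕ} {α : Finset ℕ} (hn : 3 ≤ n)
    (h : ∀ i ∈ α, i ≠ n - 2 → i + 5 ≤ n) (h5 : ¬(n = 5 ∧ 0 ∈ α)) (h7 : ¬(n = 7 ∧ 0 ∈ α))
    (h10 : ¬(n = 10 ∧ 0 ∈ α ∧ 3 ∈ α ∧ 5 ∈ α)) : (∑ i ∈ α, deg i) ≤ deg n := by
  have hs : α ⊆ insert (n - 2) (Finset.range (n - 4)) := fun i hi => by
    have := h i hi
    simp; omega
  by_cases hn : n < 12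
  · have h' := sum_deg_le hs
    interval_cases n <;> try exact h'.trans (by decide)
    · have h0 : 0 ∉ α := by simpa using h5
      refine (sum_deg_le (t := {3}) fun i hi => ?_).trans (by decide)
      have := h i hi
      have : i ≠ 0 := fun h => h0 (h ▸ hi)
      simp; omega
    · have h0 : 0 ∉ α := by simpa using h7
      refine (sum_deg_le (t := {1, 2, 5}) fun i hi => ?_).trans (by decide)
      have := h i hi
      have : i ≠ 0 := fun h => h0 (h ▸ hi)
      simp; omega
    · have key : ∀ j, j = 0 ∨ j = 3 ∨ j = 5 → j ∉ α → (∑ i ∈ α, deg i) ≤ deg 10 := by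
        intro j hj hjα
        refine (sum_deg_le (t := ({0, 1, 2, 3, 4, 5, 8} : Finset ℕ).erase j)
          fun i hi => ?_).trans (by rcases hj with rfl | rfl | rfl <;> decide)
        have := h i hi
        have : i ≠ j := fun h => hjα (h ▸ hi)
        simp; omega
      by_cases h0 : 0 ∈ α
      · by_cases h3 : 3 ∈ α
        · exact key 5 (by simp) (by simpa [h0, h3] using h10)
        · exact key 3 (by simp) h3
      · exact key 0 (by simp) h0
  · have h1 := two_mul_sum_deg (n - 4)
    have h2 := deg_le_deg_succ (n := n - 4) (by omega)
    have h3 := (sum_deg_le hs).trans (sum_deg_union_le {n - 2} (Finset.range (n - 4)))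
    rw [Finset.sum_singleton] at h3
    have h4 := deg_add_three (n - 3)
    have h5 := deg_add_three (n - 5)
    have h6 := deg_le_deg_succ (n := n - 5) (by omega)
    rw [show n - 4 + 2 = n - 2 by omega, show n - 4 + 1 = n - 3 by omega] at h1
    rw [show n - 3 + 3 = n by omega, show n - 3 + 1 = n - 2 by omega] at h4
    rw [show n - 5 + 3 = n - 2 by omega, show n - 5 + 1 = n - 4 by omega] at h5
    rw [show n - 4 + 1 = n - 3 by omega] at h2
    rw [show n - 5 + 1 = n - 4 by omega] at h6
    omega

/-- This replaces the list of exceptions by one additive inequality, which is what makes closure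
under substitution and bracket accessible. For the converse each false monomial contains a set of
letters that is already too heavy. -/
theorem standard_iff {n : ℕ} {α : Finset ℕ} :
    Standard n α ↔ Shape n α ∧ ∑ i ∈ α, deg i ≤ deg n := by
  constructor
  · rintro (⟨h, h4, h7⟩ | ⟨⟨h3, hn, h⟩, h5, h7, h10⟩)
    · exact ⟨Or.inl h, sum_deg_le_of_first h h4 h7⟩
    · exact ⟨Or.inr ⟨h3, hn, h⟩, sum_deg_le_of_second h3 h h5 h7 h10⟩
  · have key : ∀ t : Finset ℕ, t ⊆ α → deg n < (∑ i ∈ t, deg i) → ¬(∑ i ∈ α, deg i) ≤ deg n :=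
      fun t ht h h' => absurd ((sum_deg_le ht).trans h') (not_le.mpr h)
    rintro ⟨h | ⟨h3, hn, h⟩, hd⟩
    · refine Or.inl ⟨h, ?_, ?_⟩
      · rintro ⟨rfl, h0⟩
        exact key {0} (by simpa using h0) (by decide) hd
      · rintro ⟨rfl, h0, h3⟩
        exact key {0, 3} (by simp [Finset.insert_subset_iff, *]) (by decide) hd
    · refine Or.inr ⟨⟨h3, hn, h⟩, ?_, ?_, ?_⟩
      · rintro ⟨rfl, h0⟩
        exact key {0, 3} (by simp [Finset.insert_subset_iff, *]) (by decide) hd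
      · rintro ⟨rfl, h0⟩
        exact key {0, 5} (by simp [Finset.insert_subset_iff, *]) (by decide) hd
      · rintro ⟨rfl, h0, h3, h5⟩
        exact key {0, 3, 5, 8} (by simp [Finset.insert_subset_iff, *]) (by decide) hd

theorem Standard.add_two_le {n : ℕ} {α : Finset ℕ} (h : Standard n α) :
    ∀ i ∈ α, i + 2 ≤ n := by
  intro i hi
  rcases (standard_iff.mp h).1 with h | ⟨h3, _, h⟩
  · have := h i hi; omega
  · have := h i hi; omega

theorem standard_empty (n : ℕ) : Standard n ∅ := standard_iff.mpr ⟨Or.inl (by simp), by simp⟩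

/-! ### Tails of the pivot elements, and operations preserving standard monomials -/

theorem pivotTail_zero (n : ℕ) : pivotTail n 0 = ∅ := rfl

theorem mem_pivotTail {n r i : ℕ} :
    i ∈ pivotTail n r ↔ ∃ l < r, i = n + 3 * l ∨ i = n + 3 * l + 1 := by
  simp [pivotTail]

theorem pivotTail_succ (n r : ℕ) :
    pivotTail n (r + 1) = insert n (insert (n + 1) (pivotTail (n + 3) r)) := by
  ext i
  simp only [mem_pivotTail, Finset.mem_insert]
  constructor
  · rintro ⟨l, hl, h⟩
    rcases Nat.eq_zero_or_pos l with rfl | hl'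
    · omega
    · exact Or.inr (Or.inr ⟨l - 1, by omega, by omega⟩)
  · rintro (h | h | ⟨l, hl, h⟩)
    · exact ⟨0, by omega, by omega⟩
    · exact ⟨0, by omega, by omega⟩
    · exact ⟨l + 1, by omega, by omega⟩

theorem le_of_mem_pivotTail {n r i : ℕ} (h : i ∈ pivotTail n r) : n ≤ i ∧ i + 2 ≤ n + 3 * r := by
  obtain ⟨l, hl, h⟩ := mem_pivotTail.mp h
  omega

/-- Homogeneity of the pivot element: every term of $v_n$ has the same degree as its leading term
$\partial_n$. -/
theorem sum_deg_pivotTail (n r : ℕ) : (∑ i ∈ (pivotTail n r), deg i) + deg n = deg (n + 3 * r) := by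
  induction r generalizing n with
  | zero => simp [pivotTail_zero]
  | succ r ih =>
    have h1 : n + 1 ∉ pivotTail (n + 3) r := fun h => by have := le_of_mem_pivotTail h; omega
    have h2 : n ∉ insert (n + 1) (pivotTail (n + 3) r) := fun h => by
      rcases Finset.mem_insert.mp h with h | h
      · omega
      · have := le_of_mem_pivotTail h; omega
    have := ih (n + 3)
    rw [deg_add_three] at this
    rw [pivotTail_succ, Finset.sum_insert h2, Finset.sum_insert h1,
      show n + 3 * (r + 1) = n + 3 + 3 * r by ring]
    omega

/-- Substitution of the tail of `v_n` for a letter of a standard monomial. -/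
theorem Standard.subst {n k r : ℕ} {a b : Finset ℕ} (ha : Standard n a) (hb : Standard k b)
    (hj : n + 3 * r ∈ b) : Standard k (a ∪ (pivotTail n r ∪ b.erase (n + 3 * r))) := by
  have ha2 := ha.add_two_le
  have hb2 := hb.add_two_le
  obtain ⟨-, da⟩ := standard_iff.mp ha
  obtain ⟨sb, db⟩ := standard_iff.mp hb
  refine standard_iff.mpr ⟨?_, ?_⟩
  · have hcases : ∀ i ∈ a ∪ (pivotTail n r ∪ b.erase (n + 3 * r)),
        i + 2 ≤ n + 3 * r ∨ (i ∈ b ∧ i ≠ n + 3 * r) := by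
      intro i hi
      simp only [Finset.mem_union, Finset.mem_erase] at hi
      rcases hi with h | h | h
      · have := ha2 i h; omega
      · have := le_of_mem_pivotTail h; omega
      · exact Or.inr h.symm
    have hjk := hb2 _ hj
    rcases sb with h | ⟨h3, hk, h⟩
    · refine Or.inl fun i hi => ?_
      have := h _ hj
      rcases hcases i hi with h' | ⟨h', _⟩
      · omega
      · exact h i h'
    -- All new letters lie at least two below the replaced one. Replacing the top letter $x_{k-2}$
    -- therefore turns the second type into the first; replacing any other letter keeps the type.
    · by_cases hjk' : n + 3 * r = k - 2
      · refine Or.inl fun i hi => ?_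
        rcases hcases i hi with h' | ⟨h', h''⟩
        · omega
        · have := h i h' (by omega); omega
      · refine Or.inr ⟨h3, ?_, fun i hi hne => ?_⟩
        · simp [hk, Ne.symm hjk']
        · have := h _ hj hjk'
          rcases hcases i hi with h' | ⟨h', h''⟩
          · omega
          · exact h i h' hne
  -- The removed letter weighs as much as the tail and $v_n$ together, and $v_n$ outweighs the
  -- letters in `a`.
  · have h1 := sum_deg_union_le a (pivotTail n r ∪ b.erase (n + 3 * r))
    have h2 := sum_deg_union_le (pivotTail n r) (b.erase (n + 3 * r))
    have h3 := sum_deg_pivotTail n r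
    have h4 := Finset.add_sum_erase b (fun i => deg i) hj
    omega

/-- `x^C v_L` has the shape and the degree of the bracket of `v_n` and `v_k`. -/
structure IsPivotBracket (n k : ℕ) (C : Finset ℕ) (L : ℕ) : Prop where
  deg_eq : (∑ i ∈ C, deg i) + deg n + deg k = deg L
  le : ∀ i ∈ C, n ≤ i
  -- The recursion of step three ends in $[v_k,v_k]$, $[v_{k-1},v_k]$ or $[v_{k-2},v_k]$. These give
  -- the three alternatives in this order; only the first one is of the second type.
  shape : (L = k + 3 ∧ k + 1 ∈ C ∧ ∀ i ∈ C, i ≠ k + 1 → i + 2 ≤ k) ∨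
    (L = k + 2 ∧ ∀ i ∈ C, i + 1 ≤ k) ∨ (L = k + 3 ∧ ∀ i ∈ C, i ≤ k)

/-- Mirrors $[v_n,v_k]=x_nx_{n+1}[v_{n+3},v_k]$: the difference of the degrees of $v_{n+3}$ and
$v_n$ pays for the two new letters. -/
theorem IsPivotBracket.step {n k L : ℕ} {C : Finset ℕ} (h : IsPivotBracket (n + 3) k C L)
    (hk : n + 3 ≤ k) : IsPivotBracket n k (insert n (insert (n + 1) C)) L := by
  have h1 : n + 1 ∉ C := fun h' => by have := h.le _ h'; omega
  have h2 : n ∉ insert (n + 1) C := fun h' => by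
    rcases Finset.mem_insert.mp h' with h' | h'
    · omega
    · have := h.le _ h'; omega
  refine ⟨?_, ?_, ?_⟩
  · have := h.deg_eq
    rw [deg_add_three] at this
    rw [Finset.sum_insert h2, Finset.sum_insert h1]
    omega
  · intro i hi
    simp only [Finset.mem_insert] at hi
    rcases hi with hi | hi | hi
    · omega
    · omega
    · have := h.le i hi; omega
  · rcases h.shape with ⟨hL, hC, h'⟩ | ⟨hL, h'⟩ | ⟨hL, h'⟩
    · refine Or.inl ⟨hL, by simp [hC], fun i hi hne => ?_⟩
      simp only [Finset.mem_insert] at hi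
      rcases hi with hi | hi | hi
      · omega
      · omega
      · exact h' i hi hne
    · refine Or.inr (Or.inl ⟨hL, fun i hi => ?_⟩)
      simp only [Finset.mem_insert] at hi
      rcases hi with hi | hi | hi
      · omega
      · omega
      · exact h' i hi
    · refine Or.inr (Or.inr ⟨hL, fun i hi => ?_⟩)
      simp only [Finset.mem_insert] at hi
      rcases hi with hi | hi | hi
      · omega
      · omega
      · exact h' i hi

/-- Degrees are additive, and repeated letters can only help. All letters of `a` and `b` have index
at most $k-2$, which fits into each of the possible shapes of length `L`. -/
theorem IsPivotBracket.standard {n k L : ℕ} {C a b : Finset ℕ} (h : IsPivotBracket n k C L)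
    (hnk : n ≤ k) (ha : Standard n a) (hb : Standard k b) : Standard L (a ∪ (b ∪ C)) := by
  have ha2 := ha.add_two_le
  have hb2 := hb.add_two_le
  obtain ⟨-, da⟩ := standard_iff.mp ha
  obtain ⟨-, db⟩ := standard_iff.mp hb
  refine standard_iff.mpr ⟨?_, ?_⟩
  · have hcases : ∀ i ∈ a ∪ (b ∪ C), i + 2 ≤ n ∨ i + 2 ≤ k ∨ i ∈ C := by
      intro i hi
      simp only [Finset.mem_union] at hi
      rcases hi with h | h | h
      · exact Or.inl (ha2 i h)
      · exact Or.inr (Or.inl (hb2 i h))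
      · exact Or.inr (Or.inr h)
    rcases h.shape with ⟨hL, hC, h'⟩ | ⟨hL, h'⟩ | ⟨hL, h'⟩
    · refine Or.inr ⟨by omega, ?_, fun i hi hne => ?_⟩
      · rw [show L - 2 = k + 1 by omega]; simp [hC]
      · rcases hcases i hi with h | h | h
        · omega
        · omega
        · have := h' i h (by omega); omega
    · refine Or.inl fun i hi => ?_
      rcases hcases i hi with h | h | h
      · omega
      · omega
      · have := h' i h; omega
    · refine Or.inl fun i hi => ?_
      rcases hcases i hi with h | h | h
      · omega
      · omega
      · have := h' i h; omega
  · have h1 := sum_deg_union_le a (b ∪ C)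
    have h2 := sum_deg_union_le b C
    have h3 := h.deg_eq
    omega

theorem isPivotBracket_self (k : ℕ) : IsPivotBracket k k {k + 1} (k + 3) :=
  ⟨by rw [Finset.sum_singleton, deg_add_three]; ring, by simp, Or.inl ⟨rfl, by simp, by simp⟩⟩

theorem isPivotBracket_one (k : ℕ) : IsPivotBracket k (k + 1) {k} (k + 3) :=
  ⟨by rw [Finset.sum_singleton, deg_add_three]; ring, by simp, Or.inr (Or.inl ⟨rfl, by simp⟩)⟩

theorem isPivotBracket_two (k : ℕ) : IsPivotBracket k (k + 2) {k, k + 1, k + 2} (k + 5) := by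
  refine ⟨?_, by simp, Or.inr (Or.inr ⟨rfl, by simp⟩)⟩
  rw [Finset.sum_insert (by simp), Finset.sum_insert (by simp), Finset.sum_singleton,
    show k + 5 = k + 2 + 3 by ring, deg_add_three, show k + 2 + 1 = k + 3 by ring, deg_add_three]
  ring

/-! ### Admissible monomials and products of standard monomials -/

theorem Mono.Excluded.n_le {m : Mono} (h : m.Excluded) : m.n ≤ 10 := by
  unfold Mono.Excluded at h
  omega

theorem finite_of_n_lt {S : Set Mono} (N : ℕ) (h : ∀ m ∈ S, m.n < N) : S.Finite := by
  let g : Mono → ℕ × Finset ℕ × Finset ℕ := fun m => (m.n, m.α, m.β)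
  have hg : Function.Injective g := fun m m' h => by
    simp only [g, Prod.mk.injEq] at h
    exact Mono.ext h.1 h.2.1 h.2.2
  refine Set.Finite.of_finite_image (f := g) (Set.Finite.subset (Finset.finite_toSet
    (Finset.range N ×ˢ ((Finset.range N).powerset ×ˢ (Finset.range N).powerset))) ?_)
    hg.injOn
  rintro _ ⟨m, hm, rfl⟩
  have hN := h m hm
  refine Finset.mem_coe.mpr (Finset.mem_product.mpr ⟨Finset.mem_range.mpr hN,
    Finset.mem_product.mpr ⟨Finset.mem_powerset.mpr fun i hi => ?_,
      Finset.mem_powerset.mpr fun i hi => ?_⟩⟩)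
  · have := m.hα i hi
    exact Finset.mem_range.mpr (by omega)
  · have := m.hβ i hi
    exact Finset.mem_range.mpr (by omega)

theorem finite_excluded : {m : Mono | m.Excluded}.Finite :=
  finite_of_n_lt 11 fun _ hm => Nat.lt_succ_of_le (Mono.Excluded.n_le hm)

theorem Standard.cases {j i : ℕ} {t : Finset ℕ} (h : Standard j t) (hi : i ∈ t) :
    i + 3 ≤ j ∨ (3 ≤ j ∧ i + 2 = j ∧ ∀ i' ∈ t, i' ≠ i → i' + 5 ≤ j) := by
  rcases (standard_iff.mp h).1 with h | ⟨h3, h2, h⟩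
  · exact Or.inl (h i hi)
  · by_cases hij : i = j - 2
    · subst hij
      exact Or.inr ⟨h3, by omega, h⟩
    · exact Or.inl (by have := h i hi hij; omega)

/-- Every exception involves $x_0$, so the exclusions can only be felt by the factor that contains
this letter. This collects what they say about it. -/
theorem Standard.zero_mem {j : ℕ} {t : Finset ℕ} (h : Standard j t) (h0 : 0 ∈ t) :
    3 ≤ j ∧ j ≠ 4 ∧ (j = 5 → 3 ∉ t) ∧ (j = 7 → 3 ∉ t ∧ 5 ∉ t) ∧
      (j = 10 → 8 ∈ t → ¬(3 ∈ t ∧ 5 ∈ t)) := by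
  rcases h with ⟨h, h4, h7⟩ | ⟨⟨h3, h2, h⟩, h5, h7, h10⟩
  · have := h 0 h0
    refine ⟨by omega, fun h => h4 ⟨h, h0⟩, fun h' h3 => ?_, fun h' => ⟨fun h3 => h7 ⟨h', h0, h3⟩,
      fun h5 => ?_⟩, fun h' h8 => ?_⟩
    · have := h 3 h3; omega
    · have := h 5 h5; omega
    · have := h 8 h8; omega
  · have := h 0 h0
    exact ⟨h3, fun h => by omega, fun h => absurd ⟨h, h0⟩ h5, fun h => absurd ⟨h, h0⟩ h7,
      fun h _ h' => h10 ⟨h, h0, h'⟩⟩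

/-- Each letter has an owner, the factor it comes from. Only $v_n$ can own $x_{n-2}$, only
$v_n,v_{n-1}$ can own $x_{n-3}$, only $v_n,v_{n-1},v_{n-2}$ can own $x_{n-4}$, and the owner $v_j$
of $x_{j-2}$ owns neither $x_{j-3}$ nor $x_{j-4}$. The general restrictions express a shortage of
owners, the exclusions the lack of an owner for $x_0$ compatible with the other letters. -/
theorem Mono.IsStandardProduct.admissible {m : Mono} (h : m.IsStandardProduct) :
    m.Admissible := by
  obtain ⟨s, hs, -, hα⟩ := h
  have mem : ∀ i ∈ m.α, ∃ j, (j = m.n ∨ j ∈ m.β) ∧ j ≤ m.n ∧ i ∈ s j ∧ Standard j (s j) ∧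
      (i + 3 ≤ j ∨ (3 ≤ j ∧ i + 2 = j ∧ ∀ i' ∈ s j, i' ≠ i → i' + 5 ≤ j)) := by
    intro i hi
    rw [hα, Finset.mem_biUnion] at hi
    obtain ⟨j, hj, hi⟩ := hi
    refine ⟨j, Finset.mem_insert.mp hj, ?_, hi, hs j hj, (hs j hj).cases hi⟩
    rcases Finset.mem_insert.mp hj with rfl | hj
    · exact le_rfl
    · exact (m.hβ j hj).le
  obtain ⟨n, α, β, h₁, h₂⟩ := m
  simp only at mem hs hα
  constructor
  · rintro ⟨h1, hb1⟩ hb2 ⟨⟨h4, ha4⟩, ⟨-, ha3⟩, ⟨-, ha2⟩⟩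
    simp only [At, not_and] at *
    -- $x_{n-2}$ occupies $v_n$, so $x_{n-3}$ falls to $v_{n-1}$ and occupies it, so $x_{n-4}$ needs
    -- the absent $v_{n-2}$.
    obtain ⟨j, hj, hjn, hi, st, c⟩ := mem _ ha2
    obtain ⟨j', hj', hjn', hi', st', c'⟩ := mem _ ha3
    obtain ⟨l, hl, hln, hil, stl, cl⟩ := mem _ ha4
    obtain rfl : j = n := by omega
    have hj1 : j' = j - 1 := by
      by_contra hne
      obtain rfl : j' = j := by omega
      rcases c with c | ⟨-, -, c⟩
      · omega
      · have := c _ hi' (by omega); omega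
    subst hj1
    have hl2 : l = j - 2 := by
      by_contra hne
      rcases (by omega : l = j ∨ l = j - 1) with rfl | rfl
      · rcases c with c | ⟨-, -, c⟩
        · omega
        · have := c _ hil (by omega); omega
      · rcases c' with c | ⟨-, -, c⟩
        · omega
        · have := c _ hil (by omega); omega
    subst hl2
    rcases hl with hl | hl
    · omega
    · exact hb2 (by omega) hl
  · rintro hb1 - ⟨⟨h3, ha3⟩, ⟨-, ha2⟩⟩
    simp only [At, not_and] at *
    obtain ⟨j, hj, hjn, hi, st, c⟩ := mem _ ha2
    obtain ⟨j', hj', hjn', hi', st', c'⟩ := mem _ ha3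
    obtain rfl : j = n := by omega
    rcases (by omega : j' = j ∨ j' = j - 1) with rfl | rfl
    · rcases c with c | ⟨-, -, c⟩
      · omega
      · have := c _ hi' (by omega); omega
    · rcases hj' with hj' | hj'
      · omega
      · exact hb1 (by omega) hj'
  · rintro hb1 hb2
    simp only [At, not_and] at *
    rw [or_iff_not_imp_left]
    simp only [not_forall, not_not]
    rintro ⟨h2, ha2⟩
    obtain ⟨j, hj, hjn, hi, st, c⟩ := mem _ ha2
    obtain rfl : j = n := by omega
    have key : ∀ i, j ≤ i + 4 → i + 3 ≤ j → i ∉ α := by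
      intro i hi1 hi2 hiα
      obtain ⟨l, hl, hln, hil, stl, cl⟩ := mem _ hiα
      rcases (by omega : l = j ∨ l = j - 1 ∨ l = j - 2) with rfl | rfl | rfl
      · rcases c with c | ⟨-, -, c⟩
        · omega
        · have := c _ hil (by omega); omega
      · rcases hl with hl | hl
        · omega
        · exact hb1 (by omega) hl
      · rcases hl with hl | hl
        · omega
        · exact hb2 (by omega) hl
    exact ⟨fun h => key _ (by omega) (by omega), fun h => key _ (by omega) (by omega)⟩
  · rintro (rfl : β = ∅)
    simp only at *
    rw [hα]
    simpa using hs
  · intro hex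
    -- Each excluded monomial contains $x_0$. Its possible owners are compared with those of the
    -- other letters named in the exclusion, which leaves finite case checks.
    have zero : 0 ∈ α → ∃ j, (j = n ∨ j ∈ β) ∧ j ≤ n ∧ 0 ∈ s j ∧ Standard j (s j) ∧ 3 ≤ j ∧ j ≠ 4 ∧
        (j = 5 → 3 ∉ s j) ∧ (j = 7 → 3 ∉ s j ∧ 5 ∉ s j) ∧
        (j = 10 → 8 ∈ s j → ¬(3 ∈ s j ∧ 5 ∈ s j)) ∧ (0 + 3 ≤ j ∨ (3 ≤ j ∧ 0 + 2 = j ∧ ∀ i' ∈ s j, i' ≠ 0 → i' + 5 ≤ j)) := fun h => by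
      obtain ⟨j, hj, hjn, hi, st, c⟩ := mem _ h
      have := st.zero_mem hi
      exact ⟨j, hj, hjn, hi, st, this.1, this.2.1, this.2.2.1, this.2.2.2.1, this.2.2.2.2, c⟩
    simp only [Mono.Excluded, Finset.insert_subset_iff, Finset.singleton_subset_iff] at hex
    have sub : ∀ t : Finset ℕ, β ⊆ t → ∀ j, j = n ∨ j ∈ β → j = n ∨ j ∈ t :=
      fun t ht j hj => hj.imp_right fun h => ht h
    rcases hex with ⟨rfl, h0⟩ | ⟨rfl, hb, h0, h1⟩ | ⟨rfl, hb, h0⟩ | ⟨rfl, hb, h0, h1, h2⟩ |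
      ⟨rfl, hb, h0, h3⟩ | ⟨rfl, hb, hb', h0, h1, h3⟩ | ⟨rfl, hb, hb', h0, h1, h2, h3⟩ |
      ⟨rfl, hb, ⟨h0, h3⟩ | ⟨h0, h5⟩⟩ | ⟨rfl, hb, -, h0, h3, h5⟩ | ⟨rfl, hb, h0, h3, h5, h8⟩ <;>
      obtain ⟨j, hj, hjn, hi, st, j3, j4, z5, z7, z10, c⟩ := zero h0
    · omega
    · obtain ⟨l, hl, hln, hil, stl, cl⟩ := mem _ h1
      clear mem zero sub hs hα
      grind (splits := 20)
    · clear mem zero sub hs hα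
      grind
    · obtain ⟨l, hl, hln, hil, stl, cl⟩ := mem _ h1
      obtain ⟨k, hk, hkn, hik, stk, ck⟩ := mem _ h2
      clear mem zero sub hs hα
      grind (splits := 20)
    · obtain ⟨l, hl, hln, hil, stl, cl⟩ := mem _ h3
      clear mem zero sub hs hα
      grind (splits := 20)
    · obtain ⟨l, hl, hln, hil, stl, cl⟩ := mem _ h1
      obtain ⟨k, hk, hkn, hik, stk, ck⟩ := mem _ h3
      clear mem zero sub hs hα
      grind (splits := 20)
    · obtain ⟨l, hl, hln, hil, stl, cl⟩ := mem _ h1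
      obtain ⟨k, hk, hkn, hik, stk, ck⟩ := mem _ h3
      obtain ⟨p, hp, hpn, hip, stp, cp⟩ := mem _ h2
      clear mem zero sub hs hα
      grind (splits := 20)
    · obtain ⟨l, hl, hln, hil, stl, cl⟩ := mem _ h3
      have := sub _ hb _ hl
      have := sub _ hb _ hj
      simp only [Finset.mem_insert, Finset.mem_singleton] at *
      clear mem zero sub hs hα h₁ h₂
      grind (splits := 20)
    · obtain ⟨l, hl, hln, hil, stl, cl⟩ := mem _ h5
      have := sub _ hb _ hl
      have := sub _ hb _ hj
      simp only [Finset.mem_insert, Finset.mem_singleton] at *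
      clear mem zero sub hs hα h₁ h₂
      grind (splits := 20)
    · obtain ⟨l, hl, hln, hil, stl, cl⟩ := mem _ h5
      obtain ⟨k, hk, hkn, hik, stk, ck⟩ := mem _ h3
      have := sub _ hb _ hl
      have := sub _ hb _ hj
      have := sub _ hb _ hk
      simp only [Finset.mem_insert, Finset.mem_singleton] at *
      clear mem zero sub hs hα h₁ h₂
      grind (splits := 20)
    · obtain ⟨l, hl, hln, hil, stl, cl⟩ := mem _ h5
      obtain ⟨k, hk, hkn, hik, stk, ck⟩ := mem _ h3
      obtain ⟨p, hp, hpn, hip, stp, cp⟩ := mem _ h8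
      have := sub _ hb _ hl
      have := sub _ hb _ hj
      have := sub _ hb _ hk
      have := sub _ hb _ hp
      simp only [Finset.mem_insert, Finset.mem_singleton] at *
      clear mem zero sub hs hα h₁ h₂
      grind (splits := 20)

/-- A factorisation is the same as a choice of an owner for each letter; disjointness of the
exponents is then automatic. -/
theorem Mono.isStandardProduct_of_owner (m : Mono) (f : ℕ → ℕ)
    (hf : ∀ i ∈ m.α, f i ∈ insert m.n m.β)
    (hs : ∀ j ∈ insert m.n m.β, Standard j (m.α.filter (f · = j))) : m.IsStandardProduct := by
  refine ⟨fun j => m.α.filter (f · = j), hs, fun j _ k _ hjk => ?_, ?_⟩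
  · refine Finset.disjoint_left.mpr fun i hi hi' => hjk ?_
    rw [← (Finset.mem_filter.mp hi).2, (Finset.mem_filter.mp hi').2]
  · ext i
    simp only [Finset.mem_biUnion, Finset.mem_filter]
    exact ⟨fun hi => ⟨f i, hf i hi, hi, rfl⟩, fun ⟨_, _, hi, _⟩ => hi⟩

theorem standard_of_first {j : ℕ} {t : Finset ℕ} (h : ∀ i ∈ t, i + 3 ≤ j)
    (h0 : 0 ∈ t → j ≠ 4 ∧ (j = 7 → 3 ∉ t)) : Standard j t :=
  Or.inl ⟨h, fun h' => (h0 h'.2).1 h'.1, fun h' => (h0 h'.2.1).2 h'.1 h'.2.2⟩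

theorem standard_of_second {j : ℕ} {t : Finset ℕ} (h3 : 3 ≤ j) (h2 : j - 2 ∈ t)
    (h : ∀ i ∈ t, i ≠ j - 2 → i + 5 ≤ j)
    (h0 : 0 ∈ t → j ≠ 5 ∧ j ≠ 7 ∧ (j = 10 → 3 ∈ t → 5 ∉ t)) : Standard j t :=
  Or.inr ⟨⟨h3, h2, h⟩, fun h' => (h0 h'.2).1 h'.1, fun h' => (h0 h'.2).2.1 h'.1,
    fun h' => (h0 h'.2.1).2.2 h'.1 h'.2.2.1 h'.2.2.2⟩

/-- No letter of the monomial is `x_{n-2}`. -/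
theorem Mono.Admissible.isStandardProduct_of_first {m : Mono} (h : m.Admissible)
    (hn : ∀ i ∈ m.α, i + 3 ≤ m.n) : m.IsStandardProduct := by
  obtain ⟨-, -, -, -, hex⟩ := h
  obtain ⟨n, α, β, h₁, h₂⟩ := m
  simp only [Mono.Excluded, Finset.insert_subset_iff, Finset.singleton_subset_iff, not_or,
    not_and] at *
  by_cases hsp : ¬(0 ∈ α ∧ (n = 4 ∨ n = 7 ∧ 3 ∈ α))
  · refine Mono.isStandardProduct_of_owner _ (fun _ => n) (by simp) fun j hj => ?_
    by_cases hjn : n = j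
    · subst hjn
      simp only [Finset.filter_true]
      exact standard_of_first hn fun h0 => ⟨fun h => hsp ⟨h0, Or.inl h⟩,
        fun h h3 => hsp ⟨h0, Or.inr ⟨h, h3⟩⟩⟩
    · simp only [hjn, Finset.filter_false]
      exact standard_empty j
  · rw [not_not] at hsp
    -- If giving all letters to $v_n$ produces a false monomial, only $x_0$ is moved, to a factor
    -- $v_z$ with $x_0v_z$ standard. Such a factor exists because the monomial is not excluded.
    obtain ⟨z, hz, hzn, z3, z4⟩ : ∃ z ∈ β, z < n ∧ 3 ≤ z ∧ z ≠ 4 := by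
      rcases hsp with ⟨h0, rfl | ⟨rfl, h3⟩⟩
      · exact ⟨3, by by_contra h; exact hex.2.2.1 rfl h h0, by omega, by omega, by omega⟩
      · by_contra! hz
        refine hex.2.2.2.2.2.2.2.1 rfl (fun i hi => ?_) |>.1 h0 h3
        have := hz i hi (h₂ i hi)
        have := h₂ i hi
        simp only [Finset.mem_insert, Finset.mem_singleton]
        omega
    refine Mono.isStandardProduct_of_owner _ (fun i => if i = 0 then z else n) ?_ fun j hj => ?_
    · intro i hi
      split_ifs <;> simp [hz]
    · refine standard_of_first (fun i hi => ?_) fun h0 => ?_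
      · have := hn i (Finset.mem_of_mem_filter i hi)
        have h' := (Finset.mem_filter.mp hi).2
        split_ifs at h' <;> omega
      · have h' := (Finset.mem_filter.mp h0).2
        rw [if_pos rfl] at h'
        subst h'
        refine ⟨z4, fun h h3 => ?_⟩
        have h' := (Finset.mem_filter.mp h3).2
        rw [if_neg (by omega)] at h'
        omega

-- The rule: $x_{n-3}$ goes to $v_{n-1}$; $x_{n-4}$ goes to $v_{n-2}$, or to $v_{n-1}$ as a
-- substitute; the rest goes to $v_n$. In the situation `S`, where $x_0$ would make the last factor
-- false, $x_0$ goes to $v_z$ instead.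
open Classical in
theorem owner_cases {n z j i : ℕ} {α β : Finset ℕ} {S : Prop} (hin : i + 2 ≤ n)
    (hz : S → z < n ∧ 3 ≤ z ∧ z ≠ 4 ∧ (n = 7 ∨ n = 10)) (h3 : i + 3 = n → 4 ≤ n)
    (h4 : i + 4 = n → ¬(n - 2 ∈ β ∧ n ≠ 4) → n - 3 ∉ α)
    (h : (if S ∧ i = 0 then z else if i + 3 = n then n - 1 else
        if i + 4 = n then (if n - 2 ∈ β ∧ n ≠ 4 then n - 2 else n - 1) else n) = j) :
    (S ∧ i = 0 ∧ z = j ∧ z < n ∧ 3 ≤ z ∧ z ≠ 4 ∧ (n = 7 ∨ n = 10)) ∨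
      (i + 3 = n ∧ j + 1 = n ∧ 4 ≤ n) ∨
      (i + 4 = n ∧ j + 2 = n ∧ 5 ≤ n) ∨ (i + 4 = n ∧ j + 1 = n ∧ n - 3 ∉ α) ∨
      (j = n ∧ (i + 2 = n ∨ i + 5 ≤ n) ∧ (i = 0 → ¬S)) := by
  split_ifs at h with c1 c2 c3 c4
  · exact Or.inl ⟨c1.1, c1.2, h, hz c1.1⟩
  · have := h3 c2
    exact Or.inr (Or.inl ⟨c2, by omega, by omega⟩)
  · exact Or.inr (Or.inr (Or.inl ⟨c3, by omega, by omega⟩))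
  · exact Or.inr (Or.inr (Or.inr (Or.inl ⟨c3, by omega, h4 c3 c4⟩)))
  · exact Or.inr (Or.inr (Or.inr (Or.inr ⟨h.symm, by omega, fun h0 hs => c1 ⟨hs, h0⟩⟩)))

/-- Under this rule $v_n$ is of the second type with top $x_{n-2}$. The factors $v_{n-1}$ and
$v_{n-2}$ carry at most $x_0$ beside their own top letters $x_{n-3}$ and $x_{n-4}$, and otherwise
all factors are of the first type. -/
theorem standard_of_owner_cases {n z j : ℕ} {α t : Finset ℕ} {S : Prop} (hn : 3 ≤ n)
    (hjn : j ≤ n) (ht : t ⊆ α)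
    (key : ∀ i ∈ t, (S ∧ i = 0 ∧ z = j ∧ z < n ∧ 3 ≤ z ∧ z ≠ 4 ∧ (n = 7 ∨ n = 10)) ∨
      (i + 3 = n ∧ j + 1 = n ∧ 4 ≤ n) ∨
      (i + 4 = n ∧ j + 2 = n ∧ 5 ≤ n) ∨ (i + 4 = n ∧ j + 1 = n ∧ n - 3 ∉ α) ∨
      (j = n ∧ (i + 2 = n ∨ i + 5 ≤ n) ∧ (i = 0 → ¬S)))
    (m2 : j = n → n - 2 ∈ t) (m3 : j + 1 = n → n - 3 ∈ α → 4 ≤ n → n - 3 ∈ t)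
    (m4 : j + 2 = n → n - 4 ∈ α → 5 ≤ n → n - 4 ∈ t)
    (h5 : 0 ∈ α → n ≠ 5) (hS : ¬S → 0 ∈ α → n ≠ 7 ∧ (n = 10 → 3 ∈ α → 5 ∉ α))
    (hz : S → n = 7 → z = 5 → 3 ∉ α) : Standard j t := by
  by_cases hjn' : j = n
  · subst hjn'
    refine standard_of_second hn (m2 rfl) (fun i hi hne => ?_) fun h0 => ?_
    · clear h5 hS hz m2 m3 m4
      rcases key i hi with h | h | h | h | h <;> omega
    · have hS' : ¬S := by
        rcases key 0 h0 with h | h | h | h | h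
        · omega
        · omega
        · omega
        · omega
        · exact h.2.2 rfl
      have := hS hS' (ht h0)
      exact ⟨h5 (ht h0), this.1, fun h h3 h5 => this.2 h (ht h3) (ht h5)⟩
  by_cases hj1 : j + 1 = n ∧ n - 3 ∈ α ∧ 4 ≤ n
  · obtain ⟨hj1, h3, h4⟩ := hj1
    have h3t := m3 hj1 h3 h4
    clear h5 hS hz m2 m3 m4
    refine standard_of_second (by omega) ?_ (fun i hi hne => ?_) fun h0 => ?_
    · rwa [show j - 2 = n - 3 by omega]
    · rcases key i hi with h | h | h | h | h
      · omega
      · omega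
      · omega
      · exact absurd h3 h.2.2
      · omega
    · rcases key 0 h0 with h | h | h | h | h
      · omega
      · omega
      · omega
      · exact absurd h3 h.2.2
      · omega
  by_cases hj2 : j + 2 = n ∧ n - 4 ∈ α ∧ 5 ≤ n
  · obtain ⟨hj2, h4, h5n⟩ := hj2
    have h4t := m4 hj2 h4 h5n
    clear h5 hS m2 m3 m4
    refine standard_of_second (by omega) ?_ (fun i hi hne => ?_) fun h0 => ?_
    · rwa [show j - 2 = n - 4 by omega]
    · rcases key i hi with h | h | h | h | h <;> omega
    · rcases key 0 h0 with h | h | h | h | h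
      · have h75 : ¬(n = 7 ∧ z = 5) := fun h' => by
          refine hz h.1 h'.1 h'.2 ?_
          rwa [h'.1] at h4
        clear hz
        omega
      all_goals omega
  · have c1 : ∀ i ∈ t, ¬(i + 3 = n ∧ j + 1 = n ∧ 4 ≤ n) := fun i hi h => hj1 ⟨h.2.1, by
      rw [show n - 3 = i by omega]; exact ht hi, h.2.2⟩
    have c2 : ∀ i ∈ t, ¬(i + 4 = n ∧ j + 2 = n ∧ 5 ≤ n) := fun i hi h => hj2 ⟨h.2.1, by
      rw [show n - 4 = i by omega]; exact ht hi, h.2.2⟩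
    clear h5 hS hz m2 m3 m4 hj1 hj2
    refine standard_of_first (fun i hi => ?_) fun h0 => ?_
    · have := c1 i hi
      have := c2 i hi
      rcases key i hi with h | h | h | h | h <;> omega
    · have := c1 0 h0
      have := c2 0 h0
      refine ⟨?_, fun h7 h3 => ?_⟩
      · rcases key 0 h0 with h | h | h | h | h <;> omega
      · have := c1 3 h3
        have := c2 3 h3
        rcases key 0 h0 with h | h | h | h | h <;>
          rcases key 3 h3 with h' | h' | h' | h' | h' <;> omega

set_option maxHeartbeats 800000 in
/-- The letter `x_{n-2}` occurs in the monomial. -/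
theorem Mono.Admissible.isStandardProduct_of_second {m : Mono} (h : m.Admissible)
    (hn : m.n - 2 ∈ m.α) : m.IsStandardProduct := by
  obtain ⟨h10, h01, h00, -, hex⟩ := h
  obtain ⟨n, α, β, h₁, h₂⟩ := m
  simp only [Mono.Excluded, Finset.insert_subset_iff, Finset.singleton_subset_iff, not_or,
    not_and, At] at *
  have hn2 := h₁ _ hn
  have hn3 : 3 ≤ n := by
    by_contra h
    obtain rfl : n = 2 := by omega
    exact hex.1 rfl hn
  -- the owner of `x_{n-3}`
  have o3 : n - 3 ∈ α → n - 1 ∈ β := by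
    intro h; by_contra hb
    by_cases hb2 : n - 2 ∈ β
    · exact h01 (fun _ => hb) ⟨by omega, hb2⟩ ⟨by omega, h⟩ (by omega) hn
    · rcases h00 (fun _ => hb) (fun _ => hb2) with h' | h'
      · exact h' (by omega) hn
      · exact h'.1 (by omega) h
  -- The owner of $x_{n-4}$: $v_{n-2}$, or else $v_{n-1}$ provided that $x_{n-3}$ does not occupy
  -- it.
  have o4 : 4 ≤ n → n - 4 ∈ α → n - 2 ∈ β ∨ (n - 1 ∈ β ∧ n - 3 ∉ α) := by
    intro h4 h; by_contra! hb
    by_cases hb1 : n - 1 ∈ β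
    · exact h10 ⟨by omega, hb1⟩ (fun _ => hb.1) ⟨h4, h⟩ ⟨hn3, hb.2 hb1⟩ (by omega) hn
    · rcases h00 (fun _ => hb1) (fun _ => hb.1) with h' | h'
      · exact h' (by omega) hn
      · exact h'.2 h4 h
  obtain ⟨-, e3, e4, e4', e5, e5', e5'', e7, e7', e10⟩ := hex
  -- Here the general rule would leave $x_0x_3$ with $v_5$, a false monomial. Instead $x_0$ goes to
  -- $v_3$, and $x_1$ or $x_2$, which cannot both occur, goes to $v_4$.
  by_cases h5 : n = 5 ∧ 0 ∈ α
  · obtain ⟨rfl, h0⟩ := h5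
    clear h10 h01 h00 e3 e4 e4' e7 e7' e10 o4
    have hb3 : 3 ∈ β := by by_contra h; exact e5 rfl h h0 hn
    have hb4 : 1 ∈ α ∨ 2 ∈ α → 4 ∈ β := by
      rintro (h1 | h2)
      · by_contra h; exact e5' rfl hb3 h h0 h1 hn
      · exact o3 h2
    have h12 : 1 ∈ α → 2 ∉ α := fun h1 h2 => e5'' rfl hb3 (hb4 (Or.inl h1)) h0 h1 h2 hn
    clear e5 e5' e5'' o3
    refine Mono.isStandardProduct_of_owner _
      (fun i => if i = 0 then 3 else if i = 3 then 5 else 4) ?_ fun j hj => ?_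
    · intro i hi
      have := h₁ i hi
      simp only [Finset.mem_insert]
      split_ifs
      · exact Or.inr hb3
      · exact Or.inl rfl
      · refine Or.inr (hb4 ?_)
        rcases (by omega : i = 1 ∨ i = 2) with rfl | rfl <;> simp [hi]
    · have hα : ∀ i ∈ α, i ≤ 3 := fun i hi => by have := h₁ i hi; omega
      simp only [Finset.mem_insert] at hj
      by_cases hj5 : j = 5
      · subst hj5
        refine standard_of_second (by omega) ?_ ?_ ?_
        · simp [hn]
        · intro i hi hne
          obtain ⟨hi, h⟩ := Finset.mem_filter.mp hi
          split_ifs at h <;> omega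
        · simp
      by_cases hj4 : j = 4 ∧ 2 ∈ α
      · obtain ⟨rfl, h2⟩ := hj4
        refine standard_of_second (by omega) ?_ ?_ ?_
        · simp [h2]
        · intro i hi hne
          obtain ⟨hi, h⟩ := Finset.mem_filter.mp hi
          have := hα i hi
          have : i ≠ 1 := fun h => h12 (h ▸ hi) h2
          split_ifs at h <;> omega
        · simp
      · refine standard_of_first (fun i hi => ?_) fun h => ?_
        · obtain ⟨hi, h⟩ := Finset.mem_filter.mp hi
          have := hα i hi
          have : i ≠ 2 ∨ j ≠ 4 := by
            by_contra! h'
            exact hj4 ⟨h'.2, h'.1 ▸ hi⟩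
          split_ifs at h <;> omega
        · have h := (Finset.mem_filter.mp h).2
          rw [if_pos rfl] at h
          omega
  clear h10 h01 h00
  -- The situations in which $x_0$ cannot stay with $v_n$ because of the false monomials of the
  -- second type of lengths 7 and 10.
  obtain ⟨S, hS⟩ : ∃ S : Prop, S ↔ 0 ∈ α ∧ (n = 7 ∨ n = 10 ∧ 3 ∈ α ∧ 5 ∈ α) := ⟨_, Iff.rfl⟩
  have hSn : S → n = 7 ∨ n = 10 := fun h => (hS.mp h).2.imp id And.left
  -- For $n=7$ the factor $v_5$ is the last resort: it may have to carry $x_3=x_{n-4}$, and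
  -- $x_0x_3v_5$ is false. Non-exclusion settles exactly this case.
  obtain ⟨z, hz⟩ : ∃ z, S → z ∈ β ∧ z < n ∧ 3 ≤ z ∧ z ≠ 4 ∧ (n = 7 → z = 5 → 3 ∉ α) := by
    by_cases h : S
    swap
    · exact ⟨0, fun h' => absurd h' h⟩
    rcases hS.mp h with ⟨h0, rfl | ⟨rfl, h3, h5'⟩⟩
    · by_cases hb3 : 3 ∈ β
      · exact ⟨3, fun _ => ⟨hb3, by omega, by omega, by omega, by omega⟩⟩
      by_cases hb6 : 6 ∈ β
      · exact ⟨6, fun _ => ⟨hb6, by omega, by omega, by omega, by omega⟩⟩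
      have key : ∀ i ∈ β, i = 0 ∨ i = 1 ∨ i = 2 ∨ i = 4 ∨ i = 5 := by
        intro i hi
        have := h₂ i hi
        have : i ≠ 3 := fun h => hb3 (h ▸ hi)
        have : i ≠ 6 := fun h => hb6 (h ▸ hi)
        omega
      have hb5 : 5 ∈ β := by
        by_contra hb5
        refine (e7 rfl fun i hi => ?_).2 h0 hn
        have : i ≠ 5 := fun h => hb5 (h ▸ hi)
        have := key i hi
        simp only [Finset.mem_insert, Finset.mem_singleton]
        omega
      refine ⟨5, fun _ => ⟨hb5, by omega, by omega, by omega, fun _ _ h3 => ?_⟩⟩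
      refine e7' rfl (fun i hi => ?_) hb5 h0 h3 hn
      simpa using key i hi
    · by_contra! hne
      refine e10 rfl (fun i hi => ?_) h0 h3 h5' hn
      have := hne i
      have := h₂ i hi
      simp only [Finset.mem_insert, Finset.mem_singleton]
      by_contra h'
      have := ((hne i).2 hi (by omega) (by omega) (by omega)).1
      omega
  have n3 : n = 3 → 0 ∈ α → False := by
    rintro rfl h0
    exact e3 rfl (o3 h0) h0 hn
  have n4 : n = 4 → 0 ∈ α → 3 ∈ β ∧ 1 ∉ α := by
    rintro rfl h0
    have hb3 : 3 ∈ β := by by_contra h; exact e4 rfl h h0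
    exact ⟨hb3, fun h1 => e4' rfl hb3 h0 h1 hn⟩
  clear e3 e4 e4' e5 e5' e5'' e7 e7' e10
  classical
  -- The clause `n ≠ 4` is needed because $v_2$ carries no letters at all: for $n=4$ the letter
  -- $x_{n-4}=x_0$ has to go to $v_3$.
  refine Mono.isStandardProduct_of_owner _ (fun i => if S ∧ i = 0 then z else
    if i + 3 = n then n - 1 else if i + 4 = n then (if n - 2 ∈ β ∧ n ≠ 4 then n - 2 else n - 1)
    else n) ?_ fun j hj => ?_
  · intro i hi
    simp only [Finset.mem_insert]
    split_ifs with c1 c2 c3 c4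
    · exact Or.inr (hz c1.1).1
    · exact Or.inr (o3 (by rwa [show n - 3 = i by omega]))
    · exact Or.inr c4.1
    · refine Or.inr ?_
      have hi' : n - 4 ∈ α := by rwa [show n - 4 = i by omega]
      by_cases h4 : n = 4
      · subst h4
        exact (n4 rfl hi').1
      · rcases o4 (by omega) hi' with h | h
        · exact absurd ⟨h, h4⟩ c4
        · exact h.1
    · exact Or.inl rfl
  · have hjn : j ≤ n := by
      rcases Finset.mem_insert.mp hj with h | h
      · exact h.le
      · exact (h₂ j h).le
    refine standard_of_owner_cases (S := S) (z := z) hn3 hjn (Finset.filter_subset _ _)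
      (fun i hi => ?_) (fun h => ?_) (fun hj1 h3 h4 => ?_) (fun hj2 h4 h5n => ?_)
      (fun h0 h => h5 ⟨h, h0⟩) (fun h h0 => ?_) (fun hs => (hz hs).2.2.2.2)
    · obtain ⟨hi, h⟩ := Finset.mem_filter.mp hi
      refine owner_cases (h₁ i hi) (fun hs => ⟨(hz hs).2.1, (hz hs).2.2.1,
        (hz hs).2.2.2.1, hSn hs⟩) (fun h3 => ?_) (fun hi4 c4 h3 => ?_) h
      · by_contra h'
        obtain rfl : n = 3 := by omega
        obtain rfl : i = 0 := by omega
        exact n3 rfl hi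
      · have hi' : n - 4 ∈ α := by rwa [show n - 4 = i by omega]
        by_cases h4 : n = 4
        · subst h4
          exact (n4 rfl hi').2 h3
        · rcases o4 (by omega) hi' with h | h
          · exact c4 ⟨h, h4⟩
          · exact h.2 h3
    · refine Finset.mem_filter.mpr ⟨hn, ?_⟩
      clear hS hSn hz n3 n4 o3 o4 h5
      rw [if_neg (fun h => by have := h.2; omega), if_neg (by omega), if_neg (by omega), h]
    · refine Finset.mem_filter.mpr ⟨h3, ?_⟩
      clear hS hz n3 n4 o3 o4 h5
      rw [if_neg (fun h => by have := hSn h.1; have := h.2; clear hSn; omega),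
        if_pos (by clear hSn; omega)]
      clear hSn
      omega
    · refine Finset.mem_filter.mpr ⟨h4, ?_⟩
      clear hS hz n3 n4 o3 o4 h5
      have h7 : S → n - 4 ≠ 0 := fun hs => by
        have := hSn hs
        clear hSn
        omega
      clear hSn
      have hjβ : j ∈ β := (Finset.mem_insert.mp hj).resolve_left (show ¬j = n by clear h7; omega)
      rw [if_neg (fun h => h7 h.1 h.2)]
      clear h7
      rw [if_neg (by omega), if_pos (by omega), if_pos ⟨by rwa [show n - 2 = j by omega], by omega⟩]
      omega
    · rw [hS] at h
      exact ⟨fun h' => h ⟨h0, Or.inl h'⟩, fun h' h3 h5 => h ⟨h0, Or.inr ⟨h', h3, h5⟩⟩⟩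

theorem Mono.admissible_iff (m : Mono) : m.Admissible ↔ m.IsStandardProduct := by
  refine ⟨fun h => ?_, fun h => h.admissible⟩
  by_cases hn : m.n - 2 ∈ m.α
  · exact h.isStandardProduct_of_second hn
  · refine h.isStandardProduct_of_first fun i hi => ?_
    have := m.hα i hi
    have : i ≠ m.n - 2 := fun h => hn (h ▸ hi)
    omega

/-! ### Ordered products -/

/-- The product of the letters `x i`, `i ∈ s`, in increasing order. -/
def ordProd {E : Type*} [Mul E] [One E] (x : ℕ → E) (s : Finset ℕ) : E :=
  ((s.sort (· ≤ ·)).map x).prod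

section Monoid

variable {E : Type*} [Monoid E] (x : ℕ → E)

theorem ordProd_empty : ordProd x ∅ = 1 := by simp [ordProd]

theorem ordProd_singleton (i : ℕ) : ordProd x {i} = x i := by simp [ordProd]

theorem ordProd_insert_min {i : ℕ} {s : Finset ℕ} (h : ∀ j ∈ s, i < j) :
    ordProd x (insert i s) = x i * ordProd x s := by
  rw [ordProd, Finset.sort_insert _ (fun j hj => (h j hj).le) (fun hi => lt_irrefl _ (h i hi)),
    List.map_cons, List.prod_cons, ordProd]

theorem ordProd_insert_max {i : ℕ} {s : Finset ℕ} (h : ∀ j ∈ s, j < i) :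
    ordProd x (insert i s) = ordProd x s * x i := by
  induction s using Finset.induction_on_min with
  | empty => simp [ordProd]
  | insert m s hm ih =>
    rw [Finset.insert_comm, ordProd_insert_min, ordProd_insert_min x hm,
      ih fun j hj => h j (Finset.mem_insert_of_mem hj), mul_assoc]
    intro j hj
    rcases Finset.mem_insert.mp hj with rfl | hj
    · exact h m (Finset.mem_insert_self _ _)
    · exact hm j hj

theorem monoProd_eq (v : ℕ → E) (n : ℕ) (α β : Finset ℕ) :
    monoProd x v n α β = ordProd x α * ordProd v β * v n := by
  simp [monoProd, ordProd, mul_assoc]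

theorem monoProd_eq_insert (v : ℕ → E) {n : ℕ} {α β : Finset ℕ} (h : ∀ j ∈ β, j < n) :
    monoProd x v n α β = ordProd x α * ordProd v (insert n β) := by
  rw [monoProd_eq, ordProd_insert_max v h, mul_assoc]

end Monoid

section Anticommuting

variable {K E : Type*} [Field K] [Ring E] [Algebra K E] {x : ℕ → E}

theorem ordProd_anticomm {y : E} {s : Finset ℕ} (h : ∀ i ∈ s, y * x i = -(x i * y)) :
    y * ordProd x s = (-1 : K) ^ s.card • (ordProd x s * y) := by
  induction s using Finset.induction_on_min with
  | empty => simp [ordProd_empty]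
  | insert i s hi ih =>
    rw [ordProd_insert_min x hi, Finset.card_insert_of_notMem fun h => lt_irrefl _ (hi i h),
      ← mul_assoc, h i (Finset.mem_insert_self _ _), neg_mul, mul_assoc,
      ih fun j hj => h j (Finset.mem_insert_of_mem hj), pow_succ, mul_neg_one, neg_smul,
      mul_smul_comm, mul_assoc]


theorem mul_ordProd_eq_zero (hsq : ∀ i, x i * x i = 0)
    (hac : ∀ i j, x i * x j = -(x j * x i)) {i : ℕ} {s : Finset ℕ} (hi : i ∈ s) : x i * ordProd x s = 0 := by
  induction s using Finset.induction_on_min with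
  | empty => simp at hi
  | insert m s hm ih =>
    rw [ordProd_insert_min x hm, ← mul_assoc]
    rcases Finset.mem_insert.mp hi with rfl | hi
    · rw [hsq, zero_mul]
    · rw [hac, neg_mul, mul_assoc, ih hi, mul_zero, neg_zero]

theorem exists_mul_ordProd (hac : ∀ i j, x i * x j = -(x j * x i)) {i : ℕ} {s : Finset ℕ} (hi : i ∉ s) :
    ∃ u : K, u ≠ 0 ∧ x i * ordProd x s = u • ordProd x (insert i s) := by
  induction s using Finset.induction_on_min with
  | empty => exact ⟨1, one_ne_zero, by simp [ordProd_empty, ordProd_singleton]⟩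
  | insert m s hm ih =>
    have him : i ≠ m := fun h => hi (h ▸ Finset.mem_insert_self _ _)
    obtain ⟨u, hu, e⟩ := ih fun h => hi (Finset.mem_insert_of_mem h)
    rcases lt_or_gt_of_ne him with h | h
    · refine ⟨1, one_ne_zero, ?_⟩
      rw [one_smul, ordProd_insert_min x (i := i)]
      intro j hj
      rcases Finset.mem_insert.mp hj with rfl | hj
      · exact h
      · exact h.trans (hm j hj)
    · refine ⟨-u, neg_ne_zero.mpr hu, ?_⟩
      rw [Finset.insert_comm, ordProd_insert_min x hm, ordProd_insert_min x, ← mul_assoc, hac,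
        neg_mul, mul_assoc, e, mul_smul_comm, neg_smul]
      intro j hj
      rcases Finset.mem_insert.mp hj with rfl | hj
      · exact h
      · exact hm j hj

theorem exists_ordProd_mul (hac : ∀ i j, x i * x j = -(x j * x i)) {a b : Finset ℕ} (h : Disjoint a b) :
    ∃ u : K, u ≠ 0 ∧ ordProd x a * ordProd x b = u • ordProd x (a ∪ b) := by
  induction a using Finset.induction_on_min with
  | empty => exact ⟨1, one_ne_zero, by simp [ordProd_empty]⟩
  | insert i a hi ih =>
    obtain ⟨u, hu, e⟩ := ih (Finset.disjoint_of_subset_left (Finset.subset_insert _ _) h)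
    have hib : i ∉ a ∪ b := by
      rw [Finset.mem_union, not_or]
      exact ⟨fun h => lt_irrefl _ (hi i h), Finset.disjoint_left.mp h (Finset.mem_insert_self _ _)⟩
    obtain ⟨u', hu', e'⟩ := exists_mul_ordProd (K := K) hac hib
    exact ⟨u * u', mul_ne_zero hu hu', by
      rw [ordProd_insert_min x hi, mul_assoc, e, mul_smul_comm, e', smul_smul,
        Finset.insert_union]⟩

theorem ordProd_mul_eq_zero (K : Type*) {E : Type*} [Field K] [Ring E] [Algebra K E]
    {x : ℕ → E} (hsq : ∀ i, x i * x i = 0)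
    (hac : ∀ i j, x i * x j = -(x j * x i)) {a b : Finset ℕ} (h : ¬Disjoint a b) :
    ordProd x a * ordProd x b = 0 := by
  obtain ⟨i, hia, hib⟩ := Finset.not_disjoint_iff.mp h
  obtain ⟨u, hu, e⟩ := exists_mul_ordProd (K := K) hac (Finset.notMem_erase i a)
  rw [Finset.insert_erase hia] at e
  rw [← inv_smul_smul₀ hu (ordProd x a), ← e,
    ordProd_anticomm (K := K) (s := a.erase i) (fun j _ => hac i j)]
  simp only [smul_mul_assoc, mul_assoc, mul_ordProd_eq_zero hsq hac hib, mul_zero, smul_zero]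

theorem exists_ordProd_mul' (hsq : ∀ i, x i * x i = 0)
    (hac : ∀ i j, x i * x j = -(x j * x i)) (a b : Finset ℕ) :
    ∃ u : K, ordProd x a * ordProd x b = u • ordProd x (a ∪ b) := by
  by_cases h : Disjoint a b
  · obtain ⟨u, -, e⟩ := exists_ordProd_mul (K := K) hac h
    exact ⟨u, e⟩
  · exact ⟨0, by rw [ordProd_mul_eq_zero K hsq hac h, zero_smul]⟩

end Anticommuting

/-! ### Signs -/

section Signs

variable {K : Type*} [Field K]

theorem zmod_two_cases (i : ZMod 2) : i = 0 ∨ i = 1 := by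
  revert i; decide

theorem ssign_zero_left (j : ZMod 2) : ssign K 0 j = 1 := by
  simp [ssign]

theorem ssign_zero_right (j : ZMod 2) : ssign K j 0 = 1 := by
  simp [ssign]

theorem ssign_one_one : ssign K 1 1 = -1 := by
  simp [ssign, ZMod.val_one]

theorem ssign_comm (i j : ZMod 2) : ssign K i j = ssign K j i := by
  rw [ssign, ssign, mul_comm]

theorem ssign_add_left (i j k : ZMod 2) : ssign K (i + j) k = ssign K i k * ssign K j k := by
  rcases zmod_two_cases i with rfl | rfl
  · rw [zero_add, ssign_zero_left, one_mul]
  rcases zmod_two_cases j with rfl | rfl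
  · rw [add_zero, ssign_zero_left, mul_one]
  rw [show (1 + 1 : ZMod 2) = 0 by decide, ssign_zero_left]
  rcases zmod_two_cases k with rfl | rfl
  · simp [ssign_zero_right]
  · simp [ssign_one_one]

theorem ssign_add_right (i j k : ZMod 2) : ssign K i (j + k) = ssign K i j * ssign K i k := by
  rw [ssign_comm, ssign_add_left, ssign_comm j, ssign_comm k]

theorem ssign_mul_self (i j : ZMod 2) : ssign K i j * ssign K i j = 1 := by
  rw [← ssign_add_left, CharTwo.add_self_eq_zero, ssign_zero_left]

theorem ssign_ne_zero (i j : ZMod 2) : ssign K i j ≠ 0 := fun h => by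
  have := ssign_mul_self (K := K) i j
  rw [h, zero_mul] at this
  exact zero_ne_one this

theorem ssign_natCast (m n : ℕ) : ssign K (m : ZMod 2) (n : ZMod 2) = (-1) ^ (m * n) := by
  rw [ssign, ZMod.val_natCast, ZMod.val_natCast, neg_one_pow_eq_pow_mod_two,
    neg_one_pow_eq_pow_mod_two (m * n), Nat.mul_mod]
  simp

end Signs

/-! ### Brackets with the Leibniz rule -/

section SuperBr

variable {K E : Type*} [Field K] [Ring E] [Algebra K E]

/-- A family of bilinear operations `br i j`, to be applied to elements of parities `i` and `j`,
that is anticommutative and satisfies the Leibniz rule in the super sense. -/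
structure SuperBr (par : ZMod 2 → Submodule K E)
    (br : ZMod 2 → ZMod 2 → E →ₗ[K] E →ₗ[K] E) : Prop where
  one_mem : 1 ∈ par 0
  mul_mem : ∀ i j a b, a ∈ par i → b ∈ par j → a * b ∈ par (i + j)
  anti : ∀ i j a b, a ∈ par i → b ∈ par j → br i j a b = -(ssign K i j • br j i b a)
  leib : ∀ i j k a b c, a ∈ par i → b ∈ par j → c ∈ par k →
    br (i + j) k (a * b) c = a * br j k b c + ssign K j k • (br i k a c * b)

variable {par : ZMod 2 → Submodule K E} {br : ZMod 2 → ZMod 2 → E →ₗ[K] E →ₗ[K] E}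

theorem SuperBr.one_left (h : SuperBr par br) {k : ZMod 2} {c : E} (hc : c ∈ par k) :
    br 0 k 1 c = 0 := by
  have := h.leib 0 0 k 1 1 c h.one_mem h.one_mem hc
  rw [add_zero, mul_one, one_mul, mul_one, ssign_zero_left, one_smul] at this
  simpa using this

theorem SuperBr.one_right (h : SuperBr par br) {k : ZMod 2} {c : E} (hc : c ∈ par k) :
    br k 0 c 1 = 0 := by
  rw [h.anti _ _ _ _ hc h.one_mem, h.one_left hc, smul_zero, neg_zero]

theorem SuperBr.leib_right (h : SuperBr par br) {i j k : ZMod 2} {a b c : E} (ha : a ∈ par i)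
    (hb : b ∈ par j) (hc : c ∈ par k) :
    br i (j + k) a (b * c) = br i j a b * c + ssign K i j • (b * br i k a c) := by
  rw [h.anti _ _ _ _ ha (h.mul_mem _ _ _ _ hb hc), h.leib _ _ _ _ _ _ hb hc ha,
    h.anti i j a b ha hb, h.anti i k a c ha hc, ssign_add_right, ssign_comm k i]
  simp only [smul_add, neg_mul, smul_mul_assoc, mul_neg, mul_smul_comm, smul_neg, smul_smul,
    neg_add, mul_comm, mul_left_comm]
  rw [ssign_mul_self, mul_one]
  abel

end SuperBr

/-! ### Systems of pivot elements -/

section PivotSys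

variable {K E : Type*} [Field K] [Ring E] [Algebra K E]

/-- The relations between the letters `x i`, the pivot elements `v i`, and their leading terms
`d i` (`∂_i` in the associative, `y_i` in the Poisson case). The brackets with the letters
`x i`, `i < N`, are controlled. -/
structure PivotSys (N : ℕ) (x v d : ℕ → E) (par : ZMod 2 → Submodule K E)
    (br : ZMod 2 → ZMod 2 → E →ₗ[K] E →ₗ[K] E) : Prop extends SuperBr par br where
  x_mem : ∀ i, x i ∈ par 1
  v_mem : ∀ i, v i ∈ par 1
  d_mem : ∀ i, d i ∈ par 1
  x_sq : ∀ i, x i * x i = 0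
  x_anti : ∀ i j, x i * x j = -(x j * x i)
  v_x : ∀ n j, j < n → v n * x j = -(x j * v n)
  v_eq : ∀ n, v n = d n + x n * x (n + 1) * v (n + 3)
  br_x_x : ∀ i j, br 1 1 (x i) (x j) = 0
  -- The bound is there for the Poisson bracket truncated to the derivatives of index below `N`,
  -- which does not see letters of larger index.
  br_d_x : ∀ n j, j < N → br 1 1 (d n) (x j) = if n = j then 1 else 0
  br_v_x_lt : ∀ n j, j < n → br 1 1 (v n) (x j) = 0
  br_d_v : ∀ n k, n < k → br 1 1 (d n) (v k) = 0
  br_d_d : ∀ n, br 1 1 (d n) (d n) = 0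

variable {N : ℕ} {x v d : ℕ → E} {par : ZMod 2 → Submodule K E}
  {br : ZMod 2 → ZMod 2 → E →ₗ[K] E →ₗ[K] E}

theorem PivotSys.br_x_v_lt (h : PivotSys N x v d par br) {n j : ℕ} (hj : j < n) :
    br 1 1 (x j) (v n) = 0 := by
  rw [h.anti _ _ _ _ (h.x_mem j) (h.v_mem n), h.br_v_x_lt n j hj, smul_zero, neg_zero]

theorem PivotSys.xx_mem (h : PivotSys N x v d par br) (i j : ℕ) : x i * x j ∈ par 0 := by
  rw [show (0 : ZMod 2) = 1 + 1 by decide]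
  exact h.mul_mem _ _ _ _ (h.x_mem i) (h.x_mem j)

theorem PivotSys.br_xx (h : PivotSys N x v d par br) (i j : ℕ) {e : E} (he : e ∈ par 1) :
    br 0 1 (x i * x j) e = x i * br 1 1 (x j) e - br 1 1 (x i) e * x j := by
  have := h.leib 1 1 1 (x i) (x j) e (h.x_mem i) (h.x_mem j) he
  rw [show (1 + 1 : ZMod 2) = 0 by decide, ssign_one_one, neg_one_smul] at this
  rw [this, sub_eq_add_neg]

theorem PivotSys.br_xxv (h : PivotSys N x v d par br) (i j k : ℕ) {e : E} (he : e ∈ par 1) :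
    br 1 1 (x i * x j * v k) e = x i * x j * br 1 1 (v k) e - br 0 1 (x i * x j) e * v k := by
  have := h.leib 0 1 1 (x i * x j) (v k) e (h.xx_mem i j) (h.v_mem k) he
  rw [zero_add, ssign_one_one, neg_one_smul] at this
  rw [this, sub_eq_add_neg]

theorem PivotSys.xxv_mem (h : PivotSys N x v d par br) (i j k : ℕ) :
    x i * x j * v k ∈ par 1 := by
  rw [← zero_add (1 : ZMod 2)]
  exact h.mul_mem _ _ _ _ (h.xx_mem i j) (h.v_mem k)

theorem PivotSys.br_v_x_self (h : PivotSys N x v d par br) {n : ℕ} (hn : n < N) :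
    br 1 1 (v n) (x n) = 1 := by
  rw [h.v_eq, map_add, LinearMap.add_apply, h.br_d_x _ _ hn, if_pos rfl, h.br_xxv _ _ _ (h.x_mem n),
    h.br_v_x_lt _ _ (by omega), h.br_xx _ _ (h.x_mem n), h.br_x_x, h.br_x_x]
  simp

theorem PivotSys.br_v_x_step (h : PivotSys N x v d par br) {n j : ℕ} (hn : n < j) (hj : j < N) :
    br 1 1 (v n) (x j) = x n * x (n + 1) * br 1 1 (v (n + 3)) (x j) := by
  rw [h.v_eq n, map_add, LinearMap.add_apply, h.br_d_x _ _ hj, if_neg hn.ne,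
    h.br_xxv _ _ _ (h.x_mem j), h.br_xx _ _ (h.x_mem j), h.br_x_x, h.br_x_x]
  simp

theorem ordProd_pair_insert (x : ℕ → E) {n : ℕ} {C : Finset ℕ} (hC : ∀ i ∈ C, n + 2 ≤ i) :
    ordProd x (insert n (insert (n + 1) C)) = x n * x (n + 1) * ordProd x C := by
  rw [ordProd_insert_min, ordProd_insert_min, mul_assoc]
  · intro j hj
    have := hC j hj
    omega
  · intro j hj
    rcases Finset.mem_insert.mp hj with rfl | hj
    · omega
    · have := hC j hj
      omega

/-- Unrolling $r$ steps of the recursion for $v_n$ reaches the term whose derivative hits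
$x_{n+3r}$; what remains is its coefficient. -/
theorem PivotSys.br_v_x_tail (h : PivotSys N x v d par br) {n r : ℕ} (hN : n + 3 * r < N) :
    br 1 1 (v n) (x (n + 3 * r)) = ordProd x (pivotTail n r) := by
  induction r generalizing n with
  | zero => rw [mul_zero, add_zero, h.br_v_x_self (by omega), pivotTail_zero, ordProd_empty]
  | succ r ih =>
    have := ih (n := n + 3) (by omega)
    rw [show n + 3 * (r + 1) = n + 3 + 3 * r by ring, h.br_v_x_step (by omega) (by omega), this,
      pivotTail_succ, ordProd_pair_insert x fun i hi => by
        have := le_of_mem_pivotTail hi; omega]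

theorem PivotSys.br_v_x_eq_zero (h : PivotSys N x v d par br) {n j : ℕ} (hj : j < N)
    (hne : ∀ r, j ≠ n + 3 * r) : br 1 1 (v n) (x j) = 0 := by
  by_cases hjn : j < n
  · exact h.br_v_x_lt n j hjn
  · have h0 := hne 0
    induction hk : j - n using Nat.strong_induction_on generalizing n with
    | _ k ih =>
      rw [h.br_v_x_step (by omega) hj]
      by_cases hj3 : j < n + 3
      · rw [h.br_v_x_lt _ _ hj3, mul_zero]
      · rw [ih (j - (n + 3)) (by omega) (fun r h => hne (r + 1) (by rw [h]; ring)) hj3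
          (by have := hne 1; omega) rfl, mul_zero]

/-- The bracket of $v_k$ with $d_n$ vanishes, and so do those with $x_n$ and $x_{n+1}$ because both
indices are below $k$. Only the inner pivot element of the recursion contributes. -/
theorem PivotSys.br_v_v_step (h : PivotSys N x v d par br) {n k : ℕ} (hk : n + 2 ≤ k) :
    br 1 1 (v n) (v k) = x n * x (n + 1) * br 1 1 (v (n + 3)) (v k) := by
  rw [h.v_eq n, map_add, LinearMap.add_apply, h.br_d_v _ _ (by omega),
    h.br_xxv _ _ _ (h.v_mem k), h.br_xx _ _ (h.v_mem k), h.br_x_v_lt (by omega),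
    h.br_x_v_lt (by omega)]
  simp

theorem PivotSys.br_v_v_comm (h : PivotSys N x v d par br) (n k : ℕ) :
    br 1 1 (v n) (v k) = br 1 1 (v k) (v n) := by
  rw [h.anti _ _ _ _ (h.v_mem n) (h.v_mem k), ssign_one_one, neg_one_smul, neg_neg]

/-- The pairing of $x_{n+1}$ with $v_{n+1}$ gives the result. The remaining term
$x_nx_{n+1}[v_{n+3},v_{n+1}]$ vanishes, as its bracket has another factor $x_{n+1}$. -/
theorem PivotSys.br_v_v_one (h : PivotSys N x v d par br) {n : ℕ} (hn : n + 1 < N) :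
    br 1 1 (v n) (v (n + 1)) = -(x n * v (n + 3)) := by
  have h1 : br 1 1 (x (n + 1)) (v (n + 1)) = 1 := by
    rw [h.anti _ _ _ _ (h.x_mem _) (h.v_mem _), h.br_v_x_self hn, ssign_one_one, neg_one_smul,
      neg_neg]
  rw [h.v_eq n, map_add, LinearMap.add_apply, h.br_d_v _ _ (by omega),
    h.br_xxv _ _ _ (h.v_mem _), h.br_xx _ _ (h.v_mem _), h1,
    h.br_x_v_lt (n := n + 1) (j := n) (by omega), h.br_v_v_comm (n + 3) (n + 1),
    h.br_v_v_step (n := n + 1) (k := n + 3) (by omega), ← mul_assoc (x n * x (n + 1)),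
    ← mul_assoc (x n * x (n + 1)), mul_assoc (x n) (x (n + 1)), h.x_sq]
  simp

theorem PivotSys.br_v_v_two (h : PivotSys N x v d par br) {n : ℕ} (hn : n + 3 < N) :
    br 1 1 (v n) (v (n + 2)) = -(x n * x (n + 1) * x (n + 2) * v (n + 5)) := by
  rw [h.br_v_v_step le_rfl, h.br_v_v_comm, h.br_v_v_one (n := n + 2) hn]
  simp [mul_assoc]

/-- With $v_n=d_n+y$, the brackets $[d_n,d_n]$ and $[y,y]$ vanish, the latter by $(x_nx_{n+1})^2=0$.
Each of the two mixed brackets contributes $x_{n+1}v_{n+3}$. -/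
theorem PivotSys.br_v_v_self (h : PivotSys N x v d par br) {n : ℕ} (hn : n + 1 < N) :
    br 1 1 (v n) (v n) = (2 : K) • (x (n + 1) * v (n + 3)) := by
  have hy := h.xxv_mem n (n + 1) (n + 3)
  have h1 : br 1 1 (d n) (x n * x (n + 1) * v (n + 3)) = x (n + 1) * v (n + 3) := by
    have e1 := h.toSuperBr.leib_right (h.d_mem n) (h.xx_mem n (n + 1)) (h.v_mem (n + 3))
    have e2 := h.toSuperBr.leib_right (h.d_mem n) (h.x_mem n) (h.x_mem (n + 1))
    rw [zero_add, h.br_d_v _ _ (by omega), mul_zero, smul_zero, add_zero] at e1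
    rw [show (1 + 1 : ZMod 2) = 0 by decide, h.br_d_x _ _ (by omega), h.br_d_x _ _ hn, if_pos rfl,
      if_neg (by omega), one_mul, mul_zero, smul_zero, add_zero] at e2
    rw [e1, e2]
  have hc : ∀ a b, a ∈ par 1 → b ∈ par 1 → br 1 1 a b = br 1 1 b a := fun a b ha hb => by
    rw [h.anti _ _ _ _ ha hb, ssign_one_one, neg_one_smul, neg_neg]
  have h2 : br 1 1 (x n * x (n + 1) * v (n + 3)) (x n * x (n + 1) * v (n + 3)) = 0 := by
    have e1 : br 1 1 (v (n + 3)) (x n * x (n + 1) * v (n + 3)) =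
        x n * x (n + 1) * br 1 1 (v (n + 3)) (v (n + 3)) := by
      rw [hc _ _ (h.v_mem _) hy, h.br_xxv _ _ _ (h.v_mem _), h.br_xx _ _ (h.v_mem _),
        h.br_x_v_lt (by omega), h.br_x_v_lt (by omega)]
      simp
    have e2 : ∀ i, i < n + 3 → br 1 1 (x i) (x n * x (n + 1) * v (n + 3)) = 0 := fun i hi => by
      rw [hc _ _ (h.x_mem _) hy, h.br_xxv _ _ _ (h.x_mem _), h.br_xx _ _ (h.x_mem _),
        h.br_v_x_lt _ _ hi, h.br_x_x, h.br_x_x]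
      simp
    rw [h.br_xxv _ _ _ hy, h.br_xx _ _ hy, e1, e2 _ (by omega), e2 _ (by omega)]
    have : x n * x (n + 1) * (x n * x (n + 1)) = 0 := by
      rw [mul_assoc, h.x_anti n (n + 1), mul_neg, ← mul_assoc (x (n + 1)), h.x_sq]
      simp
    rw [← mul_assoc, this]
    simp
  conv_lhs => rw [h.v_eq n]
  simp only [map_add, LinearMap.add_apply]
  rw [h.br_d_d, h1, h2, hc _ _ hy (h.d_mem n), h1, two_smul]
  abel

/-- Steps of three reduce the difference of the indices to 0, 1 or 2, with coefficients 2, $-1$,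
$-1$. -/
theorem PivotSys.exists_br_v_v (h : PivotSys N x v d par br) (h2 : (2 : K) ≠ 0) {n k : ℕ}
    (hnk : n ≤ k) (hN : k + 2 < N) : ∃ (u : K) (C : Finset ℕ) (L : ℕ), u ≠ 0 ∧
      br 1 1 (v n) (v k) = u • (ordProd x C * v L) ∧ IsPivotBracket n k C L := by
  induction hm : k - n using Nat.strong_induction_on generalizing n with
  | _ m ih =>
    rcases (by omega : n = k ∨ k = n + 1 ∨ k = n + 2 ∨ n + 3 ≤ k) with rfl | rfl | rfl | h3
    · exact ⟨2, {n + 1}, n + 3, h2, by rw [h.br_v_v_self (by omega), ordProd_singleton],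
        isPivotBracket_self n⟩
    · exact ⟨-1, {n}, n + 3, by simp, by
        rw [h.br_v_v_one (by omega), ordProd_singleton, neg_one_smul], isPivotBracket_one n⟩
    · refine ⟨-1, {n, n + 1, n + 2}, n + 5, by simp, ?_, isPivotBracket_two n⟩
      rw [h.br_v_v_two (by omega), ordProd_pair_insert x (by simp), ordProd_singleton,
        neg_one_smul]
    · obtain ⟨u, C, L, hu, e, hC⟩ := ih (k - (n + 3)) (by omega) h3 rfl
      refine ⟨u, _, L, hu, ?_, hC.step h3⟩
      rw [h.br_v_v_step (by omega), e, ordProd_pair_insert x fun i hi => by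
        have := hC.le i hi; omega]
      simp only [mul_smul_comm, mul_assoc]

end PivotSys

/-! ### Brackets of standard monomials -/

section StdBracket

variable {K E : Type*} [Field K] [Ring E] [Algebra K E]

/-- The monomial `x^a v_n`. -/
def stdMon {E : Type*} [Mul E] [One E] (x v : ℕ → E) (n : ℕ) (a : Finset ℕ) : E :=
  ordProd x a * v n

/-- The span of the standard monomials. -/
def stdSpan (K : Type*) {E : Type*} [Field K] [Ring E] [Algebra K E] (x v : ℕ → E) :
    Submodule K E :=
  Submodule.span K {y | ∃ n a, Standard n a ∧ y = stdMon x v n a}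

theorem stdMon_mem_stdSpan {x v : ℕ → E} {n : ℕ} {a : Finset ℕ} (h : Standard n a) :
    stdMon x v n a ∈ stdSpan K x v :=
  Submodule.subset_span ⟨n, a, h, rfl⟩

variable {N : ℕ} {x v d : ℕ → E} {par : ZMod 2 → Submodule K E}
  {br : ZMod 2 → ZMod 2 → E →ₗ[K] E →ₗ[K] E}

theorem SuperBr.ordProd_mem (h : SuperBr par br) (hx : ∀ i, x i ∈ par 1) (s : Finset ℕ) :
    ordProd x s ∈ par (s.card : ZMod 2) := by
  induction s using Finset.induction_on_min with
  | empty => simpa [ordProd_empty] using h.one_mem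
  | insert i s hi ih =>
    rw [ordProd_insert_min x hi, Finset.card_insert_of_notMem fun h => lt_irrefl _ (hi i h),
      Nat.cast_succ, add_comm]
    exact h.mul_mem _ _ _ _ (hx i) ih

theorem PivotSys.stdMon_mem (h : PivotSys N x v d par br) (n : ℕ) (a : Finset ℕ) :
    stdMon x v n a ∈ par ((a.card : ZMod 2) + 1) :=
  h.mul_mem _ _ _ _ (h.toSuperBr.ordProd_mem h.x_mem a) (h.v_mem n)

theorem PivotSys.br_ordProd_eq_zero (h : PivotSys N x v d par br) {p : ZMod 2} {c : E}
    (hc : c ∈ par p) {s : Finset ℕ} (hs : ∀ i ∈ s, br 1 p (x i) c = 0) :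
    br s.card p (ordProd x s) c = 0 := by
  induction s using Finset.induction_on_min with
  | empty => simpa [ordProd_empty] using h.toSuperBr.one_left hc
  | insert i s hi ih =>
    rw [ordProd_insert_min x hi, Finset.card_insert_of_notMem fun h => lt_irrefl _ (hi i h),
      Nat.cast_succ, add_comm, h.leib _ _ _ _ _ _ (h.x_mem i)
        (h.toSuperBr.ordProd_mem h.x_mem s) hc, hs i (Finset.mem_insert_self _ _),
      ih fun j hj => hs j (Finset.mem_insert_of_mem hj)]
    simp

theorem PivotSys.br_v_ordProd_eq_zero (h : PivotSys N x v d par br) {n : ℕ} {s : Finset ℕ}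
    (hs : ∀ i ∈ s, br 1 1 (v n) (x i) = 0) : br 1 s.card (v n) (ordProd x s) = 0 := by
  rw [h.anti _ _ _ _ (h.v_mem n) (h.toSuperBr.ordProd_mem h.x_mem s),
    h.br_ordProd_eq_zero (h.v_mem n), smul_zero, neg_zero]
  intro i hi
  rw [h.anti _ _ _ _ (h.x_mem i) (h.v_mem n), hs i hi, smul_zero, neg_zero]

/-- The bracket of `x^a v_n` and `x^b v_k` if all letters in `a` have index less than `k`. -/
theorem PivotSys.br_stdMon (h : PivotSys N x v d par br) {n k : ℕ} {a b : Finset ℕ}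
    (ha : ∀ i ∈ a, i < k) : ∃ u : K, u ≠ 0 ∧
      br (a.card + 1) (b.card + 1) (stdMon x v n a) (stdMon x v k b) =
        ordProd x a * (br 1 b.card (v n) (ordProd x b) * v k) +
          u • (ordProd x a * (ordProd x b * br 1 1 (v n) (v k))) := by
  refine ⟨ssign K 1 b.card, ssign_ne_zero _ _, ?_⟩
  have hXa := h.toSuperBr.ordProd_mem h.x_mem a
  have hXb := h.toSuperBr.ordProd_mem h.x_mem b
  -- The letters in `a` bracket to zero with all letters and, having index below `k`, with $v_k$; so
  -- $x^a$ is a mere coefficient.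
  have h0 : br a.card (b.card + 1) (ordProd x a) (stdMon x v k b) = 0 := by
    refine h.br_ordProd_eq_zero (h.stdMon_mem k b) fun i hi => ?_
    rw [stdMon, h.toSuperBr.leib_right (h.x_mem i) hXb (h.v_mem k), h.br_x_v_lt (ha i hi),
      h.anti _ _ _ _ (h.x_mem i) hXb, h.br_ordProd_eq_zero (h.x_mem i) fun j _ => h.br_x_x j i]
    simp
  rw [stdMon, h.leib _ _ _ _ _ _ hXa (h.v_mem n) (h.stdMon_mem k b), h0, zero_mul, smul_zero,
    add_zero, stdMon, h.toSuperBr.leib_right (h.v_mem n) hXb (h.v_mem k), mul_add, mul_smul_comm]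

/-- By the Leibniz rule, the bracket with $v_n$ replaces one letter $x_{n+3r}$ at a time by a tail
of $v_n$ and annihilates the letters of other residues or of index below $n$. -/
theorem PivotSys.br_v_ordProd_mem (h : PivotSys N x v d par br) {n : ℕ} {b : Finset ℕ}
    (hb : ∀ i ∈ b, i < N) : br 1 b.card (v n) (ordProd x b) ∈
      Submodule.span K {y | ∃ r, n + 3 * r ∈ b ∧
        y = ordProd x (pivotTail n r) * ordProd x (b.erase (n + 3 * r))} := by
  induction b using Finset.induction_on_min with
  | empty =>
    rw [Finset.card_empty, ordProd_empty, Nat.cast_zero, h.toSuperBr.one_right (h.v_mem n)]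
    exact Submodule.zero_mem _
  | insert i b hi ih =>
    have hib : i ∉ b := fun h => lt_irrefl _ (hi i h)
    rw [ordProd_insert_min x hi, Finset.card_insert_of_notMem hib, Nat.cast_succ, add_comm,
      h.toSuperBr.leib_right (h.v_mem n) (h.x_mem i) (h.toSuperBr.ordProd_mem h.x_mem b)]
    refine Submodule.add_mem _ ?_ (Submodule.smul_mem _ _ ?_)
    · by_cases hr : ∃ r, i = n + 3 * r
      · obtain ⟨r, rfl⟩ := hr
        rw [h.br_v_x_tail (hb _ (Finset.mem_insert_self _ _))]
        exact Submodule.subset_span ⟨r, Finset.mem_insert_self _ _, by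
          rw [Finset.erase_insert hib]⟩
      · rw [h.br_v_x_eq_zero (hb _ (Finset.mem_insert_self _ _)) fun r hr' => hr ⟨r, hr'⟩,
          zero_mul]
        exact Submodule.zero_mem _
    · have := Submodule.mem_map_of_mem (f := LinearMap.mulLeft K (x i))
        (ih fun j hj => hb j (Finset.mem_insert_of_mem hj))
      rw [Submodule.map_span, LinearMap.mulLeft_apply] at this
      refine Submodule.span_le.mpr ?_ this
      rintro _ ⟨_, ⟨r, hr, rfl⟩, rfl⟩
      rw [LinearMap.mulLeft_apply, ← mul_assoc, ordProd_anticomm (K := K) fun j _ => h.x_anti i j,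
        smul_mul_assoc, mul_assoc]
      refine Submodule.smul_mem _ _ (Submodule.subset_span ⟨r, Finset.mem_insert_of_mem hr, ?_⟩)
      rw [Finset.erase_insert_of_ne (hi _ hr).ne,
        ordProd_insert_min x fun j hj => hi j (Finset.mem_of_mem_erase hj)]

/-- A product of letters is zero if one is repeated and $\pm$ the monomial of the union otherwise,
so only the union of the exponents has to be standard. -/
theorem PivotSys.ordProd_mul_mem_of_standard (h : PivotSys N x v d par br) {s t r : Finset ℕ}
    {n : ℕ} (hs : Standard n (s ∪ (t ∪ r))) :
    ordProd x s * (ordProd x t * ordProd x r * v n) ∈ stdSpan K x v := by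
  obtain ⟨u, e⟩ := exists_ordProd_mul' (K := K) h.x_sq h.x_anti t r
  obtain ⟨u', e'⟩ := exists_ordProd_mul' (K := K) h.x_sq h.x_anti s (t ∪ r)
  rw [e, smul_mul_assoc, mul_smul_comm, ← mul_assoc, e', smul_mul_assoc]
  exact Submodule.smul_mem _ _ (Submodule.smul_mem _ _ (stdMon_mem_stdSpan hs))

/-- The two summands of the bracket are the two operations under which standard monomials are
stable, `Standard.subst` and `IsPivotBracket.standard`. -/
theorem PivotSys.br_stdMon_mem_of_le (h : PivotSys N x v d par br) (h2 : (2 : K) ≠ 0) {n k : ℕ}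
    {a b : Finset ℕ} (hnk : n ≤ k) (hN : k + 2 < N) (ha : Standard n a) (hb : Standard k b) :
    br (a.card + 1) (b.card + 1) (stdMon x v n a) (stdMon x v k b) ∈ stdSpan K x v := by
  have hb2 := hb.add_two_le
  obtain ⟨u, -, e⟩ := h.br_stdMon (n := n) (k := k) (a := a) (b := b) fun i hi => by
    have := ha.add_two_le i hi; omega
  rw [e]
  refine Submodule.add_mem _ ?_ (Submodule.smul_mem _ _ ?_)
  · have := Submodule.mem_map_of_mem
      (f := (LinearMap.mulLeft K (ordProd x a)).comp (LinearMap.mulRight K (v k)))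
      (h.br_v_ordProd_mem (n := n) (b := b) fun i hi => by have := hb2 i hi; omega)
    rw [Submodule.map_span] at this
    refine Submodule.span_le.mpr ?_ this
    rintro _ ⟨_, ⟨r, hr, rfl⟩, rfl⟩
    exact h.ordProd_mul_mem_of_standard (ha.subst hb hr)
  · obtain ⟨u, C, L, -, e, hC⟩ := h.exists_br_v_v h2 hnk hN
    rw [e, mul_smul_comm, mul_smul_comm, ← mul_assoc (ordProd x b)]
    exact Submodule.smul_mem _ _ (h.ordProd_mul_mem_of_standard (hC.standard hnk ha hb))

theorem PivotSys.br_stdMon_mem (h : PivotSys N x v d par br) (h2 : (2 : K) ≠ 0) {n k : ℕ}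
    {a b : Finset ℕ} (hn : n + 2 < N) (hk : k + 2 < N) (ha : Standard n a) (hb : Standard k b) :
    br (a.card + 1) (b.card + 1) (stdMon x v n a) (stdMon x v k b) ∈ stdSpan K x v := by
  rcases le_total n k with hnk | hnk
  · exact h.br_stdMon_mem_of_le h2 hnk hk ha hb
  · rw [h.anti _ _ _ _ (h.stdMon_mem n a) (h.stdMon_mem k b)]
    exact Submodule.neg_mem _ (Submodule.smul_mem _ _ (h.br_stdMon_mem_of_le h2 hnk hn hb ha))

end StdBracket

/-! ### Generation of the standard monomials -/

section Splitting

open Classical in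
/-- `α \ C` is split into the exponents of two standard monomials of lengths `n` and `k`. -/
def Splits (n k : ℕ) (C α : Finset ℕ) : Prop :=
  C ⊆ α ∧ ∃ P : ℕ → Prop, Standard n ((α \ C).filter P) ∧ Standard k ((α \ C).filter (¬P ·))

/-- Prepares $x^\alpha v_m$ as a bracket of monomials of length $m-3$, from
$[v_{m-3},v_{m-3}]=2x_{m-2}v_m$. All other letters but $x_{m-5}$ fit into a first-type factor;
$x_{m-5}$ becomes the top letter of the other one. For $m=10$ with $x_0,x_3$ these two are separated
instead, since $x_0x_3v_7$ is false. -/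
theorem splits_of_second {m : ℕ} {α : Finset ℕ} (h3 : 3 ≤ m) (hm : m - 2 ∈ α)
    (h : ∀ i ∈ α, i ≠ m - 2 → i + 5 ≤ m) (h5 : ¬(m = 5 ∧ 0 ∈ α)) (h7 : ¬(m = 7 ∧ 0 ∈ α))
    (h10 : ¬(m = 10 ∧ 0 ∈ α ∧ 3 ∈ α ∧ 5 ∈ α)) : Splits (m - 3) (m - 3) {m - 2} α := by
  refine ⟨by simpa using hm, ?_⟩
  by_cases hs : m = 10 ∧ 0 ∈ α ∧ 3 ∈ α
  · obtain ⟨rfl, h0, h3⟩ := hs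
    refine ⟨(· ≠ 3), standard_of_first (fun i hi => ?_) (fun hi => ?_),
      standard_of_first (fun i hi => ?_) (fun hi => ?_)⟩
    · simp only [Finset.mem_filter, Finset.mem_sdiff, Finset.mem_singleton] at hi
      have := h i hi.1.1 hi.1.2
      have : i ≠ 5 := fun h => h10 ⟨rfl, h0, h3, h ▸ hi.1.1⟩
      omega
    · simp
    · simp only [Finset.mem_filter, Finset.mem_sdiff, Finset.mem_singleton] at hi
      omega
    · simp at hi
  · refine ⟨(· ≠ m - 5), standard_of_first (fun i hi => ?_) (fun hi => ?_), ?_⟩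
    · simp only [Finset.mem_filter, Finset.mem_sdiff, Finset.mem_singleton] at hi
      have := h i hi.1.1 hi.1.2
      omega
    · simp only [Finset.mem_filter, Finset.mem_sdiff, Finset.mem_singleton] at hi ⊢
      refine ⟨fun h' => h7 ⟨by omega, hi.1.1⟩, fun h' h'' => hs ⟨by omega, hi.1.1, h''.1.1⟩⟩
    · by_cases h5' : m - 5 ∈ α
      · have := h _ h5' (by omega)
        have h6 : m ≠ 5 := fun h => h5 ⟨h, by simpa [h] using h5'⟩
        refine standard_of_second (by omega) ?_ (fun i hi hne => ?_) fun hi => ?_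
        · simp only [Finset.mem_filter, Finset.mem_sdiff, Finset.mem_singleton]
          exact ⟨⟨by rwa [show m - 3 - 2 = m - 5 by omega], by omega⟩, by omega⟩
        · simp only [Finset.mem_filter, Finset.mem_sdiff, Finset.mem_singleton] at hi
          omega
        · simp only [Finset.mem_filter, Finset.mem_sdiff, Finset.mem_singleton] at hi
          omega
      · refine (fun s (hs : s = ∅) => hs ▸ standard_empty _ :
          ∀ s : Finset ℕ, s = ∅ → Standard (m - 3) s) _ ?_
        refine Finset.eq_empty_of_forall_notMem fun i hi => ?_
        simp only [Finset.mem_filter, Finset.mem_sdiff, not_not] at hi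
        exact h5' (hi.2 ▸ hi.1.1)

/-- Prepares the use of $[v_{m-3},v_{m-2}]=-x_{m-3}v_m$. Here $x_{m-4}$ can only be the top letter
of $v_{m-2}$ and $x_{m-5}$ that of $v_{m-3}$ if both occur. If $x_{m-6}$ occurs as well,
$[v_{m-6},v_{m-2}]=-x_{m-6}x_{m-5}x_{m-3}v_m$ is used instead. The monomial $x_0x_1x_2v_5$ is left
over; it comes from $[v_0,v_2]$. -/
theorem splits_of_first {m : ℕ} {α : Finset ℕ} (h3 : 3 ≤ m) (hm : m - 3 ∈ α)
    (h : ∀ i ∈ α, i + 3 ≤ m) (h4 : ¬(m = 4 ∧ 0 ∈ α)) (h7 : ¬(m = 7 ∧ 0 ∈ α ∧ 3 ∈ α)) :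
    Splits (m - 3) (m - 2) {m - 3} α ∨ (m = 5 ∧ α = {0, 1, 2}) ∨
      (6 ≤ m ∧ Splits (m - 6) (m - 2) {m - 6, m - 5, m - 3} α) := by
  by_cases c4 : m - 4 ∈ α ∧ 4 ≤ m
  swap
  -- Here and below, $x_0$ is treated separately for small `m` where its usual place could produce
  -- one of the false monomials.
  · refine Or.inl ⟨by simpa using hm, fun i => i = 0 ∧ (m = 6 ∨ m = 9),
      standard_of_first (fun i hi => ?_) (fun hi => ?_),
      standard_of_first (fun i hi => ?_) (fun hi => ?_)⟩ <;>
    simp only [Finset.mem_filter, Finset.mem_sdiff, Finset.mem_singleton, true_and] at hi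
    · omega
    · omega
    · have := h i hi.1.1
      by_cases hi4 : i = m - 4
      · subst hi4
        exact absurd ⟨hi.1.1, by omega⟩ c4
      · omega
    · exact ⟨by omega, fun h' => by omega⟩
  have hne4 : m ≠ 4 := fun h => h4 ⟨h, by simpa [h] using c4.1⟩
  by_cases c5 : m - 5 ∈ α
  swap
  · refine Or.inl ⟨by simpa using hm, fun i => i ≠ m - 4 ∧ ¬(m = 10 ∧ i = 0),
      standard_of_first (fun i hi => ?_) (fun hi => ?_),
      standard_of_second (by omega) ?_ (fun i hi hne => ?_) (fun hi => ?_)⟩ <;>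
    simp only [Finset.mem_filter, Finset.mem_sdiff, Finset.mem_singleton, and_true] at *
    · have := h i hi.1.1
      have : i ≠ m - 5 := fun h => c5 (h ▸ hi.1.1)
      omega
    · exact ⟨fun h' => h7 ⟨by omega, hi.1.1, by
        have := c4.1; rwa [show m - 4 = 3 by omega] at this⟩, fun h' => by omega⟩
    · exact ⟨⟨by rw [show m - 2 - 2 = m - 4 by omega]; exact c4.1, by omega⟩, by omega⟩
    · omega
    · omega
  by_cases hm5 : m = 5
  · refine Or.inr (Or.inl ⟨hm5, ?_⟩)
    subst hm5
    ext i
    simp only [Finset.mem_insert, Finset.mem_singleton]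
    constructor
    · intro hi
      have := h i hi
      omega
    · rintro (rfl | rfl | rfl)
      · exact c5
      · exact c4.1
      · exact hm
  have h70 : ¬(m = 7 ∧ 0 ∈ α) := fun h' => h7 ⟨h'.1, h'.2, by
    have := c4.1; rwa [show m - 4 = 3 by omega] at this⟩
  by_cases c6 : m - 6 ∈ α
  swap
  · refine Or.inl ⟨by simpa using hm, fun i => i = m - 5 ∨ (i = 0 ∧ (m = 9 ∨ m = 12)),
      standard_of_second (by omega) ?_ (fun i hi hne => ?_) (fun hi => ?_),
      standard_of_second (by omega) ?_ (fun i hi hne => ?_) (fun hi => ?_)⟩ <;>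
    simp only [Finset.mem_filter, Finset.mem_sdiff, Finset.mem_singleton, true_and] at *
    · exact ⟨⟨by rwa [show m - 3 - 2 = m - 5 by omega], by omega⟩, by omega⟩
    · omega
    · omega
    · exact ⟨⟨by rw [show m - 2 - 2 = m - 4 by omega]; exact c4.1, by omega⟩, by omega⟩
    · have := h i hi.1.1
      have : i ≠ m - 6 := fun h => c6 (h ▸ hi.1.1)
      omega
    · have : m ≠ 7 := fun h => h70 ⟨h, hi.1.1⟩
      exact ⟨by omega, by omega, fun h' => by omega⟩
  · refine Or.inr (Or.inr ⟨by omega, ?_, fun i => i = 0 ∧ (m = 9 ∨ m = 12),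
      standard_of_first (fun i hi => ?_) (fun hi => ?_),
      standard_of_second (by omega) ?_ (fun i hi hne => ?_) (fun hi => ?_)⟩)
    · intro i hi
      simp only [Finset.mem_insert, Finset.mem_singleton] at hi
      rcases hi with rfl | rfl | rfl
      · exact c6
      · exact c5
      · exact hm
    all_goals simp only [Finset.mem_filter, Finset.mem_sdiff, Finset.mem_singleton,
      Finset.mem_insert, true_and] at *
    · omega
    · omega
    · exact ⟨⟨by rw [show m - 2 - 2 = m - 4 by omega]; exact c4.1, by omega⟩, by omega⟩
    · have := h i hi.1.1
      omega
    · have : m ≠ 7 := fun h => h70 ⟨h, hi.1.1⟩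
      exact ⟨by omega, by omega, fun h' => by omega⟩

end Splitting

section Generation

variable {K E : Type*} [Field K] [Ring E] [Algebra K E]
variable {N : ℕ} {x v d : ℕ → E} {par : ZMod 2 → Submodule K E}
  {br : ZMod 2 → ZMod 2 → E →ₗ[K] E →ₗ[K] E}

/-- The letters outside `C` have index below `n` or equal to `n + 2`, so $v_n$ does not act on those
of the second factor. The bracket of the two factors is then a nonzero multiple of $x^\alpha v_L$.
-/
theorem PivotSys.stdMon_mem_of_splits (h : PivotSys N x v d par br) {T : Submodule K E}
    (hT : ∀ n k a b, n + 2 < N → k + 2 < N → Standard n a → Standard k b →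
      stdMon x v n a ∈ T → stdMon x v k b ∈ T →
        br (a.card + 1) (b.card + 1) (stdMon x v n a) (stdMon x v k b) ∈ T)
    {n k L : ℕ} {C α : Finset ℕ} {w : K} (hnk : n ≤ k) (hk : k + 2 < N) (hw : w ≠ 0)
    (he : br 1 1 (v n) (v k) = w • (ordProd x C * v L)) (hs : Splits n k C α)
    (hα : ∀ i ∈ α, i ∉ C → i < n ∨ i = n + 2)
    (hn : ∀ a, Standard n a → stdMon x v n a ∈ T)
    (hk' : ∀ a, Standard k a → stdMon x v k a ∈ T) : stdMon x v L α ∈ T := by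
  classical
  obtain ⟨hC, P, h1, h2⟩ := hs
  set a := (α \ C).filter P
  set b := (α \ C).filter (¬P ·)
  obtain ⟨u, hu, e⟩ := h.br_stdMon (n := n) (k := k) (a := a) (b := b) fun i hi => by
    have := h1.add_two_le i hi; omega
  have hmem := hT n k a b (by omega) hk h1 h2 (hn _ h1) (hk' _ h2)
  rw [e, h.br_v_ordProd_eq_zero, zero_mul, mul_zero, zero_add, he, mul_smul_comm, mul_smul_comm,
    ← mul_assoc, ← mul_assoc] at hmem
  · have hab : Disjoint a b := Finset.disjoint_filter_filter_not _ _ _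
    have hun : a ∪ b = α \ C := Finset.filter_union_filter_not_eq _ _
    obtain ⟨u1, hu1, e1⟩ := exists_ordProd_mul (K := K) h.x_anti hab
    rw [hun] at e1
    obtain ⟨u2, hu2, e2⟩ := exists_ordProd_mul (K := K) h.x_anti
      (Finset.sdiff_disjoint : Disjoint (α \ C) C)
    rw [Finset.sdiff_union_of_subset hC] at e2
    rw [e1, smul_mul_assoc, e2] at hmem
    simp only [smul_mul_assoc, smul_smul] at hmem
    exact (Submodule.smul_mem_iff _ (by simp [hu, hw, hu1, hu2])).mp hmem
  · intro i hi
    have hi' := (Finset.mem_filter.mp hi).1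
    have hik := h2.add_two_le i hi
    rcases hα i (Finset.mem_sdiff.mp hi').1 (Finset.mem_sdiff.mp hi').2 with h' | h'
    · exact h.br_v_x_lt _ _ h'
    · exact h.br_v_x_eq_zero (by omega) fun r => by omega

/-- Induction on the length $m$. Second-type monomials and first-type ones containing $x_{m-3}$ are
brackets of shorter monomials; the others arise from those containing $x_{m-3}$ by removing this
letter. `T` is any subspace closed under brackets of standard monomials, so the argument serves the
hull and the Poisson subalgebra alike. -/
theorem PivotSys.stdMon_mem_of_gen (h : PivotSys N x v d par br) (h2 : (2 : K) ≠ 0)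
    {T : Submodule K E}
    (hT : ∀ n k a b, n + 2 < N → k + 2 < N → Standard n a → Standard k b →
      stdMon x v n a ∈ T → stdMon x v k b ∈ T →
        br (a.card + 1) (b.card + 1) (stdMon x v n a) (stdMon x v k b) ∈ T)
    (hv : ∀ i < 3, v i ∈ T) {m : ℕ} (hm : m + 2 < N) {α : Finset ℕ} (hα : Standard m α) :
    stdMon x v m α ∈ T := by
  induction m using Nat.strong_induction_on generalizing α with
  | _ m ih =>
    by_cases hm3 : m < 3
    · have : α = ∅ := by
        refine Finset.eq_empty_of_forall_notMem fun i hi => ?_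
        rcases hα with ⟨h1, -⟩ | ⟨⟨h1, -⟩, -⟩
        · have := h1 i hi; omega
        · omega
      rw [this, stdMon, ordProd_empty, one_mul]
      exact hv m hm3
    have ih' : ∀ n, n < m → ∀ a, Standard n a → stdMon x v n a ∈ T :=
      fun n hn a ha => ih n hn (by omega) ha
    obtain ⟨l, rfl⟩ : ∃ l, m = l + 3 := ⟨m - 3, by omega⟩
    have hself := h.br_v_v_self (n := l) (by omega)
    rw [← ordProd_singleton x] at hself
    have hone := h.br_v_v_one (n := l) (by omega)
    rw [← ordProd_singleton x, ← neg_one_smul K] at hone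
    have first : ∀ α, Standard (l + 3) α → (∀ i ∈ α, i ≤ l) → l ∈ α →
        stdMon x v (l + 3) α ∈ T := by
      intro α hα hle hl
      have hex : ¬(l + 3 = 4 ∧ 0 ∈ α) ∧ ¬(l + 3 = 7 ∧ 0 ∈ α ∧ 3 ∈ α) := by
        rcases hα with ⟨-, h4⟩ | ⟨⟨-, h3, -⟩, -⟩
        · exact h4
        · have := hle _ h3; omega
      rcases splits_of_first (m := l + 3) (by omega) (by simpa using hl)
        (fun i hi => by have := hle i hi; omega) hex.1 hex.2 with hs | ⟨h5, rfl⟩ | ⟨h6, hs⟩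
      · refine h.stdMon_mem_of_splits hT (by omega) (by omega) (by simp) hone hs (fun i hi hne => ?_)
          (ih' _ (by omega)) (ih' _ (by omega))
        have := hle i hi
        simp at hne
        omega
      · obtain rfl : l = 2 := by omega
        have e := h.br_v_v_two (n := 0) (by omega)
        have hmem := hT 0 2 ∅ ∅ (by omega) (by omega) (standard_empty _) (standard_empty _)
          (ih' 0 (by omega) _ (standard_empty _)) (ih' 2 (by omega) _ (standard_empty _))
        simp only [stdMon, ordProd_empty, one_mul, Finset.card_empty, Nat.cast_zero,
          zero_add] at hmem e
        rw [e] at hmem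
        have := (Submodule.neg_mem_iff _).mp hmem
        rwa [← ordProd_singleton x 2, ← ordProd_pair_insert x (by simp)] at this
      · obtain ⟨k, rfl⟩ : ∃ k, l = k + 3 := ⟨l - 3, by omega⟩
        have e := h.br_v_v_step (n := k) (k := k + 4) (by omega)
        rw [h.br_v_v_one (n := k + 3) (by omega), mul_neg, ← mul_assoc,
          ← ordProd_singleton x (k + 3), ← ordProd_pair_insert x (by simp), ← neg_one_smul K] at e
        refine h.stdMon_mem_of_splits hT (n := k) (k := k + 4) (by omega) (by omega) (by simp) e hs
          (fun i hi hne => ?_) (ih' _ (by omega)) (ih' _ (by omega))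
        have := hle i hi
        simp at hne
        omega
    rcases hα with ⟨h1, h4, h7⟩ | ⟨⟨h3, hl, h1⟩, h5, h7, h10⟩
    · have hα : Standard (l + 3) α := Or.inl ⟨h1, h4, h7⟩
      by_cases hl : l ∈ α
      · exact first α hα (fun i hi => by have := h1 i hi; omega) hl
      · have hlt : ∀ i ∈ α, i < l := fun i hi => by
          have := h1 i hi
          have : i ≠ l := fun h => hl (h ▸ hi)
          omega
        -- Without $x_l$, insert it and then bracket with $v_l$, which strips it off again. The
        -- summand containing $[v_l,v_{l+3}]$ is killed by $x_l^2=0$. Inserting $x_{m-3}$ never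
        -- creates a false monomial.
        have hα' : Standard (l + 3) (insert l α) := by
          refine standard_of_first (fun i hi => ?_) fun h0 => ?_
          · rcases Finset.mem_insert.mp hi with rfl | hi
            · omega
            · exact h1 i hi
          · rcases Finset.mem_insert.mp h0 with h0 | h0
            · omega
            · refine ⟨fun h => h4 ⟨h, h0⟩, fun h h' => ?_⟩
              rcases Finset.mem_insert.mp h' with h' | h'
              · omega
              · exact h7 ⟨h, h0, h'⟩
        have hmem := hT l (l + 3) ∅ (insert l α) (by omega) (by omega) (standard_empty _) hα'
          (ih' _ (by omega) _ (standard_empty _)) (first _ hα' (fun i hi => by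
            rcases Finset.mem_insert.mp hi with rfl | hi
            · exact le_rfl
            · exact (hlt i hi).le) (Finset.mem_insert_self _ _))
        obtain ⟨u, -, e⟩ := h.br_stdMon (n := l) (k := l + 3) (a := ∅) (b := insert l α) (by simp)
        have hXα := h.toSuperBr.ordProd_mem h.x_mem α
        rw [e, h.br_v_v_step (by omega), ← mul_assoc (ordProd x (insert l α)),
          ← mul_assoc (ordProd x (insert l α)), ordProd_insert_max x hlt,
          mul_assoc (ordProd x α), h.x_sq, Finset.card_insert_of_notMem hl, Nat.cast_succ,
          h.toSuperBr.leib_right (h.v_mem l) hXα (h.x_mem l),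
          h.br_v_ordProd_eq_zero fun i hi => h.br_v_x_lt _ _ (hlt i hi),
          h.br_v_x_self (by omega), ordProd_empty] at hmem
        simp only [zero_mul, mul_zero, zero_add, mul_one, smul_zero, add_zero, one_mul,
          smul_mul_assoc] at hmem
        exact (Submodule.smul_mem_iff _ (ssign_ne_zero _ _)).mp hmem
    · refine h.stdMon_mem_of_splits hT le_rfl (by omega) h2 hself
        (splits_of_second h3 hl h1 h5 h7 h10) (fun i hi hne => ?_) (ih' _ (by omega))
        (ih' _ (by omega))
      have := h1 i hi (by simpa using hne)
      omega

end Generation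

/-! ### The pivot elements as operators -/

section EndSystem

variable (K : Type*) [Field K]

/-- The unit of the Grassmann algebra. -/
def lamOne : Lam K := (1 : ExteriorAlgebra K (ℕ →₀ K))

theorem xOp_sq (i : ℕ) : xOp K i * xOp K i = 0 := by
  refine LinearMap.ext fun (f : ExteriorAlgebra K (ℕ →₀ K)) => ?_
  exact (mul_assoc (gen K i) (gen K i) f).symm.trans
    ((congrArg (fun a : ExteriorAlgebra K (ℕ →₀ K) => a * f) (ExteriorAlgebra.ι_sq_zero _)).trans
      (zero_mul (M₀ := ExteriorAlgebra K (ℕ →₀ K)) f))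

theorem xOp_anti (i j : ℕ) : xOp K i * xOp K j = -(xOp K j * xOp K i) := by
  refine LinearMap.ext fun (f : ExteriorAlgebra K (ℕ →₀ K)) => ?_
  have h : gen K i * gen K j = -(gen K j * gen K i) :=
    eq_neg_of_add_eq_zero_left (ExteriorAlgebra.ι_add_mul_swap _ _)
  exact (mul_assoc (gen K i) (gen K j) f).symm.trans
    ((congrArg (fun a : ExteriorAlgebra K (ℕ →₀ K) => a * f) h).trans
      ((neg_mul (α := ExteriorAlgebra K (ℕ →₀ K)) (gen K j * gen K i) f).trans
        (congrArg (fun a : ExteriorAlgebra K (ℕ →₀ K) => -a) (mul_assoc (gen K j) (gen K i) f))))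

theorem dOp_mul_xOp (i j : ℕ) :
    dOp K i * xOp K j = (if i = j then 1 else 0) - xOp K j * dOp K i := by
  refine LinearMap.ext fun f => (dOp_xOp K i j f).trans ?_
  split_ifs <;> rfl

theorem dOp_anti (i j : ℕ) : dOp K i * dOp K j = -(dOp K j * dOp K i) :=
  LinearMap.ext fun f => CliffordAlgebra.contractLeft_comm (Q := (0 : QuadraticForm K (ℕ →₀ K))) _ _ f

theorem dOp_sq (i : ℕ) : dOp K i * dOp K i = 0 :=
  LinearMap.ext fun f =>
    CliffordAlgebra.contractLeft_contractLeft (Q := (0 : QuadraticForm K (ℕ →₀ K))) _ f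

theorem pivot_apply_eq_sum {i N : ℕ} {f : Lam K} (h : ∀ k, N ≤ k → dOp K (i + 3 * k) f = 0) :
    pivot K i f = ∑ k ∈ Finset.range N, ordProd (xOp K) (pivotTail i k) (dOp K (i + 3 * k) f) := by
  change (∑ᶠ k, xProd K (pivotTail i k) (dOp K (i + 3 * k) f)) = _
  refine finsum_eq_sum_of_support_subset _ fun k hk => ?_
  rw [Finset.coe_range, Set.mem_Iio]
  by_contra hN
  exact hk (by simp only [h k (by omega), map_zero])

theorem pivot_eq (i : ℕ) : pivot K i = dOp K i + xOp K i * xOp K (i + 1) * pivot K (i + 3) := by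
  refine LinearMap.ext fun f => ?_
  obtain ⟨N, hN⟩ := dOp_eventually_zero K f
  rw [pivot_apply_eq_sum K (N := N + 1) fun k hk => hN _ (by omega), Finset.sum_range_succ',
    LinearMap.add_apply, Module.End.mul_apply,
    pivot_apply_eq_sum K (N := N) fun k hk => hN _ (by omega), map_sum, add_comm]
  refine congrArg₂ _ ?_ (Finset.sum_congr rfl fun k _ => ?_)
  · rw [pivotTail_zero, ordProd_empty]; rfl
  · rw [pivotTail_succ, ordProd_pair_insert _ fun j hj => by
      have := le_of_mem_pivotTail hj; omega, show i + 3 * (k + 1) = i + 3 + 3 * k by ring]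
    rfl

theorem pivot_eventually_zero (f : Lam K) : ∃ N, ∀ i, N ≤ i → pivot K i f = 0 := by
  obtain ⟨N, hN⟩ := dOp_eventually_zero K f
  refine ⟨N, fun i hi => ?_⟩
  rw [pivot_apply_eq_sum K (N := 0) fun k _ => hN _ (by omega), Finset.sum_range_zero]

/-- A family of operators with a recursion of step three vanishes if it vanishes pointwise from
some index on. -/
theorem eq_zero_of_step {A B : ℕ → Module.End K (Lam K)} {n : ℕ}
    (h : ∀ k, n ≤ k → A k = B k * A (k + 3)) (h0 : ∀ f, ∃ N, ∀ k, N ≤ k → A k f = 0) {k : ℕ}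
    (hk : n ≤ k) : A k = 0 := by
  refine LinearMap.ext fun f => ?_
  obtain ⟨N, hN⟩ := h0 f
  induction hm : N - k using Nat.strong_induction_on generalizing k with
  | _ m ih =>
    by_cases hkN : N ≤ k
    · exact hN k hkN
    · rw [h k hk, Module.End.mul_apply, ih (N - (k + 3)) (by omega) (k := k + 3) (by omega) rfl]
      exact map_zero _

/-- The anticommutator $A_n$ of $v_n$ and $x_j$ satisfies $A_n=x_nx_{n+1}A_{n+3}$ and vanishes on
any given element for large $n$, hence it is zero. The same argument works for $\partial_n$ and
$v_k$ below. -/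
theorem pivot_xOp {n j : ℕ} (hj : j < n) : pivot K n * xOp K j = -(xOp K j * pivot K n) := by
  refine eq_neg_of_add_eq_zero_left
    (eq_zero_of_step K (A := fun n => pivot K n * xOp K j + xOp K j * pivot K n)
      (B := fun n => xOp K n * xOp K (n + 1)) (n := j + 1) (fun k hk => ?_) (fun f => ?_) hj)
  · have hx : xOp K j * (xOp K k * xOp K (k + 1)) = xOp K k * xOp K (k + 1) * xOp K j := by
      rw [← mul_assoc, xOp_anti K j k, neg_mul, mul_assoc, xOp_anti K j (k + 1), mul_neg, neg_neg,
        mul_assoc]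
    rw [pivot_eq, add_mul, mul_add, dOp_mul_xOp, if_neg (by omega), mul_add, ← mul_assoc (xOp K j),
      hx]
    simp only [mul_assoc]
    abel
  · obtain ⟨N, hN⟩ := pivot_eventually_zero K f
    obtain ⟨M, hM⟩ := pivot_eventually_zero K (xOp K j f)
    refine ⟨max N M, fun k hk => ?_⟩
    rw [LinearMap.add_apply, Module.End.mul_apply, Module.End.mul_apply,
      hM k ((le_max_right _ _).trans hk), hN k ((le_max_left _ _).trans hk), map_zero, add_zero]

theorem dOp_pivot {n k : ℕ} (hk : n < k) : dOp K n * pivot K k + pivot K k * dOp K n = 0 := by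
  refine eq_zero_of_step K (A := fun k => dOp K n * pivot K k + pivot K k * dOp K n)
      (B := fun n => xOp K n * xOp K (n + 1)) (n := n + 1) (fun k hk => ?_) (fun f => ?_) hk
  · have hx : ∀ j, n < j → dOp K n * xOp K j = -(xOp K j * dOp K n) := fun j hj => by
      rw [dOp_mul_xOp, if_neg hj.ne, zero_sub]
    rw [pivot_eq, add_mul, mul_add, dOp_anti K n k, mul_add, ← mul_assoc (dOp K n),
      ← mul_assoc (dOp K n), hx k (by omega), neg_mul, mul_assoc (xOp K k), hx (k + 1) (by omega)]
    simp only [mul_neg, neg_neg, mul_assoc]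
    abel
  · obtain ⟨N, hN⟩ := pivot_eventually_zero K f
    obtain ⟨M, hM⟩ := pivot_eventually_zero K (dOp K n f)
    refine ⟨max N M, fun k hk => ?_⟩
    rw [LinearMap.add_apply, Module.End.mul_apply, Module.End.mul_apply,
      hM k ((le_max_right _ _).trans hk), hN k ((le_max_left _ _).trans hk), map_zero, add_zero]

/-! ### Parities of operators -/

theorem one_mem_endPar : (1 : Module.End K (Lam K)) ∈ endPar K 0 := fun j _ hf => by
  rw [zero_add]; exact hf

theorem mul_mem_endPar {i j : ZMod 2} {a b : Module.End K (Lam K)} (ha : a ∈ endPar K i)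
    (hb : b ∈ endPar K j) : a * b ∈ endPar K (i + j) := fun k f hf => by
  rw [add_assoc]; exact ha _ _ (hb _ _ hf)

theorem xOp_mem_endPar (i : ℕ) : xOp K i ∈ endPar K 1 := fun j _ hf =>
  CliffordAlgebra.evenOdd_mul_le (0 : QuadraticForm K (ℕ →₀ K)) 1 j
    (Submodule.mul_mem_mul (CliffordAlgebra.ι_mem_evenOdd_one _ _) hf)

theorem contractLeft_mem_evenOdd (l : Module.Dual K (ℕ →₀ K)) (n : ZMod 2)
    {f : CliffordAlgebra (0 : QuadraticForm K (ℕ →₀ K))}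
    (hf : f ∈ CliffordAlgebra.evenOdd (0 : QuadraticForm K (ℕ →₀ K)) n) :
    CliffordAlgebra.contractLeft l f ∈
      CliffordAlgebra.evenOdd (0 : QuadraticForm K (ℕ →₀ K)) (1 + n) := by
  induction f, hf using CliffordAlgebra.evenOdd_induction with
  | range_ι_pow v h =>
    rcases zmod_two_cases n with rfl | rfl
    · rw [show ZMod.val (0 : ZMod 2) = 0 from rfl, pow_zero] at h
      obtain ⟨r, rfl⟩ := Submodule.mem_one.mp h
      rw [CliffordAlgebra.contractLeft_algebraMap]
      exact Submodule.zero_mem _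
    · rw [show ZMod.val (1 : ZMod 2) = 1 from rfl, pow_one] at h
      obtain ⟨r, rfl⟩ := h
      rw [CliffordAlgebra.contractLeft_ι, Algebra.algebraMap_eq_smul_one]
      exact Submodule.smul_mem _ _ (CliffordAlgebra.one_le_evenOdd_zero _
        (Submodule.one_le.mp le_rfl))
  | add x y hx hy h1 h2 =>
    rw [map_add]
    exact Submodule.add_mem _ h1 h2
  | ι_mul_ι_mul m₁ m₂ y hy h =>
    have hm := fun m => CliffordAlgebra.ι_mem_evenOdd_one (0 : QuadraticForm K (ℕ →₀ K)) m
    have hmul := fun m (j : ZMod 2) y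
      (hy : y ∈ CliffordAlgebra.evenOdd (0 : QuadraticForm K (ℕ →₀ K)) j) =>
      CliffordAlgebra.evenOdd_mul_le _ 1 j (Submodule.mul_mem_mul (hm m) hy)
    rw [mul_assoc, CliffordAlgebra.contractLeft_ι_mul, CliffordAlgebra.contractLeft_ι_mul]
    refine Submodule.sub_mem _ (Submodule.smul_mem _ _ (hmul _ _ _ hy)) ?_
    refine hmul _ _ _ (Submodule.sub_mem _ (Submodule.smul_mem _ _ ?_) ?_)
    · exact hy
    · have := hmul m₂ _ _ h
      rwa [← add_assoc, CharTwo.add_self_eq_zero, zero_add] at this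

theorem dOp_mem_endPar (i : ℕ) : dOp K i ∈ endPar K 1 := fun j _ hf =>
  contractLeft_mem_evenOdd K _ j hf

/-- The supercommutator as a bilinear map. -/
def scommB (p q : ZMod 2) :
    Module.End K (Lam K) →ₗ[K] Module.End K (Lam K) →ₗ[K] Module.End K (Lam K) :=
  LinearMap.mul K _ - ssign K p q • (LinearMap.mul K _).flip

theorem scommB_apply (p q : ZMod 2) (a b : Module.End K (Lam K)) :
    scommB K p q a b = scomm K p q a b := rfl

theorem scomm_one_one (a b : Module.End K (Lam K)) : scomm K 1 1 a b = a * b + b * a := by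
  rw [scomm, ssign_one_one, neg_one_smul, sub_neg_eq_add]

theorem superBr_end : SuperBr (endPar K) (scommB K) where
  one_mem := one_mem_endPar K
  mul_mem _ _ _ _ ha hb := mul_mem_endPar K ha hb
  anti i j a b _ _ := by
    rw [scommB_apply, scommB_apply, scomm, scomm, smul_sub, smul_smul, ssign_comm j i,
      ssign_mul_self, one_smul, neg_sub]
  leib i j k a b c _ _ _ := by
    simp only [scommB_apply, scomm, ssign_add_left, mul_sub, sub_mul, smul_sub, mul_smul_comm,
      smul_mul_assoc, smul_smul, mul_assoc, mul_comm (ssign K j k)]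
    abel

theorem ordProd_xOp_mem (s : Finset ℕ) : ordProd (xOp K) s ∈ endPar K s.card :=
  (superBr_end K).ordProd_mem (xOp_mem_endPar K) s

theorem card_pivotTail (i k : ℕ) : ((pivotTail i k).card : ZMod 2) = 0 := by
  induction k generalizing i with
  | zero => simp [pivotTail_zero]
  | succ k ih =>
    have h1 : i + 1 ∉ pivotTail (i + 3) k := fun h => by have := le_of_mem_pivotTail h; omega
    have h2 : i ∉ insert (i + 1) (pivotTail (i + 3) k) := fun h => by
      rcases Finset.mem_insert.mp h with h | h
      · omega
      · have := le_of_mem_pivotTail h; omega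
    rw [pivotTail_succ, Finset.card_insert_of_notMem h2, Finset.card_insert_of_notMem h1,
      Nat.cast_succ, Nat.cast_succ, ih, zero_add]
    decide

theorem pivot_mem_endPar (i : ℕ) : pivot K i ∈ endPar K 1 := fun j f hf => by
  obtain ⟨N, hN⟩ := dOp_eventually_zero K f
  rw [pivot_apply_eq_sum K (N := N) fun k hk => hN _ (by omega)]
  refine Submodule.sum_mem _ fun k _ => ?_
  have := ordProd_xOp_mem K (pivotTail i k) _ _ (dOp_mem_endPar K (i + 3 * k) _ _ hf)
  rwa [card_pivotTail, zero_add] at this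

theorem pivotSys_end (N : ℕ) : PivotSys N (xOp K) (pivot K) (dOp K) (endPar K) (scommB K) where
  toSuperBr := superBr_end K
  x_mem := xOp_mem_endPar K
  v_mem := pivot_mem_endPar K
  d_mem := dOp_mem_endPar K
  x_sq := xOp_sq K
  x_anti := xOp_anti K
  v_x _ _ h := pivot_xOp K h
  v_eq := pivot_eq K
  br_x_x i j := by rw [scommB_apply, scomm_one_one, xOp_anti K i j, neg_add_cancel]
  br_d_x n j _ := by rw [scommB_apply, scomm_one_one, dOp_mul_xOp, sub_add_cancel]
  br_v_x_lt n j h := by rw [scommB_apply, scomm_one_one, pivot_xOp K h, neg_add_cancel]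
  br_d_v n k h := by rw [scommB_apply, scomm_one_one, dOp_pivot K h]
  br_d_d n := by rw [scommB_apply, scomm_one_one, dOp_sq, add_zero]

end EndSystem

/-! ### Linear independence -/

section LinIndep

variable {K E : Type*} [Field K] [Ring E] [Algebra K E]

/-- Linear independence of the monomials `x^α v^β` by means of a chain of left ideals. -/
theorem linearIndependent_of_chain {x v : ℕ → E} (I : ℕ → Submodule K E)
    (hanti : ∀ n, I (n + 1) ≤ I n) (hleft : ∀ n a b, b ∈ I n → a * b ∈ I n)
    (hv : ∀ n, v n ∈ I n) (hF : ∀ n F, F * v n ∈ I (n + 1) → F ∈ I n)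
    (h0 : ∀ c : Finset ℕ →₀ K, (c.sum fun a r => r • ordProd x a) ∈ I 0 → c = 0) :
    LinearIndependent K fun w : Finset ℕ × Finset ℕ => ordProd x w.1 * ordProd v w.2 := by
  classical
  let M : (Finset ℕ × Finset ℕ →₀ K) → E := fun c => c.sum fun w r =>
    r • (ordProd x w.1 * ordProd v w.2)
  have hM : ∀ c, M c = Finsupp.linearCombination K
    (fun w : Finset ℕ × Finset ℕ => ordProd x w.1 * ordProd v w.2) c := fun _ => rfl
  -- Induction on a bound for the letters $v_j$ involved. The part divisible by $v_n$ lies in `I n`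
  -- anyway, so the part `c0` without $v_n$ lies there too and vanishes by induction. Cancelling
  -- $v_n$ from the rest by `hF` leaves `c2`, which vanishes for the same reason.
  have key : ∀ n (c : Finset ℕ × Finset ℕ →₀ K), (∀ w ∈ c.support, ∀ j ∈ w.2, j < n) →
      M c ∈ I n → c = 0 := by
    intro n
    induction n with
    | zero =>
      intro c hc hI
      have hinj : Set.InjOn Prod.fst (c.support : Set (Finset ℕ × Finset ℕ)) := by
        intro w hw w' hw' h
        have h1 : w.2 = ∅ := Finset.eq_empty_of_forall_notMem fun j hj => by
          simpa using hc w hw j hj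
        have h2 : w'.2 = ∅ := Finset.eq_empty_of_forall_notMem fun j hj => by
          simpa using hc w' hw' j hj
        exact Prod.ext h (h1.trans h2.symm)
      have := h0 (c.mapDomain Prod.fst) (by
        rw [Finsupp.sum_mapDomain_index (by simp) (by simp [add_smul])]
        convert hI using 1
        refine Finset.sum_congr rfl fun w hw => ?_
        have h1 : w.2 = ∅ := Finset.eq_empty_of_forall_notMem fun j hj => by
          simpa using hc w hw j hj
        change c w • _ = c w • (_ * _)
        rw [h1, ordProd_empty, mul_one])
      exact Finsupp.mapDomain_injOn _ hinj (Set.Subset.refl _) (by simp)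
        (this.trans Finsupp.mapDomain_zero.symm)
    | succ n ih =>
      intro c hc hI
      let c0 := c.filter fun w => n ∉ w.2
      let c1 := c.filter fun w => ¬ n ∉ w.2
      have hcc : c0 + c1 = c := Finsupp.filter_add_filter_not _ _
      let e : Finset ℕ × Finset ℕ → Finset ℕ × Finset ℕ := fun w => (w.1, w.2.erase n)
      let c2 := c1.mapDomain e
      have hs1 : ∀ w ∈ c1.support, w ∈ c.support ∧ n ∈ w.2 := fun w hw => by
        simpa [c1] using hw
      have hinj : Set.InjOn e (c1.support : Set (Finset ℕ × Finset ℕ)) := by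
        intro w hw w' hw' h
        have h1 := Prod.ext_iff.mp h
        refine Prod.ext h1.1 ?_
        rw [← Finset.insert_erase (hs1 w hw).2, ← Finset.insert_erase (hs1 w' hw').2]
        exact congrArg (insert n) h1.2
      have hlt : ∀ w ∈ c1.support, ∀ j ∈ (e w).2, j < n := fun w hw j hj => by
        have h1 := hc w (hs1 w hw).1 j (Finset.mem_of_mem_erase hj)
        have h2 := Finset.ne_of_mem_erase hj
        omega
      have hM1 : M c1 = M c2 * v n := by
        change c1.sum _ = (c1.mapDomain e).sum _ * _
        rw [Finsupp.sum_mapDomain_index (by simp) (by simp [add_smul]), Finsupp.sum,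
          Finsupp.sum, Finset.sum_mul]
        refine Finset.sum_congr rfl fun w hw => ?_
        rw [smul_mul_assoc, mul_assoc, ← ordProd_insert_max v (hlt w hw),
          Finset.insert_erase (hs1 w hw).2]
      have hMc : M c = M c0 + M c1 := by rw [hM, hM, hM, ← map_add, hcc]
      have hI1 : M c1 ∈ I n := hM1 ▸ hleft _ _ _ (hv n)
      have hc0 : c0 = 0 := by
        refine ih c0 (fun w hw j hj => ?_) ?_
        · have hw' : w ∈ c.support ∧ n ∉ w.2 := by simpa [c0] using hw
          have h1 := hc w hw'.1 j hj
          have h2 : j ≠ n := fun h => hw'.2 (h ▸ hj)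
          omega
        · have := Submodule.sub_mem _ (hanti n hI) hI1
          rwa [hMc, add_sub_cancel_right] at this
      have hc2 : c2 = 0 := by
        refine ih c2 (fun w hw => ?_) (hF n _ ?_)
        · obtain ⟨w', hw', rfl⟩ := Finset.mem_image.mp (Finsupp.mapDomain_support hw)
          exact hlt w' hw'
        · rw [← hM1]
          rw [hMc, hc0, hM, map_zero, zero_add] at hI
          exact hI
      have hc1 : c1 = 0 := Finsupp.mapDomain_injOn _ hinj (Set.Subset.refl _) (by simp)
        (hc2.trans Finsupp.mapDomain_zero.symm)
      rw [← hcc, hc0, hc1, add_zero]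
  rw [linearIndependent_iff]
  intro c hc
  obtain ⟨n, hn⟩ : ∃ n, ∀ w ∈ c.support, ∀ j ∈ w.2, j < n :=
    ⟨(c.support.biUnion Prod.snd).sup id + 1, fun w hw j hj => Nat.lt_succ_of_le
      (Finset.le_sup (f := id) (Finset.mem_biUnion.mpr ⟨w, hw, hj⟩))⟩
  refine key n c hn ?_
  rw [hM, hc]
  exact Submodule.zero_mem _

end LinIndep

/-! ### Independence of the operators $x^\alpha v^\beta$, via their action on the unit and on
subalgebras of $\Lambda$ -/

section EndIndep

variable (K : Type*) [Field K]

theorem dOp_ordProd {n : ℕ} {s : Finset ℕ} (hs : n ∉ s) :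
    dOp K n * ordProd (xOp K) s = (-1 : K) ^ s.card • (ordProd (xOp K) s * dOp K n) :=
  ordProd_anticomm fun i hi => by
    rw [dOp_mul_xOp, if_neg (fun h : n = i => hs (h ▸ hi)), zero_sub]

theorem dOp_ordProd_lamOne {n : ℕ} {s : Finset ℕ} (hs : n ∉ s) :
    dOp K n (ordProd (xOp K) s (lamOne K)) = 0 := by
  rw [← Module.End.mul_apply, dOp_ordProd K hs, LinearMap.smul_apply, Module.End.mul_apply]
  change _ • ordProd (xOp K) s (dOp K n (1 : ExteriorAlgebra K (ℕ →₀ K))) = 0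
  rw [dOp_one, map_zero, smul_zero]

theorem ordProd_dOp_eq_zero {s t : Finset ℕ} (h : ¬s ⊆ t) :
    ordProd (dOp K) s (ordProd (xOp K) t (lamOne K)) = 0 := by
  obtain ⟨i, hi, hit⟩ := Finset.not_subset.mp h
  obtain ⟨u, hu, e⟩ := exists_mul_ordProd (K := K) (dOp_anti K) (Finset.notMem_erase i s)
  rw [Finset.insert_erase hi, ordProd_anticomm (K := K) fun j _ => dOp_anti K i j] at e
  rw [← inv_smul_smul₀ hu (ordProd (dOp K) s), ← e, LinearMap.smul_apply, LinearMap.smul_apply,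
    Module.End.mul_apply, dOp_ordProd_lamOne K hit, map_zero, smul_zero, smul_zero]

theorem ordProd_dOp_self (s : Finset ℕ) : ∃ u : K, u ≠ 0 ∧
    ordProd (dOp K) s (ordProd (xOp K) s (lamOne K)) = u • lamOne K := by
  induction s using Finset.induction_on_min with
  | empty => exact ⟨1, one_ne_zero, by rw [ordProd_empty, ordProd_empty, one_smul]; rfl⟩
  | insert i s hi ih =>
    obtain ⟨u, hu, e⟩ := ih
    refine ⟨(-1) ^ s.card * u, mul_ne_zero (by simp) hu, ?_⟩
    have hd : dOp K i * ordProd (dOp K) s = (-1 : K) ^ s.card • (ordProd (dOp K) s * dOp K i) :=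
      ordProd_anticomm fun j _ => dOp_anti K i j
    rw [ordProd_insert_min _ hi, ordProd_insert_min _ hi, hd, LinearMap.smul_apply,
      Module.End.mul_apply, Module.End.mul_apply, dOp_xOp, if_pos rfl,
      dOp_ordProd_lamOne K fun h => lt_irrefl _ (hi i h), map_zero, sub_zero, e, smul_smul]

/-- For an exponent `a` of maximal size in the support, the product of the derivatives in `a` kills
all other monomials and sends $x^a$ to a nonzero scalar. -/
theorem ordProd_xOp_one_indep (c : Finset ℕ →₀ K)
    (hc : (c.sum fun a r => r • ordProd (xOp K) a) (lamOne K) = 0) : c = 0 := by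
  by_contra hne
  obtain ⟨a, ha, hmax⟩ := Finset.exists_max_image c.support Finset.card
    (Finsupp.support_nonempty_iff.mpr hne)
  obtain ⟨u, hu, e⟩ := ordProd_dOp_self K a
  have h := congrArg (⇑(ordProd (dOp K) a)) hc
  rw [map_zero, Finsupp.sum, LinearMap.sum_apply, map_sum, Finset.sum_eq_single a] at h
  · rw [LinearMap.smul_apply, map_smul, e, smul_smul] at h
    rcases smul_eq_zero.mp h with h | h
    · exact (Finsupp.mem_support_iff.mp ha) ((mul_eq_zero.mp h).resolve_right hu)
    · exact one_ne_zero (α := ExteriorAlgebra K (ℕ →₀ K)) h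
  · intro b hb hba
    rw [LinearMap.smul_apply, map_smul, ordProd_dOp_eq_zero, smul_zero]
    exact fun hab => hba (Finset.eq_of_subset_of_card_le hab (hmax b hb)).symm
  · exact fun h => absurd ha h

/-- The operators that vanish on the Grassmann subalgebra with the letters `x_i`, `i < n`. -/
def killIdeal (n : ℕ) : Submodule K (Module.End K (Lam K)) where
  carrier := {F | ∀ s : Finset ℕ, (∀ i ∈ s, i < n) → F (ordProd (xOp K) s (lamOne K)) = 0}
  add_mem' h₁ h₂ s hs := by rw [LinearMap.add_apply, h₁ s hs, h₂ s hs, add_zero]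
  zero_mem' _ _ := rfl
  smul_mem' c F h s hs := by rw [LinearMap.smul_apply, h s hs, smul_zero]

theorem pivot_lamOne (n : ℕ) : pivot K n (lamOne K) = 0 := by
  rw [pivot_apply_eq_sum K (N := 0) (f := lamOne K) fun k _ => dOp_one K _, Finset.sum_range_zero]

theorem pivot_mem_killIdeal (n : ℕ) : pivot K n ∈ killIdeal K n := fun s hs => by
  rw [← Module.End.mul_apply, ordProd_anticomm (K := K) fun i hi => pivot_xOp K (hs i hi),
    LinearMap.smul_apply, Module.End.mul_apply, pivot_lamOne, map_zero, smul_zero]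

/-- If $w$ has only letters of index below $n$, then $v_nw=0$ and $[v_n,x_n]=1$ give $v_n(x_nw)=w$.
So $Fw=(Fv_n)(x_nw)$, and $x_nw$ has only letters of index below $n+1$. -/
theorem mem_killIdeal_of_mul {n : ℕ} {F : Module.End K (Lam K)}
    (h : F * pivot K n ∈ killIdeal K (n + 1)) : F ∈ killIdeal K n := fun s hs => by
  have h1 := h (insert n s) fun i hi => by
    rcases Finset.mem_insert.mp hi with rfl | hi
    · omega
    · have := hs i hi; omega
  have hn : n ∉ s := fun h => lt_irrefl _ (hs n h)
  obtain ⟨u, hu, e⟩ := exists_mul_ordProd (K := K) (xOp_anti K) hn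
  have e2 := (pivotSys_end K (n + 1)).br_v_x_self (n := n) (by omega)
  rw [scommB_apply, scomm_one_one] at e2
  have e3 : pivot K n (xOp K n (ordProd (xOp K) s (lamOne K))) =
      ordProd (xOp K) s (lamOne K) := by
    have := congrArg (fun g : Module.End K (Lam K) => g (ordProd (xOp K) s (lamOne K))) e2
    simp only [LinearMap.add_apply, Module.End.mul_apply, Module.End.one_apply] at this
    rwa [pivot_mem_killIdeal K n s hs, map_zero, add_zero] at this
  rw [← e3, ← Module.End.mul_apply (xOp K n), e, LinearMap.smul_apply, map_smul, map_smul,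
    ← Module.End.mul_apply F, h1, smul_zero]

theorem linearIndependent_end : LinearIndependent K fun w : Finset ℕ × Finset ℕ =>
    ordProd (xOp K) w.1 * ordProd (pivot K) w.2 := by
  refine linearIndependent_of_chain (killIdeal K) (fun n F h s hs => h s fun i hi => ?_)
    (fun n a b hb s hs => ?_) (pivot_mem_killIdeal K) (fun n F h => mem_killIdeal_of_mul K h)
    fun c hc => ordProd_xOp_one_indep K c ?_
  · have := hs i hi; omega
  · rw [Module.End.mul_apply, hb s hs, map_zero]
  · have := hc ∅ (by simp)
    rwa [ordProd_empty] at this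

end EndIndep

/-! ### The signs of the products of monomials -/

section SerSign

theorem inv_eq_sum (S T : Finset ℕ) : inv S T = ∑ p ∈ S, ∑ q ∈ T, if q < p then 1 else 0 := by
  rw [inv, Finset.card_filter, Finset.sum_product]

theorem inv_union_left {S S' : Finset ℕ} (h : Disjoint S S') (T : Finset ℕ) :
    inv (S ∪ S') T = inv S T + inv S' T := by
  simp only [inv_eq_sum, Finset.sum_union h]

theorem inv_union_right (S : Finset ℕ) {T T' : Finset ℕ} (h : Disjoint T T') :
    inv S (T ∪ T') = inv S T + inv S T' := by
  simp only [inv_eq_sum, Finset.sum_union h, Finset.sum_add_distrib]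

theorem inv_add_inv {S T : Finset ℕ} (h : Disjoint S T) : inv S T + inv T S = S.card * T.card := by
  have h1 : ∀ p ∈ S, ∀ q ∈ T, (if q < p then 1 else 0) + (if p < q then 1 else 0) = 1 := by
    intro p hp q hq
    have : p ≠ q := fun e => Finset.disjoint_left.mp h hp (e ▸ hq)
    split_ifs <;> omega
  rw [inv_eq_sum, inv_eq_sum T, Finset.sum_comm (s := T)]
  simp only [← Finset.sum_add_distrib]
  rw [Finset.sum_congr rfl fun p hp => Finset.sum_congr rfl (h1 p hp)]
  simp

theorem inv_empty_left (T : Finset ℕ) : inv ∅ T = 0 := by simp [inv]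

theorem inv_empty_right (S : Finset ℕ) : inv S ∅ = 0 := by simp [inv]

/-- The number of letters of a monomial. -/
def letters (a : Finset ℕ × Finset ℕ) : ℕ := a.1.card + a.2.card

theorem letters_sup {a b : Finset ℕ × Finset ℕ} (h : Disjoint a b) :
    letters (a ⊔ b) = letters a + letters b := by
  obtain ⟨h1, h2⟩ := Prod.disjoint_iff.mp h
  change (a.1 ∪ b.1).card + (a.2 ∪ b.2).card = _
  rw [Finset.card_union_of_disjoint h1, Finset.card_union_of_disjoint h2, letters, letters]
  omega

variable (K : Type*) [Field K]

/-- The sign is a bicharacter on disjoint monomials; associativity and the Leibniz rule for formal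
sums rest on this. -/
theorem serSign_sup_left {a b : Finset ℕ × Finset ℕ} (h : Disjoint a b) (c : Finset ℕ × Finset ℕ) :
    serSign K (a ⊔ b) c = serSign K a c * serSign K b c := by
  obtain ⟨h1, h2⟩ := Prod.disjoint_iff.mp h
  change (-1) ^ (inv (a.1 ∪ b.1) c.1 + inv (a.2 ∪ b.2) c.2 + (a.2 ∪ b.2).card * c.1.card) = _
  rw [inv_union_left h1, inv_union_left h2, Finset.card_union_of_disjoint h2, serSign, serSign,
    ← pow_add]
  congr 1
  ring

theorem serSign_sup_right (a : Finset ℕ × Finset ℕ) {b c : Finset ℕ × Finset ℕ}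
    (h : Disjoint b c) : serSign K a (b ⊔ c) = serSign K a b * serSign K a c := by
  obtain ⟨h1, h2⟩ := Prod.disjoint_iff.mp h
  change (-1) ^ (inv a.1 (b.1 ∪ c.1) + inv a.2 (b.2 ∪ c.2) + a.2.card * (b.1 ∪ c.1).card) = _
  rw [inv_union_right _ h1, inv_union_right _ h2, Finset.card_union_of_disjoint h1, serSign,
    serSign, ← pow_add]
  congr 1
  ring

theorem serSign_mul_self (a b : Finset ℕ × Finset ℕ) : serSign K a b * serSign K a b = 1 := by
  rw [serSign, ← mul_pow, neg_one_mul, neg_neg, one_pow]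

theorem serSign_ne_zero (a b : Finset ℕ × Finset ℕ) : serSign K a b ≠ 0 :=
  pow_ne_zero _ (by simp)

theorem serSign_mul_swap {a b : Finset ℕ × Finset ℕ} (h : Disjoint a b) :
    serSign K a b * serSign K b a = (-1) ^ (letters a * letters b) := by
  obtain ⟨h1, h2⟩ := Prod.disjoint_iff.mp h
  have e1 := inv_add_inv h1
  have e2 := inv_add_inv h2
  rw [serSign, serSign, ← pow_add, letters, letters]
  congr 1
  calc _ = (inv a.1 b.1 + inv b.1 a.1) + (inv a.2 b.2 + inv b.2 a.2) + a.2.card * b.1.card +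
        b.2.card * a.1.card := by ring
    _ = _ := by rw [e1, e2]; ring

theorem serSign_bot_left (a : Finset ℕ × Finset ℕ) : serSign K ⊥ a = 1 := by
  change (-1) ^ (inv ∅ a.1 + inv ∅ a.2 + (∅ : Finset ℕ).card * a.1.card) = (1 : K)
  simp [inv_empty_left]

theorem serSign_bot_right (a : Finset ℕ × Finset ℕ) : serSign K a ⊥ = 1 := by
  change (-1) ^ (inv a.1 ∅ + inv a.2 ∅ + a.2.card * (∅ : Finset ℕ).card) = (1 : K)
  simp [inv_empty_right]

end SerSign

/-! ### The ring of formal sums -/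

section SerRing

/-- The divisors of a monomial. -/
def divisors (a : Finset ℕ × Finset ℕ) : Finset (Finset ℕ × Finset ℕ) :=
  a.1.powerset ×ˢ a.2.powerset

theorem mem_divisors {a s : Finset ℕ × Finset ℕ} : s ∈ divisors a ↔ s ≤ a := by
  rw [divisors, Finset.mem_product, Finset.mem_powerset, Finset.mem_powerset]
  exact Prod.le_def.symm

theorem Ser.ext {K : Type*} {f g : Ser K} (h : ∀ a, f a = g a) : f = g := funext h

variable {K : Type*} [Field K]

theorem Ser.zero_apply (a : Finset ℕ × Finset ℕ) : (0 : Ser K) a = 0 := rfl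

theorem Ser.add_apply (f g : Ser K) (a : Finset ℕ × Finset ℕ) : (f + g) a = f a + g a := rfl

theorem Ser.smul_apply (c : K) (f : Ser K) (a : Finset ℕ × Finset ℕ) : (c • f) a = c * f a := rfl

theorem Ser.mul_apply (f g : Ser K) (a : Finset ℕ × Finset ℕ) :
    (f * g) a = ∑ s ∈ divisors a, serSign K s (a \ s) * f s * g (a \ s) := by
  rw [divisors, Finset.sum_product]
  rfl

theorem serMono_apply (a b : Finset ℕ × Finset ℕ) : serMono K a b = if b = a then 1 else 0 := rfl

theorem serMono_mul_apply (s : Finset ℕ × Finset ℕ) (f : Ser K) (a : Finset ℕ × Finset ℕ) :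
    (serMono K s * f) a = if s ≤ a then serSign K s (a \ s) * f (a \ s) else 0 := by
  rw [Ser.mul_apply]
  by_cases h : s ≤ a
  · rw [if_pos h, Finset.sum_eq_single s]
    · rw [serMono_apply, if_pos rfl, mul_one]
    · intro t _ ht
      rw [serMono_apply, if_neg ht, mul_zero, zero_mul]
    · exact fun h' => absurd (mem_divisors.mpr h) h'
  · rw [if_neg h]
    refine Finset.sum_eq_zero fun t ht => ?_
    have : t ≠ s := fun e => h (e ▸ mem_divisors.mp ht)
    rw [serMono_apply, if_neg this, mul_zero, zero_mul]

theorem Ser.one_mul' (f : Ser K) : 1 * f = f := Ser.ext fun a => by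
  change (serMono K ⊥ * f) a = f a
  rw [serMono_mul_apply, if_pos bot_le, serSign_bot_left, one_mul, sdiff_bot]

theorem Ser.mul_one' (f : Ser K) : f * 1 = f := Ser.ext fun a => by
  change (f * serMono K ⊥) a = f a
  rw [Ser.mul_apply, Finset.sum_eq_single a]
  · rw [sdiff_self, serSign_bot_right, serMono_apply, if_pos rfl, mul_one, one_mul]
  · intro t ht hne
    rw [serMono_apply, if_neg, mul_zero]
    exact fun h => hne (le_antisymm (mem_divisors.mp ht) (sdiff_eq_bot_iff.mp h))
  · exact fun h => absurd (mem_divisors.mpr le_rfl) h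

/-- Both sides sum over the ordered decompositions of a monomial into three parts. A chain $t\le
s\le a$ on the left corresponds to the pair $(t,s\setminus t)$ on the right. -/
theorem Ser.mul_assoc' (f g h : Ser K) : f * g * h = f * (g * h) := Ser.ext fun a => by
  simp only [Ser.mul_apply, Finset.mul_sum, Finset.sum_mul]
  rw [Finset.sum_sigma', Finset.sum_sigma']
  refine Finset.sum_bij' (fun p _ => ⟨p.2, p.1 \ p.2⟩) (fun p _ => ⟨p.1 ⊔ p.2, p.1⟩) ?_ ?_ ?_ ?_ ?_
  · rintro ⟨s, t⟩ hp
    simp only [Finset.mem_sigma, mem_divisors] at hp ⊢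
    exact ⟨hp.2.trans hp.1, sdiff_le_sdiff_right hp.1⟩
  · rintro ⟨p, q⟩ hp
    simp only [Finset.mem_sigma, mem_divisors] at hp ⊢
    exact ⟨sup_le hp.1 (hp.2.trans sdiff_le), le_sup_left⟩
  · rintro ⟨s, t⟩ hp
    simp only [Finset.mem_sigma, mem_divisors] at hp
    simp only [sup_sdiff_cancel_right hp.2]
  · rintro ⟨p, q⟩ hp
    simp only [Finset.mem_sigma, mem_divisors] at hp
    have : Disjoint p q := (disjoint_sdiff_self_right).mono_right hp.2
    simp only [this.sup_sdiff_cancel_left]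
  · rintro ⟨s, t⟩ hp
    simp only [Finset.mem_sigma, mem_divisors] at hp
    have e1 : (a \ t) \ (s \ t) = a \ s := by
      rw [sdiff_sdiff_left, sup_sdiff_cancel_right hp.2]
    have e2 : a \ t = (s \ t) ⊔ (a \ s) := by
      rw [← e1, sup_sdiff_cancel_right (sdiff_le_sdiff_right hp.1)]
    have d1 : Disjoint (s \ t) (a \ s) := disjoint_sdiff_self_right.mono_left sdiff_le
    have e3 : serSign K s (a \ s) = serSign K t (a \ s) * serSign K (s \ t) (a \ s) := by
      rw [← serSign_sup_left K disjoint_sdiff_self_right, sup_sdiff_cancel_right hp.2]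
    simp only [e1]
    rw [e3, e2, serSign_sup_right K t d1]
    ring

instance : Ring (Ser K) :=
  { (inferInstance : AddCommGroup (Ser K)), (inferInstance : Mul (Ser K)),
    (inferInstance : One (Ser K)) with
    left_distrib := fun f g h => map_add (serMul K f) g h
    right_distrib := fun f g h => LinearMap.map_add₂ (serMul K) f g h
    zero_mul := fun f => LinearMap.map_zero₂ (serMul K) f
    mul_zero := fun f => map_zero (serMul K f)
    mul_assoc := Ser.mul_assoc'
    one_mul := Ser.one_mul'
    mul_one := Ser.mul_one' }

instance : Algebra K (Ser K) :=
  Algebra.ofModule (fun c f g => LinearMap.map_smul₂ (serMul K) c f g)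
    fun c f g => map_smul (serMul K f) c g

theorem one_mem_serPar : (1 : Ser K) ∈ serPar K 0 := by
  intro a h
  have : a = (∅, ∅) := by
    by_contra hne
    exact h (if_neg hne)
  rw [this]
  rfl

theorem mul_mem_serPar {i j : ZMod 2} {f g : Ser K} (hf : f ∈ serPar K i) (hg : g ∈ serPar K j) :
    f * g ∈ serPar K (i + j) := by
  intro a h
  rw [Ser.mul_apply] at h
  obtain ⟨s, hs, h⟩ := Finset.exists_ne_zero_of_sum_ne_zero h
  have h1 := hf s (right_ne_zero_of_mul (left_ne_zero_of_mul h))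
  have h2 := hg (a \ s) (right_ne_zero_of_mul h)
  rw [← h1, ← h2, ← Nat.cast_add]
  congr 1
  have e := letters_sup (disjoint_sdiff_self_right : Disjoint s (a \ s))
  rw [sup_sdiff_cancel_right (mem_divisors.mp hs)] at e
  exact e

theorem Ser.mul_supercomm {i j : ZMod 2} {f g : Ser K} (hf : f ∈ serPar K i) (hg : g ∈ serPar K j) :
    f * g = ssign K i j • (g * f) := Ser.ext fun a => by
  rw [Ser.smul_apply, Ser.mul_apply, Ser.mul_apply, Finset.mul_sum]
  refine Finset.sum_bij' (fun s _ => a \ s) (fun s _ => a \ s) ?_ ?_ ?_ ?_ ?_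
  · exact fun s _ => mem_divisors.mpr sdiff_le
  · exact fun s _ => mem_divisors.mpr sdiff_le
  · exact fun s hs => sdiff_sdiff_eq_self (mem_divisors.mp hs)
  · exact fun s hs => sdiff_sdiff_eq_self (mem_divisors.mp hs)
  · intro s hs
    rw [sdiff_sdiff_eq_self (mem_divisors.mp hs)]
    by_cases h1 : f s = 0
    · simp [h1]
    by_cases h2 : g (a \ s) = 0
    · simp [h2]
    have e1 : (letters s : ZMod 2) = i := hf s h1
    have e2 : (letters (a \ s) : ZMod 2) = j := hg _ h2
    have e3 := serSign_mul_swap K (disjoint_sdiff_self_right : Disjoint s (a \ s))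
    rw [← ssign_natCast, e1, e2] at e3
    rw [← e3]
    linear_combination (-f s * g (a \ s) * serSign K s (a \ s)) * serSign_mul_self K (a \ s) s

end SerRing

/-! ### The partial derivatives -/

section Deriv

variable {K : Type*} [Field K]

/-- The letter `e` is a minimal monomial. -/
structure IsLetter (e : Finset ℕ × Finset ℕ) : Prop where
  le_or_disjoint : ∀ a, e ≤ a ∨ Disjoint e a
  letters_eq : letters e = 1

theorem isLetter_x (i : ℕ) : IsLetter ({i}, ∅) := by
  refine ⟨fun a => ?_, rfl⟩
  by_cases h : i ∈ a.1
  · exact Or.inl ⟨Finset.singleton_subset_iff.mpr h, Finset.empty_subset _⟩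
  · exact Or.inr (Prod.disjoint_iff.mpr
      ⟨Finset.disjoint_singleton_left.mpr h, Finset.disjoint_empty_left _⟩)

theorem isLetter_y (i : ℕ) : IsLetter (∅, {i}) := by
  refine ⟨fun a => ?_, rfl⟩
  by_cases h : i ∈ a.2
  · exact Or.inl ⟨Finset.empty_subset _, Finset.singleton_subset_iff.mpr h⟩
  · exact Or.inr (Prod.disjoint_iff.mpr
      ⟨Finset.disjoint_empty_left _, Finset.disjoint_singleton_left.mpr h⟩)

theorem IsLetter.not_le {e a : Finset ℕ × Finset ℕ} (he : IsLetter e) (h : Disjoint e a) :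
    ¬e ≤ a := fun hle => by
  have h0 : e = ⊥ := disjoint_self.mp (h.mono_right hle)
  have := he.letters_eq
  rw [h0] at this
  exact absurd this (by decide)

/-- The sum over the divisors of `e a` for a letter `e` that does not occur in `a`. -/
theorem IsLetter.sum_divisors {e a : Finset ℕ × Finset ℕ} (he : IsLetter e) (h : Disjoint e a)
    (F : Finset ℕ × Finset ℕ → K) :
    ∑ s ∈ divisors (e ⊔ a), F s = ∑ s ∈ divisors a, F (e ⊔ s) + ∑ s ∈ divisors a, F s := by
  classical
  rw [← Finset.sum_filter_add_sum_filter_not _ (e ≤ ·)]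
  congr 1
  · refine Finset.sum_bij' (fun s _ => s \ e) (fun s _ => e ⊔ s) ?_ ?_ ?_ ?_ ?_
    · intro s hs
      rw [Finset.mem_filter, mem_divisors] at hs
      exact mem_divisors.mpr (sdiff_le_iff.mpr hs.1)
    · intro s hs
      rw [Finset.mem_filter, mem_divisors]
      exact ⟨sup_le_sup_left (mem_divisors.mp hs) _, le_sup_left⟩
    · intro s hs
      exact sup_sdiff_cancel_right (Finset.mem_filter.mp hs).2
    · intro s hs
      exact (h.mono_right (mem_divisors.mp hs)).sup_sdiff_cancel_left
    · intro s hs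
      rw [sup_sdiff_cancel_right (Finset.mem_filter.mp hs).2]
  · refine Finset.sum_congr ?_ fun _ _ => rfl
    ext s
    rw [Finset.mem_filter, mem_divisors, mem_divisors]
    constructor
    · rintro ⟨h1, h2⟩
      exact ((he.le_or_disjoint s).resolve_left h2).symm.left_le_of_le_sup_left h1
    · intro h1
      exact ⟨h1.trans le_sup_right, he.not_le (h.mono_right h1)⟩

/-- `D` is the partial superderivative with respect to the letter `e`. -/
def IsPartial (e : Finset ℕ × Finset ℕ) (D : Ser K →ₗ[K] Ser K) : Prop :=
  ∀ f a, (e ≤ a → D f a = 0) ∧ (Disjoint e a → D f a = serSign K e a * f (e ⊔ a))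

theorem isPartial_dx (i : ℕ) : IsPartial ({i}, ∅) (dx K i) := by
  refine fun f a => ⟨fun h => if_pos (Finset.singleton_subset_iff.mp h.1), fun h => ?_⟩
  obtain ⟨h1, -⟩ := Prod.disjoint_iff.mp h
  refine (if_neg (Finset.disjoint_singleton_left.mp h1)).trans ?_
  have e1 : (({i}, ∅) : Finset ℕ × Finset ℕ) ⊔ a = (insert i a.1, a.2) :=
    Prod.ext (Finset.insert_eq i a.1).symm (Finset.empty_union _)
  rw [e1, serSign, inv_empty_left, Finset.card_empty, zero_mul, inv_eq_sum, Finset.sum_singleton,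
    Finset.card_filter]
  rfl

theorem isPartial_dy (i : ℕ) : IsPartial (∅, {i}) (dy K i) := by
  refine fun f a => ⟨fun h => if_pos (Finset.singleton_subset_iff.mp h.2), fun h => ?_⟩
  obtain ⟨-, h1⟩ := Prod.disjoint_iff.mp h
  refine (if_neg (Finset.disjoint_singleton_left.mp h1)).trans ?_
  have e1 : ((∅, {i}) : Finset ℕ × Finset ℕ) ⊔ a = (a.1, insert i a.2) :=
    Prod.ext (Finset.empty_union _) (Finset.insert_eq i a.2).symm
  rw [e1, serSign, inv_empty_left, Finset.card_singleton, one_mul, inv_eq_sum,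
    Finset.sum_singleton, Finset.card_filter, zero_add, add_comm a.1.card]

theorem IsPartial.mem_serPar {e : Finset ℕ × Finset ℕ} {D : Ser K →ₗ[K] Ser K}
    (hD : IsPartial e D) (he : IsLetter e) {i : ZMod 2} {f : Ser K} (hf : f ∈ serPar K i) :
    D f ∈ serPar K (i + 1) := by
  intro a h
  rcases he.le_or_disjoint a with hle | hd
  · exact absurd ((hD f a).1 hle) h
  · rw [(hD f a).2 hd] at h
    have h1 : (letters (e ⊔ a) : ZMod 2) = i := hf _ (right_ne_zero_of_mul h)
    rw [letters_sup hd, he.letters_eq, Nat.cast_add, Nat.cast_one] at h1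
    change (letters a : ZMod 2) = i + 1
    rw [← h1, add_comm (1 : ZMod 2), add_assoc, CharTwo.add_self_eq_zero, add_zero]

theorem neg_one_pow_letters {i : ZMod 2} {f : Ser K} (hf : f ∈ serPar K i)
    (s : Finset ℕ × Finset ℕ) : (-1) ^ letters s * f s = ssign K 1 i * f s := by
  by_cases h : f s = 0
  · rw [h, mul_zero, mul_zero]
  · rw [← (hf s h : (letters s : ZMod 2) = i), ← Nat.cast_one (R := ZMod 2), ssign_natCast, one_mul]
    rfl

/-- At monomials containing the letter the left side vanishes and the terms on the right cancel in
pairs. At the other monomials the sum is split according to the factor that receives the letter. -/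
theorem IsPartial.map_mul {e : Finset ℕ × Finset ℕ} {D : Ser K →ₗ[K] Ser K}
    (hD : IsPartial e D) (he : IsLetter e) {i : ZMod 2} {f : Ser K} (hf : f ∈ serPar K i)
    (g : Ser K) : D (f * g) = D f * g + ssign K 1 i • (f * D g) := Ser.ext fun a => by
  rw [Ser.add_apply, Ser.smul_apply]
  rcases he.le_or_disjoint a with hle | hd
  · obtain ⟨b, hb, rfl⟩ : ∃ b, Disjoint e b ∧ a = e ⊔ b :=
      ⟨a \ e, disjoint_sdiff_self_right, (sup_sdiff_cancel_right hle).symm⟩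
    rw [(hD _ _).1 hle, Ser.mul_apply, Ser.mul_apply, he.sum_divisors hb, he.sum_divisors hb,
      mul_add, Finset.mul_sum, Finset.mul_sum, ← Finset.sum_add_distrib, ← Finset.sum_add_distrib,
      ← Finset.sum_add_distrib]
    refine (Finset.sum_eq_zero fun s hs => ?_).symm
    have hs' := mem_divisors.mp hs
    have hes := hb.mono_right hs'
    have hebs : Disjoint e (b \ s) := hb.mono_right sdiff_le
    have e1 : (e ⊔ b) \ s = e ⊔ b \ s := by rw [sup_sdiff, hes.sdiff_eq_left]
    have e2 : (e ⊔ b) \ (e ⊔ s) = b \ s := by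
      rw [← sdiff_sdiff_left, hb.sup_sdiff_cancel_left]
    rw [e1, e2, (hD f _).1 le_sup_left, (hD g _).1 le_sup_left, (hD f s).2 hes, (hD g _).2 hebs, serSign_sup_left K hes,
      serSign_sup_right K _ hebs]
    have e3 := serSign_mul_swap K hes
    have e4 := neg_one_pow_letters hf (e ⊔ s)
    have e5 := serSign_mul_self K e (b \ s)
    rw [letters_sup hes, he.letters_eq, pow_add, pow_one] at e4
    rw [he.letters_eq, one_mul] at e3
    linear_combination (-serSign K s (b \ s) * g (e ⊔ b \ s)) * e4 +
      (ssign K 1 i * serSign K s (b \ s) * f (e ⊔ s) * g (e ⊔ b \ s)) * e5 +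
      (serSign K s (b \ s) * f (e ⊔ s) * g (e ⊔ b \ s)) * e3
  · rw [(hD _ _).2 hd, Ser.mul_apply, Ser.mul_apply, Ser.mul_apply, he.sum_divisors hd, mul_add,
      Finset.mul_sum, Finset.mul_sum, Finset.mul_sum]
    congr 1 <;> refine Finset.sum_congr rfl fun s hs => ?_
    all_goals
      have hs' := mem_divisors.mp hs
      have hes := hd.mono_right hs'
      have heas : Disjoint e (a \ s) := hd.mono_right sdiff_le
      have e1 : (e ⊔ a) \ s = e ⊔ a \ s := by rw [sup_sdiff, hes.sdiff_eq_left]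
      have e2 : (e ⊔ a) \ (e ⊔ s) = a \ s := by
        rw [← sdiff_sdiff_left, hd.sup_sdiff_cancel_left]
      have e3 : serSign K e a = serSign K e s * serSign K e (a \ s) := by
        rw [← serSign_sup_right K e disjoint_sdiff_self_right, sup_sdiff_cancel_right hs']
      have e5 := serSign_mul_self K e (a \ s)
    · rw [e2, e3, (hD f s).2 hes, serSign_sup_left K hes]
      linear_combination (serSign K e s * serSign K s (a \ s) * f (e ⊔ s) * g (a \ s)) * e5
    · rw [e1, e3, (hD g _).2 heas, serSign_sup_right K _ heas]
      have e6 := serSign_mul_swap K hes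
      have e4 := neg_one_pow_letters hf s
      rw [he.letters_eq, one_mul] at e6
      linear_combination
        (serSign K e (a \ s) * serSign K s (a \ s) * f s * g (e ⊔ a \ s)) * e6 +
        (serSign K e (a \ s) * serSign K s (a \ s) * g (e ⊔ a \ s)) * e4

end Deriv

/-! ### The truncated brackets of formal sums -/

section SerBr

variable {K : Type*} [Field K]

theorem parSign_eq {i : ZMod 2} {f : Ser K} (hf : f ∈ serPar K i) :
    parSign K f = -(ssign K 1 i • f) := Ser.ext fun a => by
  change (-1) ^ (letters a + 1) * f a = -(ssign K 1 i * f a)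
  rw [pow_succ, mul_neg_one, neg_mul, neg_one_pow_letters hf]

theorem brTerm_eq {i : ZMod 2} {f : Ser K} (hf : f ∈ serPar K i) (n : ℕ) (g : Ser K) :
    brTerm K n f g = -(ssign K 1 i • (dx K n f * dy K n g + dy K n f * dx K n g)) := by
  change dx K n (parSign K f) * dy K n g + dy K n (parSign K f) * dx K n g = _
  rw [parSign_eq hf]
  simp only [map_neg, map_smul, neg_mul, smul_mul_assoc, smul_add, neg_add]

theorem superBr_brTerm (n : ℕ) : SuperBr (serPar K) (fun _ _ => brTerm K n) where
  one_mem := one_mem_serPar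
  mul_mem _ _ _ _ hf hg := mul_mem_serPar hf hg
  anti i j f g hf hg := by
    rw [brTerm_eq hf, brTerm_eq hg,
      Ser.mul_supercomm ((isPartial_dx n).mem_serPar (isLetter_x n) hg)
        ((isPartial_dy n).mem_serPar (isLetter_y n) hf),
      Ser.mul_supercomm ((isPartial_dy n).mem_serPar (isLetter_y n) hg)
        ((isPartial_dx n).mem_serPar (isLetter_x n) hf)]
    simp only [ssign_add_left, ssign_add_right]
    rcases zmod_two_cases i with rfl | rfl <;> rcases zmod_two_cases j with rfl | rfl <;>
      simp only [ssign_zero_left, ssign_zero_right, ssign_one_one] <;> module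
  leib i j k f g h hf hg hh := by
    rw [brTerm_eq hf, brTerm_eq hg, brTerm_eq (mul_mem_serPar hf hg),
      (isPartial_dx n).map_mul (isLetter_x n) hf, (isPartial_dy n).map_mul (isLetter_y n) hf]
    simp only [mul_add, add_mul, neg_mul, mul_neg, smul_mul_assoc, mul_smul_comm, mul_assoc,
      smul_add, smul_neg, smul_smul]
    rw [Ser.mul_supercomm ((isPartial_dx n).mem_serPar (isLetter_x n) hh) hg,
      Ser.mul_supercomm ((isPartial_dy n).mem_serPar (isLetter_y n) hh) hg]
    simp only [mul_smul_comm, smul_smul, ssign_add_left, ssign_add_right]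
    rcases zmod_two_cases i with rfl | rfl <;> rcases zmod_two_cases j with rfl | rfl <;>
      rcases zmod_two_cases k with rfl | rfl <;>
      simp only [ssign_zero_left, ssign_zero_right, ssign_one_one] <;> module

/-- The sum of the first `N` terms of the Poisson bracket. -/
def brN (K : Type*) [Field K] (N : ℕ) : Ser K →ₗ[K] Ser K →ₗ[K] Ser K :=
  ∑ i ∈ Finset.range N, brTerm K i

theorem brN_apply (N : ℕ) (f g : Ser K) :
    brN K N f g = ∑ i ∈ Finset.range N, brTerm K i f g := by
  simp only [brN, LinearMap.sum_apply]

theorem superBr_brN (N : ℕ) : SuperBr (serPar K) (fun _ _ => brN K N) where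
  one_mem := one_mem_serPar
  mul_mem _ _ _ _ hf hg := mul_mem_serPar hf hg
  anti i j f g hf hg := by
    rw [brN_apply, brN_apply, Finset.smul_sum, ← Finset.sum_neg_distrib]
    exact Finset.sum_congr rfl fun n _ => (superBr_brTerm n).anti i j f g hf hg
  leib i j k f g h hf hg hh := by
    rw [brN_apply, brN_apply, brN_apply, Finset.mul_sum, Finset.sum_mul, Finset.smul_sum,
      ← Finset.sum_add_distrib]
    exact Finset.sum_congr rfl fun n _ => (superBr_brTerm n).leib i j k f g h hf hg hh

/-! ### The pivot elements as formal sums -/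

theorem serMono_mem_serPar (a : Finset ℕ × Finset ℕ) : serMono K a ∈ serPar K (letters a) := by
  intro b h
  have : b = a := by
    by_contra hne
    exact h (if_neg hne)
  rw [this]
  rfl

theorem serMono_mul {s t : Finset ℕ × Finset ℕ} (h : Disjoint s t) :
    serMono K s * serMono K t = serSign K s t • serMono K (s ⊔ t) := Ser.ext fun a => by
  rw [serMono_mul_apply, Ser.smul_apply, serMono_apply, serMono_apply]
  by_cases ha : a = s ⊔ t
  · subst ha
    rw [if_pos le_sup_left, h.sup_sdiff_cancel_left, if_pos rfl, if_pos rfl]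
  · rw [if_neg ha, mul_zero]
    split_ifs with h1 h2
    · exact absurd (by rw [← h2, sup_sdiff_cancel_right h1]) ha
    · rw [mul_zero]
    · rfl

theorem eq_bot_of_letters {a : Finset ℕ × Finset ℕ} (h : letters a = 0) : a = ⊥ := by
  rw [letters, Nat.add_eq_zero_iff, Finset.card_eq_zero, Finset.card_eq_zero] at h
  exact Prod.ext h.1 h.2

theorem IsPartial.serMono {e e' : Finset ℕ × Finset ℕ} {D : Ser K →ₗ[K] Ser K}
    (hD : IsPartial e D) (he : IsLetter e) (he' : IsLetter e') :
    D (serMono K e') = if e = e' then 1 else 0 := Ser.ext fun a => by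
  have hone : ∀ a, (1 : Ser K) a = if a = ⊥ then 1 else 0 := fun _ => rfl
  rcases he.le_or_disjoint a with hle | hd
  · rw [(hD _ _).1 hle]
    split_ifs with h
    · rw [hone, if_neg]
      rintro rfl
      exact he.not_le disjoint_bot_right hle
    · rfl
  · rw [(hD _ _).2 hd, serMono_apply]
    by_cases ha : a = ⊥
    · subst ha
      rw [serSign_bot_right, sup_bot_eq, one_mul]
      split_ifs <;> simp [hone, Ser.zero_apply]
    · rw [if_neg, mul_zero]
      · split_ifs
        · rw [hone, if_neg ha]
        · rfl
      · intro h
        have h1 := letters_sup hd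
        rw [h, he.letters_eq, he'.letters_eq] at h1
        exact ha (eq_bot_of_letters (by omega))

/-- The letter `y_i`. -/
def serY (K : Type*) [Field K] (i : ℕ) : Ser K := serMono K (∅, {i})

theorem dx_serX (i j : ℕ) : dx K i (serX K j) = if i = j then 1 else 0 := by
  rw [serX, (isPartial_dx i).serMono (isLetter_x i) (isLetter_x j)]
  simp

theorem dx_serY (i j : ℕ) : dx K i (serY K j) = 0 := by
  rw [serY, (isPartial_dx i).serMono (isLetter_x i) (isLetter_y j)]
  simp

theorem dy_serX (i j : ℕ) : dy K i (serX K j) = 0 := by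
  rw [serX, (isPartial_dy i).serMono (isLetter_y i) (isLetter_x j)]
  simp

theorem dy_serY (i j : ℕ) : dy K i (serY K j) = if i = j then 1 else 0 := by
  rw [serY, (isPartial_dy i).serMono (isLetter_y i) (isLetter_y j)]
  simp

theorem serV_ne_zero {n : ℕ} {a : Finset ℕ × Finset ℕ} (h : serV K n a ≠ 0) :
    ∃ k, a = (pivotTail n k, {n + 3 * k}) := by
  unfold serV at h
  split_ifs at h with h0
  · exact h0
  · exact absurd rfl h

theorem serV_apply_tail (n k : ℕ) : serV K n (pivotTail n k, {n + 3 * k}) = 1 :=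
  if_pos ⟨k, rfl⟩

theorem dx_serV {j n : ℕ} (h : j < n) : dx K j (serV K n) = 0 := Ser.ext fun a => by
  by_contra hne
  obtain ⟨k, e⟩ := serV_ne_zero (dx_ne_zero K hne)
  have h1 : j ∈ pivotTail n k :=
    (Prod.ext_iff.mp e).1.subset (Finset.mem_insert_self j a.1)
  have := le_of_mem_pivotTail h1
  omega

theorem dy_serV {j n : ℕ} (h : j < n) : dy K j (serV K n) = 0 := Ser.ext fun a => by
  by_contra hne
  obtain ⟨k, e⟩ := serV_ne_zero (dy_ne_zero K hne)
  have h1 : j ∈ ({n + 3 * k} : Finset ℕ) :=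
    (Prod.ext_iff.mp e).2.subset (Finset.mem_insert_self j a.2)
  have := Finset.mem_singleton.mp h1
  omega

theorem serX_mem_serPar (i : ℕ) : serX K i ∈ serPar K 1 := by
  have := serMono_mem_serPar (K := K) ({i}, ∅)
  rwa [(isLetter_x i).letters_eq, Nat.cast_one] at this

theorem serY_mem_serPar (i : ℕ) : serY K i ∈ serPar K 1 := by
  have := serMono_mem_serPar (K := K) (∅, {i})
  rwa [(isLetter_y i).letters_eq, Nat.cast_one] at this

theorem serV_mem_serPar (n : ℕ) : serV K n ∈ serPar K 1 := by
  intro a h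
  obtain ⟨k, rfl⟩ := serV_ne_zero h
  rw [Nat.cast_add, card_pivotTail, Finset.card_singleton, zero_add, Nat.cast_one]

theorem Ser.anticomm {f g : Ser K} (hf : f ∈ serPar K 1) (hg : g ∈ serPar K 1) :
    f * g = -(g * f) := by
  rw [Ser.mul_supercomm hf hg, ssign_one_one, neg_one_smul]

theorem serX_sq (i : ℕ) : serX K i * serX K i = 0 := Ser.ext fun a => by
  rw [serX, serMono_mul_apply]
  split_ifs with h
  · rw [serMono_apply, if_neg, mul_zero]
    · rfl
    · intro e
      exact (isLetter_x i).not_le disjoint_sdiff_self_right e.ge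
  · rfl

theorem serV_eq (n : ℕ) : serV K n = serY K n + serX K n * serX K (n + 1) * serV K (n + 3) := by
  have hxx : serX K n * serX K (n + 1) = serMono K ({n, n + 1}, ∅) := by
    rw [serX, serX, serMono_mul (Prod.disjoint_iff.mpr ⟨by simp, by simp⟩)]
    have h1 : inv {n} {n + 1} = 0 := by simp [inv_eq_sum]
    rw [serSign, h1, inv_empty_left, Finset.card_empty, zero_mul, add_zero, pow_zero,
      one_smul]
    rfl
  let m : Finset ℕ × Finset ℕ := ({n, n + 1}, ∅)
  have hcons : ∀ k, ((pivotTail n (k + 1), {n + 3 * (k + 1)}) : Finset ℕ × Finset ℕ) =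
      m ⊔ (pivotTail (n + 3) k, {n + 3 + 3 * k}) := fun k => by
    rw [pivotTail_succ, show n + 3 * (k + 1) = n + 3 + 3 * k by ring]
    refine Prod.ext ?_ (Finset.empty_union _).symm
    ext i
    simp [m]
  have hdisj : ∀ k, Disjoint m (pivotTail (n + 3) k, {n + 3 + 3 * k}) := fun k => by
    refine Prod.disjoint_iff.mpr ⟨Finset.disjoint_left.mpr fun i hi hi' => ?_,
      Finset.disjoint_empty_left _⟩
    have := le_of_mem_pivotTail hi'
    simp only [m, Finset.mem_insert, Finset.mem_singleton] at hi
    omega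
  have hsign : ∀ k, serSign K m (pivotTail (n + 3) k, {n + 3 + 3 * k}) = 1 := fun k => by
    have h1 : inv {n, n + 1} (pivotTail (n + 3) k) = 0 := by
      rw [inv_eq_sum]
      refine Finset.sum_eq_zero fun p hp => Finset.sum_eq_zero fun q hq => ?_
      have := le_of_mem_pivotTail hq
      simp only [Finset.mem_insert, Finset.mem_singleton] at hp
      rw [if_neg (by omega)]
    simp only [serSign, m, h1, inv_empty_left, Finset.card_empty, zero_mul, add_zero, pow_zero]
  refine Ser.ext fun a => ?_
  rw [hxx, Ser.add_apply, serMono_mul_apply, serY, serMono_apply]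
  change _ = _ + if m ≤ a then serSign K m (a \ m) * serV K (n + 3) (a \ m) else 0
  by_cases h : ∃ k, a = (pivotTail n k, {n + 3 * k})
  · obtain ⟨k, rfl⟩ := h
    rw [serV_apply_tail]
    cases k with
    | zero =>
      rw [if_pos (by simp [pivotTail_zero]), if_neg, add_zero]
      intro hle
      exact absurd (hle.1 (Finset.mem_insert_self n _)) (by simp [pivotTail_zero])
    | succ k =>
      rw [if_neg, hcons, if_pos le_sup_left, (hdisj k).sup_sdiff_cancel_left, hsign,
        serV_apply_tail, one_mul, zero_add]
      intro e
      have h1 := (Prod.ext_iff.mp e).1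
      rw [pivotTail_succ] at h1
      exact Finset.insert_ne_empty _ _ h1
  · have h1 : serV K n a = 0 := if_neg h
    rw [h1, if_neg fun e => h ⟨0, by simpa [pivotTail_zero] using e⟩, zero_add]
    symm
    split_ifs with hle
    · by_contra hne
      obtain ⟨k, e⟩ := serV_ne_zero (right_ne_zero_of_mul hne)
      exact h ⟨k + 1, by rw [hcons, ← e, sup_sdiff_cancel_right hle]⟩
    · rfl

theorem pivotSys_ser (N : ℕ) :
    PivotSys N (serX K) (serV K) (serY K) (serPar K) (fun _ _ => brN K N) where
  toSuperBr := superBr_brN N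
  x_mem := serX_mem_serPar
  v_mem := serV_mem_serPar
  d_mem := serY_mem_serPar
  x_sq := serX_sq
  x_anti i j := Ser.anticomm (serX_mem_serPar i) (serX_mem_serPar j)
  v_x n j _ := Ser.anticomm (serV_mem_serPar n) (serX_mem_serPar j)
  v_eq := serV_eq
  br_x_x i j := by
    rw [brN_apply]
    refine Finset.sum_eq_zero fun n _ => ?_
    rw [brTerm_eq (serX_mem_serPar i), dy_serX, dy_serX]
    simp
  br_d_x n j hj := by
    rw [brN_apply, Finset.sum_eq_single j]
    · rw [brTerm_eq (serY_mem_serPar n), dx_serX, dx_serY, dy_serY, if_pos rfl, ssign_one_one,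
        neg_one_smul, neg_neg, zero_mul, zero_add, mul_one]
      simp only [eq_comm]
    · intro i _ hij
      rw [brTerm_eq (serY_mem_serPar n), dx_serX, dx_serY, if_neg hij]
      simp
    · exact fun h => absurd (Finset.mem_range.mpr hj) h
  br_v_x_lt n j h := by
    rw [brN_apply]
    refine Finset.sum_eq_zero fun i _ => ?_
    rw [brTerm_eq (serV_mem_serPar n), dx_serX, dy_serX]
    by_cases hij : i = j
    · rw [hij, dy_serV h]
      simp
    · rw [if_neg hij]
      simp
  br_d_v n k h := by
    rw [brN_apply]
    refine Finset.sum_eq_zero fun i _ => ?_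
    rw [brTerm_eq (serY_mem_serPar n), dx_serY, dy_serY]
    by_cases hij : i = n
    · rw [hij, dx_serV h]
      simp
    · rw [if_neg hij]
      simp
  br_d_d n := by
    rw [brN_apply]
    refine Finset.sum_eq_zero fun i _ => ?_
    rw [brTerm_eq (serY_mem_serPar n), dx_serY]
    simp

/-- The formal sums all of whose terms contain a letter `y_j` with `j ≥ n`. -/
def yIdeal (K : Type*) [Field K] (n : ℕ) : Submodule K (Ser K) where
  carrier := {f | ∀ a, f a ≠ 0 → ∃ j ∈ a.2, n ≤ j}
  add_mem' {f g} hf hg a h := by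
    by_cases h0 : f a = 0
    · refine hg a fun h1 => h ?_
      rw [Ser.add_apply, h0, h1, add_zero]
    · exact hf a h0
  zero_mem' _ h := absurd rfl h
  smul_mem' c f hf a h := hf a fun h0 => h (by rw [Ser.smul_apply, h0, mul_zero])

theorem ordProd_serX (s : Finset ℕ) : ordProd (serX K) s = serMono K (s, ∅) := by
  induction s using Finset.induction_on_min with
  | empty => rw [ordProd_empty]; rfl
  | insert i s hi ih =>
    have hd : Disjoint (({i}, ∅) : Finset ℕ × Finset ℕ) (s, ∅) :=
      Prod.disjoint_iff.mpr ⟨by simpa using fun h => lt_irrefl _ (hi i h), by simp⟩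
    have h1 : inv {i} s = 0 := by
      rw [inv_eq_sum, Finset.sum_singleton]
      exact Finset.sum_eq_zero fun q hq => if_neg (hi q hq).le.not_gt
    rw [ordProd_insert_min _ hi, ih, serX, serMono_mul hd, serSign, h1, inv_empty_left,
      Finset.card_empty, zero_mul, add_zero, pow_zero,
      one_smul]
    rfl

/-- Suppose a term of $F$ has no $y_j$ with $j\ge n$. Multiplied by the leading term $y_n$ of $V_n$
it gives a term of $FV_n$ without $y_j$ for $j>n$. Nothing cancels it, since all other terms of
$V_n$ contain some $y_{n+3k}$ with $k>0$. -/
theorem mem_yIdeal_of_mul {n : ℕ} {F : Ser K} (h : F * serV K n ∈ yIdeal K (n + 1)) :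
    F ∈ yIdeal K n := by
  intro a ha
  by_contra hne
  push Not at hne
  have hd : Disjoint a (∅, {n}) := by
    refine Prod.disjoint_iff.mpr ⟨Finset.disjoint_empty_right _,
      Finset.disjoint_singleton_right.mpr fun hn => ?_⟩
    have := hne n hn
    omega
  have h1 : (F * serV K n) (a ⊔ (∅, {n})) = serSign K a (∅, {n}) * F a := by
    rw [Ser.mul_apply, Finset.sum_eq_single a]
    · rw [hd.sup_sdiff_cancel_left]
      have : serV K n (∅, {n}) = 1 := serV_apply_tail n 0
      rw [this, mul_one]
    · intro s hs hsa
      by_contra hne'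
      obtain ⟨k, e⟩ := serV_ne_zero (right_ne_zero_of_mul hne')
      have hmem : n + 3 * k ∈ ((a ⊔ (∅, {n})) \ s).2 := by
        rw [e]; exact Finset.mem_singleton_self _
      have hmem' : n + 3 * k ∈ a.2 ∪ {n} := Finset.sdiff_subset hmem
      obtain rfl : k = 0 := by
        rcases Finset.mem_union.mp hmem' with h' | h'
        · have := hne _ h'; omega
        · have := Finset.mem_singleton.mp h'; omega
      refine hsa ?_
      have e' : (a ⊔ (∅, {n})) \ s = (∅, {n}) := e
      have h3 := sdiff_sdiff_eq_self (mem_divisors.mp hs)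
      rw [e', sup_sdiff_right_self, hd.sdiff_eq_left] at h3
      exact h3.symm
    · exact fun h => absurd (mem_divisors.mpr le_sup_left) h
  obtain ⟨j, hj, hnj⟩ := h _ (by rw [h1]; exact mul_ne_zero (serSign_ne_zero K _ _) ha)
  rcases Finset.mem_union.mp hj with h' | h'
  · have := hne _ h'; omega
  · have := Finset.mem_singleton.mp h'; omega

theorem linearIndependent_ser : LinearIndependent K fun w : Finset ℕ × Finset ℕ =>
    ordProd (serX K) w.1 * ordProd (serV K) w.2 := by
  refine linearIndependent_of_chain (yIdeal K) (fun n F h a ha => ?_)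
    (fun n f g hg a ha => ?_) (fun n a ha => ?_) (fun n F h => mem_yIdeal_of_mul h) fun c hc => ?_
  · obtain ⟨j, hj, h⟩ := h a ha
    exact ⟨j, hj, by omega⟩
  · obtain ⟨s, hs, t, ht, -, h⟩ := serMul_ne_zero K ha
    obtain ⟨j, hj, h⟩ := hg _ h
    exact ⟨j, (Finset.mem_sdiff.mp hj).1, h⟩
  · obtain ⟨k, rfl⟩ := serV_ne_zero ha
    exact ⟨_, Finset.mem_singleton_self _, by omega⟩
  · ext s
    by_contra hne
    refine absurd (hc (s, ∅) ?_) (by simp)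
    have hsum : (c.sum fun a r => r • ordProd (serX K) a) (s, ∅) =
        ∑ t ∈ c.support, (c t • ordProd (serX K) t) (s, ∅) := Finset.sum_apply _ _ _
    rw [hsum, Finset.sum_eq_single s]
    · rw [ordProd_serX, Ser.smul_apply, serMono_apply, if_pos rfl, mul_one]
      exact hne
    · intro t _ hts
      rw [ordProd_serX, Ser.smul_apply, serMono_apply, if_neg, mul_zero]
      exact fun e => hts (Prod.ext_iff.mp e).1.symm
    · intro h
      rw [Finsupp.notMem_support_iff.mp h, zero_smul]
      rfl

/-! ### The bracket on the completion -/

/-- On the completion each coefficient of the bracket is computed by a finite truncation, so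
identities of `brN` carry over. -/
theorem serBr_apply {f g : Ser K} (hf : f ∈ hTilde K) (hg : g ∈ hTilde K) {N : ℕ}
    {a : Finset ℕ × Finset ℕ} (hN : a.2.sup id < N) : serBr K f g a = brN K N f g a := by
  have h1 : brN K N f g a = ∑ i ∈ Finset.range N, brTerm K i f g a := by
    rw [brN_apply]; exact Finset.sum_apply _ _ _
  rw [h1]
  refine Finset.sum_subset (Finset.range_subset_range.mpr hN) fun i _ hi => ?_
  exact brTerm_eq_zero K hf hg hi

theorem Ser.mul_apply_congr_right {f g g' : Ser K} {a : Finset ℕ × Finset ℕ}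
    (h : ∀ s ≤ a, g s = g' s) : (f * g) a = (f * g') a := by
  rw [Ser.mul_apply, Ser.mul_apply]
  exact Finset.sum_congr rfl fun s _ => by rw [h _ sdiff_le]

theorem Ser.mul_apply_congr_left {f f' g : Ser K} {a : Finset ℕ × Finset ℕ}
    (h : ∀ s ≤ a, f s = f' s) : (f * g) a = (f' * g) a := by
  rw [Ser.mul_apply, Ser.mul_apply]
  exact Finset.sum_congr rfl fun s hs => by rw [h _ (mem_divisors.mp hs)]

/-- The divisors of a monomial have no larger $y$-letters than the monomial itself, so one
truncation serves all coefficients in an identity. -/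
theorem superBr_serBr :
    SuperBr (fun i => serPar K i ⊓ hTilde K) (fun _ _ => serBr K) where
  one_mem := ⟨one_mem_serPar, one_mem_hTilde K⟩
  mul_mem _ _ _ _ hf hg := ⟨mul_mem_serPar hf.1 hg.1, serMul_mem K hf.2 hg.2⟩
  anti i j f g hf hg := Ser.ext fun a => by
    have h := (superBr_brN (K := K) (a.2.sup id + 1)).anti i j f g hf.1 hg.1
    rw [serBr_apply hf.2 hg.2 (Nat.lt_succ_self _), h]
    change -(ssign K i j * brN K _ g f a) = -(ssign K i j * serBr K g f a)
    rw [serBr_apply hg.2 hf.2 (Nat.lt_succ_self _)]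
  leib i j k f g h hf hg hh := Ser.ext fun a => by
    have e := (superBr_brN (K := K) (a.2.sup id + 1)).leib i j k f g h hf.1 hg.1 hh.1
    have hs : ∀ s ≤ a, s.2.sup id < a.2.sup id + 1 := fun s hs =>
      Nat.lt_succ_of_le (Finset.sup_mono hs.2)
    have h1 : serBr K (f * g) h a = brN K (a.2.sup id + 1) (f * g) h a :=
      serBr_apply (serMul_mem K hf.2 hg.2) hh.2 (Nat.lt_succ_self _)
    rw [h1, e, Ser.add_apply, Ser.add_apply, Ser.smul_apply, Ser.smul_apply]
    congr 1
    · exact (Ser.mul_apply_congr_right fun s h' => serBr_apply hg.2 hh.2 (hs s h')).symm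
    · congr 1
      exact (Ser.mul_apply_congr_left fun s h' => serBr_apply hf.2 hh.2 (hs s h')).symm

end SerBr

/-! ### Products of systems of pivot elements -/

section Product

variable {K A B : Type*} [Field K] [Ring A] [Algebra K A] [Ring B] [Algebra K B]

/-- The componentwise bilinear operation on a product. -/
def prodBr (b₁ : A →ₗ[K] A →ₗ[K] A) (b₂ : B →ₗ[K] B →ₗ[K] B) : A × B →ₗ[K] A × B →ₗ[K] A × B :=
  LinearMap.mk₂ K (fun a b => (b₁ a.1 b.1, b₂ a.2 b.2))
    (fun a a' b => Prod.ext (by simp) (by simp)) (fun c a b => Prod.ext (by simp) (by simp))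
    (fun a b b' => Prod.ext (by simp) (by simp)) (fun c a b => Prod.ext (by simp) (by simp))

variable {par : ZMod 2 → Submodule K A} {br : ZMod 2 → ZMod 2 → A →ₗ[K] A →ₗ[K] A}
  {par' : ZMod 2 → Submodule K B} {br' : ZMod 2 → ZMod 2 → B →ₗ[K] B →ₗ[K] B}

theorem SuperBr.prod (h : SuperBr par br) (h' : SuperBr par' br') :
    SuperBr (fun i => (par i).prod (par' i)) (fun p q => prodBr (br p q) (br' p q)) where
  one_mem := ⟨h.one_mem, h'.one_mem⟩
  mul_mem i j _ _ ha hb := ⟨h.mul_mem i j _ _ ha.1 hb.1, h'.mul_mem i j _ _ ha.2 hb.2⟩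
  anti i j _ _ ha hb := Prod.ext (h.anti i j _ _ ha.1 hb.1) (h'.anti i j _ _ ha.2 hb.2)
  leib i j k _ _ _ ha hb hc :=
    Prod.ext (h.leib i j k _ _ _ ha.1 hb.1 hc.1) (h'.leib i j k _ _ _ ha.2 hb.2 hc.2)

/-- This is what couples operators and symbols: any identity derived from the axioms then holds in
both components with the same coefficients. -/
theorem PivotSys.prod {N : ℕ} {x v d : ℕ → A} {x' v' d' : ℕ → B} (h : PivotSys N x v d par br)
    (h' : PivotSys N x' v' d' par' br') :
    PivotSys N (fun i => (x i, x' i)) (fun i => (v i, v' i)) (fun i => (d i, d' i))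
      (fun i => (par i).prod (par' i)) (fun p q => prodBr (br p q) (br' p q)) where
  toSuperBr := h.toSuperBr.prod h'.toSuperBr
  x_mem i := ⟨h.x_mem i, h'.x_mem i⟩
  v_mem i := ⟨h.v_mem i, h'.v_mem i⟩
  d_mem i := ⟨h.d_mem i, h'.d_mem i⟩
  x_sq i := Prod.ext (h.x_sq i) (h'.x_sq i)
  x_anti i j := Prod.ext (h.x_anti i j) (h'.x_anti i j)
  v_x n j hj := Prod.ext (h.v_x n j hj) (h'.v_x n j hj)
  v_eq n := Prod.ext (h.v_eq n) (h'.v_eq n)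
  br_x_x i j := Prod.ext (h.br_x_x i j) (h'.br_x_x i j)
  br_d_x n j hj := by
    refine Prod.ext ((h.br_d_x n j hj).trans ?_) ((h'.br_d_x n j hj).trans ?_) <;>
      split_ifs <;> rfl
  br_v_x_lt n j hj := Prod.ext (h.br_v_x_lt n j hj) (h'.br_v_x_lt n j hj)
  br_d_v n k hk := Prod.ext (h.br_d_v n k hk) (h'.br_d_v n k hk)
  br_d_d n := Prod.ext (h.br_d_d n) (h'.br_d_d n)

theorem ordProd_prodMk (x : ℕ → A) (x' : ℕ → B) (s : Finset ℕ) :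
    ordProd (fun i => (x i, x' i)) s = (ordProd x s, ordProd x' s) := by
  refine Prod.ext ?_ ?_
  · exact (map_list_prod (MonoidHom.fst A B) _).trans (by rw [List.map_map]; rfl)
  · exact (map_list_prod (MonoidHom.snd A B) _).trans (by rw [List.map_map]; rfl)

theorem stdMon_prodMk (x v : ℕ → A) (x' v' : ℕ → B) (n : ℕ) (a : Finset ℕ) :
    stdMon (fun i => (x i, x' i)) (fun i => (v i, v' i)) n a =
      (stdMon x v n a, stdMon x' v' n a) := by
  rw [stdMon, ordProd_prodMk]
  rfl

end Product

/-! ### The pairs of an operator and a formal sum -/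

section Pairs

variable (K : Type*) [Field K]

/-- The pairs of an operator and a formal sum. -/
abbrev Pairs := Module.End K (Lam K) × Ser K

/-- The pair of the letters `x_i`. -/
def eX (i : ℕ) : Pairs K := (xOp K i, serX K i)

/-- The pair of the pivot elements `v_i`, `V_i`. -/
def eV (i : ℕ) : Pairs K := (pivot K i, serV K i)

theorem eX_eq : eX K = fun i => (xOp K i, serX K i) := rfl

theorem eV_eq : eV K = fun i => (pivot K i, serV K i) := rfl

/-- The pair `x^α v^β`, `x^α V^β`. -/
def eMon (w : Finset ℕ × Finset ℕ) : Pairs K := ordProd (eX K) w.1 * ordProd (eV K) w.2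

theorem eMon_fst (w : Finset ℕ × Finset ℕ) :
    (eMon K w).1 = ordProd (xOp K) w.1 * ordProd (pivot K) w.2 := by
  rw [eMon, eX_eq, eV_eq, ordProd_prodMk, ordProd_prodMk]
  rfl

theorem eMon_snd (w : Finset ℕ × Finset ℕ) :
    (eMon K w).2 = ordProd (serX K) w.1 * ordProd (serV K) w.2 := by
  rw [eMon, eX_eq, eV_eq, ordProd_prodMk, ordProd_prodMk]
  rfl

theorem linearCombination_eMon_fst (c : Finset ℕ × Finset ℕ →₀ K) :
    (Finsupp.linearCombination K (eMon K) c).1 = Finsupp.linearCombination K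
      (fun w : Finset ℕ × Finset ℕ => ordProd (xOp K) w.1 * ordProd (pivot K) w.2) c := by
  have := Finsupp.apply_linearCombination K (LinearMap.fst K (Module.End K (Lam K)) (Ser K))
    (eMon K) c
  rw [LinearMap.fst_apply] at this
  rw [this]
  congr 1
  exact congrArg _ (funext fun w => eMon_fst K w)

theorem linearCombination_eMon_snd (c : Finset ℕ × Finset ℕ →₀ K) :
    (Finsupp.linearCombination K (eMon K) c).2 = Finsupp.linearCombination K
      (fun w : Finset ℕ × Finset ℕ => ordProd (serX K) w.1 * ordProd (serV K) w.2) c := by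
  have := Finsupp.apply_linearCombination K (LinearMap.snd K (Module.End K (Lam K)) (Ser K))
    (eMon K) c
  rw [LinearMap.snd_apply] at this
  rw [this]
  congr 1
  exact congrArg _ (funext fun w => eMon_snd K w)

/-- By independence the operator determines the combination of monomials, hence the formal sum. It
transfers identities from operators to symbols. -/
theorem eq_zero_of_fst {z : Pairs K} (hz : z ∈ Submodule.span K (Set.range (eMon K)))
    (h : z.1 = 0) : z = 0 := by
  obtain ⟨c, rfl⟩ := (Finsupp.mem_span_range_iff_exists_finsupp (R := K)).mp hz
  change (Finsupp.linearCombination K (eMon K) c) = 0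
  change (Finsupp.linearCombination K (eMon K) c).1 = 0 at h
  rw [linearCombination_eMon_fst] at h
  rw [linearIndependent_iff.mp (linearIndependent_end K) c h, map_zero]

/-- The pair of the monomials `x^α v_n`, `x^α V_n`. -/
def wMon (w : ℕ × Finset ℕ) : Pairs K := (aMon K w, pMon K w)

theorem wMon_eq (w : ℕ × Finset ℕ) : wMon K w = stdMon (eX K) (eV K) w.1 w.2 := by
  rw [eX_eq, eV_eq, stdMon_prodMk, wMon, aMon, pMon, monoProd_eq, monoProd_eq, ordProd_empty,
    ordProd_empty, mul_one, mul_one]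
  rfl

theorem aMon_eq (w : ℕ × Finset ℕ) : aMon K w = stdMon (xOp K) (pivot K) w.1 w.2 := by
  rw [aMon, monoProd_eq, ordProd_empty, mul_one]
  rfl

theorem pMon_eq (w : ℕ × Finset ℕ) : pMon K w = stdMon (serX K) (serV K) w.1 w.2 := by
  rw [pMon, monoProd_eq, ordProd_empty, mul_one]
  rfl

theorem wMon_eq_eMon (w : ℕ × Finset ℕ) : wMon K w = eMon K (w.2, {w.1}) := by
  rw [wMon_eq, eMon, ordProd_singleton]
  rfl

/-- The parity of `x^α v_n`. -/
def wPar (w : ℕ × Finset ℕ) : ZMod 2 := w.2.card + 1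

theorem pivotSys_pairs (N : ℕ) : PivotSys N (eX K) (eV K) (fun i => (dOp K i, serY K i))
    (fun i => (endPar K i).prod (serPar K i))
    (fun p q => prodBr (scommB K p q) (brN K N)) :=
  (pivotSys_end K N).prod (pivotSys_ser N)

theorem stdSpan_eq : stdSpan K (eX K) (eV K) =
    Submodule.span K {z | ∃ w : ℕ × Finset ℕ, Standard w.1 w.2 ∧ z = wMon K w} := by
  rw [stdSpan]
  congr 1
  ext z
  constructor
  · rintro ⟨n, a, h, rfl⟩
    exact ⟨(n, a), h, (wMon_eq K (n, a)).symm⟩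
  · rintro ⟨w, h, rfl⟩
    exact ⟨w.1, w.2, h, wMon_eq K w⟩

theorem stdSpan_le : stdSpan K (eX K) (eV K) ≤ Submodule.span K (Set.range (eMon K)) := by
  rw [stdSpan_eq]
  refine Submodule.span_mono ?_
  rintro _ ⟨w, -, rfl⟩
  exact ⟨_, (wMon_eq_eMon K w).symm⟩

variable {K}

theorem pMon_mem_hTilde {w : ℕ × Finset ℕ} (hw : Standard w.1 w.2) : pMon K w ∈ hTilde K := by
  intro s h
  rw [pMon_eq, stdMon, ordProd_serX, serMono_mul_apply] at h
  split_ifs at h with hle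
  · obtain ⟨k, e⟩ := serV_ne_zero (right_ne_zero_of_mul h)
    have hs : s = (w.2, ∅) ⊔ (pivotTail w.1 k, {w.1 + 3 * k}) := by
      rw [← e, sup_sdiff_cancel_right hle]
    rw [hs]
    refine Or.inr ⟨w.1 + 3 * k, Finset.mem_union_right _ (Finset.mem_singleton_self _),
      fun i hi => ?_⟩
    rcases Finset.mem_union.mp hi with hi | hi
    · have := hw.add_two_le i hi; omega
    · have := le_of_mem_pivotTail hi; omega
  · exact absurd rfl h

theorem wMon_mem_prod (w : ℕ × Finset ℕ) :
    wMon K w ∈ (endPar K (wPar w)).prod (serPar K (wPar w)) := by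
  rw [wMon_eq]
  exact (pivotSys_pairs K 0).stdMon_mem w.1 w.2

theorem brN_wMon_mem (h2 : (2 : K) ≠ 0) {w w' : ℕ × Finset ℕ} (hw : Standard w.1 w.2)
    (hw' : Standard w'.1 w'.2) {N : ℕ} (hN : w.1 + 2 < N) (hN' : w'.1 + 2 < N) :
    (scomm K (wPar w) (wPar w') (aMon K w) (aMon K w'), brN K N (pMon K w) (pMon K w')) ∈
      stdSpan K (eX K) (eV K) := by
  have := (pivotSys_pairs K N).br_stdMon_mem h2 hN hN' hw hw'
  rw [← wMon_eq, ← wMon_eq] at this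
  exact this

/-- For every large truncation the pair of supercommutator and truncated bracket is a combination of
pairs of standard monomials. Its operator does not depend on the truncation, so neither does its
formal sum. Any coefficient of the full bracket is reached by truncating late enough. -/
theorem serBr_pMon (h2 : (2 : K) ≠ 0) {w w' : ℕ × Finset ℕ} (hw : Standard w.1 w.2)
    (hw' : Standard w'.1 w'.2) {N : ℕ} (hN : w.1 + 2 < N) (hN' : w'.1 + 2 < N) :
    serBr K (pMon K w) (pMon K w') = brN K N (pMon K w) (pMon K w') := Ser.ext fun a => by
  have e : ∀ M, w.1 + 2 < M → w'.1 + 2 < M →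
      brN K M (pMon K w) (pMon K w') = brN K N (pMon K w) (pMon K w') := fun M hM hM' => by
    have h := Submodule.sub_mem _ (brN_wMon_mem h2 hw hw' hM hM') (brN_wMon_mem h2 hw hw' hN hN')
    have := (Prod.ext_iff.mp (eq_zero_of_fst K (stdSpan_le K h) (sub_self _))).2
    exact sub_eq_zero.mp this
  rw [serBr_apply (pMon_mem_hTilde hw) (pMon_mem_hTilde hw')
    (N := max (a.2.sup id + 1) (max (w.1 + 3) (w'.1 + 3))) (by omega),
    e _ (by omega) (by omega)]

/-- The bracket of pairs, given by the supercommutator and the Poisson bracket. -/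
def eBr (K : Type*) [Field K] (p q : ZMod 2) : Pairs K →ₗ[K] Pairs K →ₗ[K] Pairs K :=
  prodBr (scommB K p q) (serBr K)

/-- The pairs of elements of parity `i`. -/
def ePar (K : Type*) [Field K] (i : ZMod 2) : Submodule K (Pairs K) :=
  (endPar K i).prod (serPar K i ⊓ hTilde K)

theorem superBr_pairs : SuperBr (ePar K) (eBr K) := (superBr_end K).prod superBr_serBr

theorem wMon_mem_ePar {w : ℕ × Finset ℕ} (hw : Standard w.1 w.2) : wMon K w ∈ ePar K (wPar w) :=
  ⟨(wMon_mem_prod w).1, (wMon_mem_prod w).2, pMon_mem_hTilde hw⟩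

theorem eBr_wMon_mem (h2 : (2 : K) ≠ 0) {w w' : ℕ × Finset ℕ} (hw : Standard w.1 w.2)
    (hw' : Standard w'.1 w'.2) :
    eBr K (wPar w) (wPar w') (wMon K w) (wMon K w') ∈ stdSpan K (eX K) (eV K) := by
  have := brN_wMon_mem h2 hw hw' (N := max (w.1 + 3) (w'.1 + 3)) (by omega) (by omega)
  rw [← serBr_pMon h2 hw hw' (by omega) (by omega)] at this
  exact this

theorem aMon_mem_hull (h2 : (2 : K) ≠ 0) {w : ℕ × Finset ℕ} (hw : Standard w.1 w.2) :
    aMon K w ∈ hull K := by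
  rw [aMon_eq]
  refine (pivotSys_end K (w.1 + 3)).stdMon_mem_of_gen h2 (T := Subalgebra.toSubmodule (hull K))
    (fun n k a b _ _ _ _ ha hb => ?_) (fun i hi => ?_) (by omega) hw
  · exact (hull K).sub_mem ((hull K).mul_mem ha hb)
      ((hull K).smul_mem ((hull K).mul_mem hb ha) _)
  · refine Algebra.subset_adjoin ?_
    interval_cases i <;> simp

theorem pMon_mem_poisson (h2 : (2 : K) ≠ 0) {w : ℕ × Finset ℕ} (hw : Standard w.1 w.2) :
    pMon K w ∈ poisson K := by
  obtain ⟨-, h0, h1, h2', hcl⟩ := poisson_closed K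
  rw [pMon_eq]
  refine (pivotSys_ser (w.1 + 3)).stdMon_mem_of_gen h2 (T := poisson K)
    (fun n k a b hn hk ha hb ha' hb' => ?_) (fun i hi => ?_) (by omega) hw
  · have e := serBr_pMon h2 (w := (n, a)) (w' := (k, b)) ha hb hn hk
    rw [pMon_eq, pMon_eq] at e
    rw [← e]
    exact (hcl _ ha' _ hb').2
  · interval_cases i
    · exact h0
    · exact h1
    · exact h2'

end Pairs

/-! ### Products of standard monomials -/

section Lists

variable (K : Type*) [Field K]

/-- The monomials in the list are standard. -/
def AllStd (l : List (ℕ × Finset ℕ)) : Prop := ∀ w ∈ l, Standard w.1 w.2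

/-- The pair of products of the standard monomials in a list. -/
def wProd (l : List (ℕ × Finset ℕ)) : Pairs K := (l.map (wMon K)).prod

theorem wProd_nil : wProd K [] = 1 := rfl

theorem wProd_cons (w : ℕ × Finset ℕ) (l : List (ℕ × Finset ℕ)) :
    wProd K (w :: l) = wMon K w * wProd K l := by
  rw [wProd, List.map_cons, List.prod_cons, wProd]

theorem wProd_append (l l' : List (ℕ × Finset ℕ)) :
    wProd K (l ++ l') = wProd K l * wProd K l' := by
  rw [wProd, List.map_append, List.prod_append, wProd, wProd]

theorem wProd_fst (l : List (ℕ × Finset ℕ)) : (wProd K l).1 = (l.map (aMon K)).prod :=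
  (map_list_prod (MonoidHom.fst (Module.End K (Lam K)) (Ser K)) _).trans
    (by rw [List.map_map]; rfl)

theorem wProd_snd (l : List (ℕ × Finset ℕ)) : (wProd K l).2 = (l.map (pMon K)).prod :=
  (map_list_prod (MonoidHom.snd (Module.End K (Lam K)) (Ser K)) _).trans
    (by rw [List.map_map]; rfl)

/-- The span of the pairs of `m`-fold products of standard monomials. -/
def listSpan (m : ℕ) : Submodule K (Pairs K) :=
  Submodule.span K {z | ∃ l, AllStd l ∧ l.length = m ∧ z = wProd K l}

/-- The pairs of an element of lower filtration degree and zero. -/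
def low (m : ℕ) : Submodule K (Pairs K) := (filtPred (filt K) m).prod ⊥

/-- The pairs of an element of the filtration and its symbol. -/
def symSpan (m : ℕ) : Submodule K (Pairs K) := listSpan K m ⊔ low K m

variable {K}

theorem AllStd.cons {w : ℕ × Finset ℕ} {l : List (ℕ × Finset ℕ)} (hw : Standard w.1 w.2)
    (hl : AllStd l) : AllStd (w :: l) := fun w' h => by
  rcases List.mem_cons.mp h with rfl | h
  · exact hw
  · exact hl w' h

theorem AllStd.of_cons {w : ℕ × Finset ℕ} {l : List (ℕ × Finset ℕ)} (h : AllStd (w :: l)) :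
    Standard w.1 w.2 ∧ AllStd l :=
  ⟨h w List.mem_cons_self, fun w' h' => h w' (List.mem_cons_of_mem _ h')⟩

theorem wProd_mem_listSpan {l : List (ℕ × Finset ℕ)} (hl : AllStd l) :
    wProd K l ∈ listSpan K l.length := Submodule.subset_span ⟨l, hl, rfl, rfl⟩

theorem listSpan_one : stdSpan K (eX K) (eV K) = listSpan K 1 := by
  rw [stdSpan_eq, listSpan]
  congr 1
  ext z
  constructor
  · rintro ⟨w, hw, rfl⟩
    exact ⟨[w], by simpa [AllStd] using hw, rfl, by rw [wProd_cons, wProd_nil, mul_one]⟩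
  · rintro ⟨l, hl, hm, rfl⟩
    obtain ⟨w, rfl⟩ := List.length_eq_one_iff.mp hm
    exact ⟨w, (AllStd.of_cons hl).1, by rw [wProd_cons, wProd_nil, mul_one]⟩

theorem listSpan_mul {m n : ℕ} {a b : Pairs K} (ha : a ∈ listSpan K m) (hb : b ∈ listSpan K n) :
    a * b ∈ listSpan K (m + n) := by
  have h : listSpan K m * listSpan K n ≤ listSpan K (m + n) := by
    rw [listSpan, listSpan, Submodule.span_mul_span]
    refine Submodule.span_mono ?_
    rintro _ ⟨_, ⟨l, hl, rfl, rfl⟩, _, ⟨l', hl', rfl, rfl⟩, rfl⟩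
    refine ⟨l ++ l', fun w hw => ?_, by simp, (wProd_append K l l').symm⟩
    rcases List.mem_append.mp hw with h | h
    · exact hl w h
    · exact hl' w h
  exact h (Submodule.mul_mem_mul ha hb)

theorem fst_mem_filt {m : ℕ} {a : Pairs K} (ha : a ∈ listSpan K m) : a.1 ∈ filt K m := by
  have : listSpan K m ≤ (filt K m).comap (LinearMap.fst K _ _) := by
    refine Submodule.span_le.mpr ?_
    rintro _ ⟨l, hl, rfl, rfl⟩
    exact Submodule.subset_span ⟨l, le_rfl, hl, wProd_fst K l⟩
  exact this ha

theorem filtPred_le (m : ℕ) : filtPred (filt K) m ≤ filt K m := by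
  unfold filtPred
  split_ifs
  · exact bot_le
  · exact filt_mono K (by omega)

theorem mem_low {m : ℕ} {a : Pairs K} : a ∈ low K m ↔ a.1 ∈ filtPred (filt K) m ∧ a.2 = 0 :=
  Iff.rfl

theorem low_mul {m n : ℕ} {a b : Pairs K} (ha : a ∈ low K m) (hb : b.1 ∈ filt K n) :
    a * b ∈ low K (m + n) := by
  refine mem_low.mpr ⟨filtPred_mul_left (filt K)
    (fun _ _ _ _ ha hb => filt_mul K ha hb) (mem_low.mp ha).1 hb, ?_⟩
  rw [Prod.snd_mul, (mem_low.mp ha).2, zero_mul]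

theorem mul_low {m n : ℕ} {a b : Pairs K} (ha : a.1 ∈ filt K m) (hb : b ∈ low K n) :
    a * b ∈ low K (m + n) := by
  refine mem_low.mpr ⟨filtPred_mul_right (filt K)
    (fun _ _ _ _ ha hb => filt_mul K ha hb) ha (mem_low.mp hb).1, ?_⟩
  rw [Prod.snd_mul, (mem_low.mp hb).2, mul_zero]

theorem symSpan_mul {m n : ℕ} {a b : Pairs K} (ha : a ∈ symSpan K m) (hb : b ∈ symSpan K n) :
    a * b ∈ symSpan K (m + n) := by
  obtain ⟨a', ha', a'', ha'', rfl⟩ := Submodule.mem_sup.mp ha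
  obtain ⟨b', hb', b'', hb'', rfl⟩ := Submodule.mem_sup.mp hb
  rw [add_mul, mul_add]
  refine Submodule.add_mem _ (Submodule.add_mem _ ?_ ?_) ?_
  · exact Submodule.mem_sup_left (listSpan_mul ha' hb')
  · exact Submodule.mem_sup_right (mul_low (fst_mem_filt ha') hb'')
  · refine Submodule.mem_sup_right (low_mul ha'' ?_)
    exact Submodule.add_mem _ (fst_mem_filt hb') (filtPred_le _ hb''.1)

theorem low_of_fst_mem {m : ℕ} {a : Pairs K} (h : a.1 ∈ filt K m) (h2 : a.2 = 0) :
    a ∈ low K (m + 1) := mem_low.mpr ⟨by rwa [filtPred, if_neg (by omega)], h2⟩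

theorem wMon_fst_mem {w : ℕ × Finset ℕ} (hw : Standard w.1 w.2) : (wMon K w).1 ∈ filt K 1 :=
  Submodule.subset_span ⟨[w], by simp, by simpa using hw, by simp [wMon]⟩

/-! ### Sorting -/

theorem serV_sq (h2 : (2 : K) ≠ 0) (n : ℕ) : serV K n * serV K n = 0 := by
  have h := Ser.anticomm (serV_mem_serPar (K := K) n) (serV_mem_serPar n)
  have h' : (2 : K) • (serV K n * serV K n) = 0 := by
    rw [two_smul]; nth_rewrite 1 [h]; exact neg_add_cancel _
  exact (smul_eq_zero.mp h').resolve_left h2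

theorem pivot_mul_pivot (h2 : (2 : K) ≠ 0) (n : ℕ) :
    pivot K n * pivot K n = xOp K (n + 1) * pivot K (n + 3) := by
  have h := (pivotSys_end K (n + 2)).br_v_v_self (n := n) (by omega)
  rw [scommB_apply, scomm_one_one, ← two_smul K] at h
  exact (IsUnit.mk0 _ h2).smul_left_cancel.mp h

/-- A product of two standard monomials of the same length has lower degree. -/
theorem wMon_mul_self_mem (h2 : (2 : K) ≠ 0) {n : ℕ} {a b : Finset ℕ} (ha : Standard n a)
    (hb : Standard n b) : wMon K (n, a) * wMon K (n, b) ∈ low K 2 := by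
  refine low_of_fst_mem (m := 1) ?_ ?_
  · have e0 := (pivotSys_pairs K (n + 3)).br_v_ordProd_mem (n := n) (b := b) fun i hi => by
      have := hb.add_two_le i hi; omega
    have hmem : ∀ y ∈ stdSpan K (eX K) (eV K), y.1 ∈ filt K 1 := fun y hy =>
      fst_mem_filt (listSpan_one (K := K) ▸ hy)
    let z := prodBr (scommB K 1 b.card) (brN K (n + 3)) (eV K n) (ordProd (eX K) b)
    have h1 : (ordProd (eX K) a * (z * eV K n)).1 ∈ filt K 1 := by
      refine hmem _ ?_
      have := Submodule.mem_map_of_mem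
        (f := (LinearMap.mulLeft K (ordProd (eX K) a)).comp (LinearMap.mulRight K (eV K n))) e0
      rw [Submodule.map_span] at this
      refine Submodule.span_le.mpr ?_ this
      rintro _ ⟨_, ⟨r, hr, rfl⟩, rfl⟩
      exact (pivotSys_pairs K 0).ordProd_mul_mem_of_standard (ha.subst hb hr)
    have h3 : (ordProd (eX K) a * (ordProd (eX K) b * ordProd (eX K) {n + 1} *
        eV K (n + 3))).1 ∈ filt K 1 :=
      hmem _ ((pivotSys_pairs K 0).ordProd_mul_mem_of_standard
        ((isPivotBracket_self n).standard le_rfl ha hb))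
    have hz : z.1 = pivot K n * ordProd (xOp K) b -
        ssign K 1 b.card • (ordProd (xOp K) b * pivot K n) := by
      change scomm K _ _ (pivot K n) (ordProd (eX K) b).1 = _
      rw [eX_eq, ordProd_prodMk]
      rfl
    have hx : ∀ s, (ordProd (eX K) s).1 = ordProd (xOp K) s := fun s => by
      rw [eX_eq, ordProd_prodMk]
    have hv : ∀ n, (eV K n).1 = pivot K n := fun _ => rfl
    have hx' : ∀ n, (eX K n).1 = xOp K n := fun _ => rfl
    -- Moving the first $v_n$ past $x^b$ costs the commutator `z`, a substitution in $x^b$; the rest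
    -- contains $v_n^2=x_{n+1}v_{n+3}$. Both parts are combinations of single standard monomials.
    have e : (wMon K (n, a) * wMon K (n, b)).1 = (ordProd (eX K) a * (z * eV K n)).1 +
        ssign K 1 b.card • (ordProd (eX K) a * (ordProd (eX K) b * ordProd (eX K) {n + 1} *
        eV K (n + 3))).1 := by
      simp only [wMon_eq, stdMon, Prod.fst_mul, hx, hv, hz, ordProd_singleton, hx']
      rw [mul_assoc (ordProd (xOp K) b), ← pivot_mul_pivot h2]
      simp only [mul_sub, sub_mul, mul_smul_comm, smul_mul_assoc, mul_assoc]
      abel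
    rw [e]
    exact Submodule.add_mem _ h1 (Submodule.smul_mem _ _ h3)
  · change pMon K (n, a) * pMon K (n, b) = 0
    rw [pMon_eq, pMon_eq, stdMon, stdMon, ← mul_assoc, mul_assoc (ordProd (serX K) a),
      ordProd_anticomm (K := K) fun i _ => Ser.anticomm (serV_mem_serPar n) (serX_mem_serPar i)]
    simp only [mul_smul_comm, smul_mul_assoc, mul_assoc, serV_sq h2, mul_zero, smul_zero]

/-- The supercommutator of two standard monomials is a combination of single ones, so it drops by
one in the filtration, while their symbols supercommute. -/
theorem wMon_mul_swap (h2 : (2 : K) ≠ 0) {w w' : ℕ × Finset ℕ} (hw : Standard w.1 w.2)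
    (hw' : Standard w'.1 w'.2) :
    wMon K w * wMon K w' - ssign K (wPar w) (wPar w') • (wMon K w' * wMon K w) ∈ low K 2 := by
  refine low_of_fst_mem (m := 1) ?_ ?_
  · have h1 := eBr_wMon_mem h2 hw hw'
    rw [listSpan_one] at h1
    have h3 := fst_mem_filt h1
    exact h3
  · change pMon K w * pMon K w' - ssign K (wPar w) (wPar w') • (pMon K w' * pMon K w) = 0
    rw [Ser.mul_supercomm (f := pMon K w) (g := pMon K w') (wMon_mem_ePar hw).2.1
      (wMon_mem_ePar hw').2.1]
    exact sub_self _

/-- The span of the products of standard monomials with lengths sorted with respect to `r` that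
satisfy `Q`. -/
def sortedSpan (K : Type*) [Field K] (r : ℕ → ℕ → Prop) (Q : ℕ → Prop) (m : ℕ) :
    Submodule K (Pairs K) :=
  Submodule.span K {z | ∃ l, AllStd l ∧ l.length = m ∧ l.Pairwise (fun w w' => r w.1 w'.1) ∧
    (∀ w ∈ l, Q w.1) ∧ z = wProd K l}

theorem wMon_mul_mem_sortedSpan {r : ℕ → ℕ → Prop} {Q : ℕ → Prop} {m : ℕ} {w : ℕ × Finset ℕ}
    (hw : Standard w.1 w.2) (hQ : Q w.1) {z : Pairs K}
    (hz : z ∈ sortedSpan K r (fun j => Q j ∧ r w.1 j) m ⊔ low K m) :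
    wMon K w * z ∈ sortedSpan K r Q (m + 1) ⊔ low K (m + 1) := by
  obtain ⟨z', hz', z'', hz'', rfl⟩ := Submodule.mem_sup.mp hz
  rw [mul_add]
  refine Submodule.add_mem _ (Submodule.mem_sup_left ?_) (Submodule.mem_sup_right ?_)
  · have := Submodule.mem_map_of_mem (f := LinearMap.mulLeft K (wMon K w)) hz'
    rw [sortedSpan, Submodule.map_span] at this
    refine Submodule.span_mono ?_ this
    rintro _ ⟨_, ⟨l, h1, h2, h3, h4, rfl⟩, rfl⟩
    refine ⟨w :: l, h1.cons hw, by simp [h2], List.pairwise_cons.mpr ⟨fun w' hw' => (h4 w' hw').2, h3⟩,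
      fun w' hw' => ?_, (wProd_cons K w l).symm⟩
    rcases List.mem_cons.mp hw' with rfl | hw'
    · exact hQ
    · exact (h4 w' hw').1
  · rw [add_comm m]
    exact mul_low (wMon_fst_mem hw) hz''

/-- Insertion sort modulo lower terms: swaps cost `wMon_mul_swap`, and equal lengths collapse by
`wMon_mul_self_mem`. The predicate `Q` remembers bounds on the lengths while the induction passes to
the tail. The order `r` stays free, since the normal form needs increasing and the filtration
statement decreasing lengths. -/
theorem insert_mem_sortedSpan (h2 : (2 : K) ≠ 0) {r : ℕ → ℕ → Prop}
    (htrans : ∀ i j k, r i j → r j k → r i k) (htri : ∀ i j, r i j ∨ i = j ∨ r j i)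
    {w : ℕ × Finset ℕ} (hw : Standard w.1 w.2) (l : List (ℕ × Finset ℕ)) (hl : AllStd l)
    (hs : l.Pairwise (fun w w' => r w.1 w'.1)) (Q : ℕ → Prop) (hQ : Q w.1) (hQl : ∀ w' ∈ l, Q w'.1) :
    wMon K w * wProd K l ∈ sortedSpan K r Q (l.length + 1) ⊔ low K (l.length + 1) := by
  induction l generalizing Q with
  | nil =>
    refine Submodule.mem_sup_left (Submodule.subset_span ⟨[w], by simpa [AllStd] using hw, rfl,
      by simp, by simpa using hQ, by rw [wProd_cons]⟩)
  | cons w' l ih =>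
    obtain ⟨hw', hl'⟩ := hl.of_cons
    obtain ⟨hr, hs'⟩ := List.pairwise_cons.mp hs
    have hfl : (wProd K l).1 ∈ filt K l.length := fst_mem_filt (wProd_mem_listSpan hl')
    rcases htri w.1 w'.1 with h | h | h
    · refine Submodule.mem_sup_left (Submodule.subset_span ⟨w :: w' :: l, hl.cons hw, rfl,
        List.pairwise_cons.mpr ⟨fun w'' hw'' => ?_, hs⟩, fun w'' hw'' => ?_,
        (wProd_cons K _ _).symm⟩)
      · rcases List.mem_cons.mp hw'' with rfl | hw''
        · exact h
        · exact htrans _ _ _ h (hr w'' hw'')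
      · rcases List.mem_cons.mp hw'' with rfl | hw''
        · exact hQ
        · exact hQl w'' hw''
    · refine Submodule.mem_sup_right ?_
      rw [wProd_cons, ← mul_assoc, List.length_cons, add_assoc, add_comm]
      refine low_mul ?_ hfl
      obtain ⟨n, a⟩ := w
      obtain ⟨n', b⟩ := w'
      obtain rfl : n = n' := h
      exact wMon_mul_self_mem h2 hw hw'
    · have e : wMon K w * wProd K (w' :: l) =
          (wMon K w * wMon K w' - ssign K (wPar w) (wPar w') • (wMon K w' * wMon K w)) *
            wProd K l + ssign K (wPar w) (wPar w') • (wMon K w' * (wMon K w * wProd K l)) := by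
        rw [wProd_cons]
        simp only [sub_mul, smul_mul_assoc, mul_assoc]
        abel
      rw [e]
      refine Submodule.add_mem _ (Submodule.mem_sup_right ?_) (Submodule.smul_mem _ _ ?_)
      · rw [List.length_cons, add_assoc, add_comm]
        exact low_mul (wMon_mul_swap h2 hw hw') hfl
      · refine wMon_mul_mem_sortedSpan hw' (hQl w' List.mem_cons_self) ?_
        exact ih hl' hs' _ ⟨hQ, h⟩ fun w'' hw'' =>
          ⟨hQl w'' (List.mem_cons_of_mem _ hw''), hr w'' hw''⟩

theorem listSpan_le_sortedSpan (h2 : (2 : K) ≠ 0) {r : ℕ → ℕ → Prop}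
    (htrans : ∀ i j k, r i j → r j k → r i k) (htri : ∀ i j, r i j ∨ i = j ∨ r j i) (m : ℕ) :
    listSpan K m ≤ sortedSpan K r (fun _ => True) m ⊔ low K m := by
  refine Submodule.span_le.mpr ?_
  rintro _ ⟨l, hl, rfl, rfl⟩
  induction l with
  | nil =>
    exact Submodule.mem_sup_left (Submodule.subset_span ⟨[], hl, rfl, by simp, by simp, rfl⟩)
  | cons w l ih =>
    obtain ⟨hw, hl'⟩ := hl.of_cons
    obtain ⟨z, hz, z', hz', e⟩ := Submodule.mem_sup.mp (ih hl')
    rw [wProd_cons, ← e, mul_add]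
    refine Submodule.add_mem _ ?_ (Submodule.mem_sup_right ?_)
    · have := Submodule.mem_map_of_mem (f := LinearMap.mulLeft K (wMon K w)) hz
      rw [sortedSpan, Submodule.map_span] at this
      refine Submodule.span_le.mpr ?_ this
      rintro _ ⟨_, ⟨l', h1, h2', h3, -, rfl⟩, rfl⟩
      have := insert_mem_sortedSpan h2 htrans htri hw l' h1 h3 (fun _ => True) trivial
        fun _ _ => trivial
      rwa [h2'] at this
    · rw [List.length_cons, add_comm]
      exact mul_low (wMon_fst_mem hw) hz'

end Lists

/-! ### Normal forms -/

section NormalForm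

variable {K : Type*} [Field K]

/-- The standard monomials `x^{s j} v_j`, `j ∈ γ`, have no common letters. -/
def IsSplit (γ : Finset ℕ) (s : ℕ → Finset ℕ) : Prop :=
  ∀ j ∈ γ, ∀ k ∈ γ, j ≠ k → Disjoint (s j) (s k)

theorem ordProd_congr {E : Type*} [Mul E] [One E] {x y : ℕ → E} {s : Finset ℕ}
    (h : ∀ i ∈ s, x i = y i) : ordProd x s = ordProd y s := by
  rw [ordProd, ordProd, List.map_congr_left fun i hi => h i ((Finset.mem_sort _).mp hi)]

theorem ordProd_wMon_mem {γ : Finset ℕ} {s : ℕ → Finset ℕ} (hs : ∀ j ∈ γ, Standard j (s j)) :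
    ordProd (fun j => wMon K (j, s j)) γ ∈ listSpan K γ.card := by
  refine Submodule.subset_span ⟨(γ.sort (· ≤ ·)).map fun j => (j, s j), ?_, by simp, ?_⟩
  · intro w hw
    obtain ⟨j, hj, rfl⟩ := List.mem_map.mp hw
    exact hs j ((Finset.mem_sort _).mp hj)
  · rw [ordProd, wProd, List.map_map]
    rfl

theorem fst_eMon_mem_of_sub {γ : Finset ℕ} {s : ℕ → Finset ℕ} (hs : ∀ j ∈ γ, Standard j (s j))
    {u : K} (hu : u ≠ 0) {z : Pairs K}
    (h : ordProd (fun j => wMon K (j, s j)) γ - u • z ∈ low K γ.card) :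
    z ∈ symSpan K γ.card ∧ z.1 ∈ filt K γ.card := by
  have h1 : u • z ∈ symSpan K γ.card := by
    have := Submodule.sub_mem _ (Submodule.mem_sup_left (ordProd_wMon_mem hs))
      (Submodule.mem_sup_right h : _ ∈ symSpan K γ.card)
    rwa [sub_sub_cancel] at this
  have h2 := (Submodule.smul_mem_iff _ hu).mp h1
  refine ⟨h2, ?_⟩
  obtain ⟨a, ha, b, hb, rfl⟩ := Submodule.mem_sup.mp h2
  exact Submodule.add_mem _ (fst_mem_filt ha) (filtPred_le _ (mem_low.mp hb).1)

/-- Replacing a letter in one of the factors by a standard monomial. -/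
theorem fst_subst_mem {j r : ℕ} {γ a : Finset ℕ} {s : ℕ → Finset ℕ}
    (ha : Standard j a) (hs : ∀ k ∈ γ, Standard k (s k)) (hγ : IsSplit γ s)
    (hi : j + 3 * r ∈ γ.biUnion s)
    (ih : ∀ s' : ℕ → Finset ℕ, (∀ k ∈ γ, Standard k (s' k)) → IsSplit γ s' →
      (eMon K (γ.biUnion s', γ)).1 ∈ filt K γ.card) :
    (ordProd (eX K) a * (ordProd (eX K) (pivotTail j r) *
      ordProd (eX K) ((γ.biUnion s).erase (j + 3 * r)) * ordProd (eV K) γ)).1 ∈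
      filt K γ.card := by
  obtain ⟨k, hk, hik⟩ := Finset.mem_biUnion.mp hi
  have hsq := (pivotSys_pairs K 0).x_sq
  have hac := (pivotSys_pairs K 0).x_anti
  set i := j + 3 * r with hi_def
  have hil : ∀ l ∈ γ, l ≠ k → i ∉ s l := fun l hl hlk h =>
    Finset.disjoint_left.mp (hγ l hl k hk hlk) h hik
  -- The factor that owned the replaced letter absorbs both `a` and the tail, so it remains
  -- standard.
  let s' := Function.update s k (a ∪ (pivotTail j r ∪ (s k).erase i))
  have hs'k : s' k = a ∪ (pivotTail j r ∪ (s k).erase i) := Function.update_self _ _ _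
  have hs'l : ∀ l, l ≠ k → s' l = s l := fun l hl => Function.update_of_ne hl _ _
  have hs' : ∀ l ∈ γ, Standard l (s' l) := fun l hl => by
    by_cases hlk : l = k
    · subst hlk
      rw [hs'k]
      exact ha.subst (hs l hl) hik
    · rw [hs'l l hlk]
      exact hs l hl
  have hun : γ.biUnion s' = a ∪ (pivotTail j r ∪ (γ.biUnion s).erase i) := by
    ext p
    simp only [Finset.mem_biUnion, Finset.mem_union, Finset.mem_erase]
    constructor
    · rintro ⟨l, hl, hp⟩
      by_cases hlk : l = k
      · subst hlk
        rw [hs'k, Finset.mem_union, Finset.mem_union, Finset.mem_erase] at hp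
        rcases hp with hp | hp | ⟨hp, hp'⟩
        · exact Or.inl hp
        · exact Or.inr (Or.inl hp)
        · exact Or.inr (Or.inr ⟨hp, l, hl, hp'⟩)
      · rw [hs'l l hlk] at hp
        exact Or.inr (Or.inr ⟨fun h => hil l hl hlk (h ▸ hp), l, hl, hp⟩)
    · rintro (hp | hp | ⟨hp, l, hl, hp'⟩)
      · exact ⟨k, hk, by rw [hs'k]; exact Finset.mem_union_left _ hp⟩
      · exact ⟨k, hk, by
          rw [hs'k]; exact Finset.mem_union_right _ (Finset.mem_union_left _ hp)⟩
      · by_cases hlk : l = k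
        · subst hlk
          exact ⟨l, hl, by
            rw [hs'k]
            exact Finset.mem_union_right _ (Finset.mem_union_right _
              (Finset.mem_erase.mpr ⟨hp, hp'⟩))⟩
        · exact ⟨l, hl, by rw [hs'l l hlk]; exact hp'⟩
  by_cases hsplit : IsSplit γ s'
  · obtain ⟨u, e⟩ := exists_ordProd_mul' (K := K) hsq hac (pivotTail j r)
      ((γ.biUnion s).erase i)
    obtain ⟨u', e'⟩ := exists_ordProd_mul' (K := K) hsq hac a
      (pivotTail j r ∪ (γ.biUnion s).erase i)
    rw [e, smul_mul_assoc, mul_smul_comm, ← mul_assoc, e', smul_mul_assoc, ← hun]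
    exact Submodule.smul_mem _ _ (Submodule.smul_mem _ _ (ih s' hs' hsplit))
  -- If the new exponents are no longer disjoint, a letter is repeated and the product is zero.
  · have hnd : ¬Disjoint (a ∪ pivotTail j r) ((γ.biUnion s).erase i) := by
      intro hd
      refine hsplit ?_
      have hkl : ∀ l ∈ γ, l ≠ k → Disjoint (s' k) (s' l) := fun l hl hlk => by
        rw [hs'k, hs'l l hlk, ← Finset.union_assoc]
        refine Finset.disjoint_union_left.mpr ⟨Finset.disjoint_of_subset_right ?_ hd,
          Finset.disjoint_of_subset_left (Finset.erase_subset _ _) (hγ k hk l hl (Ne.symm hlk))⟩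
        intro p hp
        exact Finset.mem_erase.mpr ⟨fun h => hil l hl hlk (h ▸ hp),
          Finset.mem_biUnion.mpr ⟨l, hl, hp⟩⟩
      intro l hl l' hl' hne
      by_cases h1 : l = k
      · subst h1
        exact hkl l' hl' (Ne.symm hne)
      · by_cases h2 : l' = k
        · subst h2
          exact (hkl l hl h1).symm
        · rw [hs'l l h1, hs'l l' h2]
          exact hγ l hl l' hl' hne
    obtain ⟨u, e⟩ := exists_ordProd_mul' (K := K) hsq hac a (pivotTail j r)
    rw [← mul_assoc, ← mul_assoc, e, smul_mul_assoc, ordProd_mul_eq_zero K hsq hac hnd, smul_zero,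
      zero_mul]
    exact Submodule.zero_mem _

/-- Induction on the factors from the right. The pivot letter of the first factor is moved past all
letters $x^t$ of the others: the main term is $\pm x^{s_j}x^tv_jv^\gamma$, which vanishes exactly
when a letter is repeated. Each correction replaces one letter by a tail and loses the factor $v_j$,
so it is again a normal monomial, with one pivot letter less. -/
theorem ordProd_wMon {γ : Finset ℕ} {s : ℕ → Finset ℕ}
    (hs : ∀ j ∈ γ, Standard j (s j)) : ∃ u : K, (IsSplit γ s → u ≠ 0) ∧ (¬IsSplit γ s → u = 0) ∧
      ordProd (fun j => wMon K (j, s j)) γ - u • eMon K (γ.biUnion s, γ) ∈ low K γ.card := by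
  induction γ using Finset.induction_on_min generalizing s with
  | empty =>
    refine ⟨1, fun _ => one_ne_zero, fun h => absurd (fun j hj => by simp at hj) h, ?_⟩
    rw [ordProd_empty, Finset.biUnion_empty, eMon, ordProd_empty, ordProd_empty, one_smul, mul_one,
      sub_self]
    exact Submodule.zero_mem _
  | insert j γ hj ih =>
    have hjγ : j ∉ γ := fun h => lt_irrefl _ (hj j h)
    have hsj := hs j (Finset.mem_insert_self _ _)
    have hsγ : ∀ k ∈ γ, Standard k (s k) := fun k hk => hs k (Finset.mem_insert_of_mem hk)
    have hsplit : IsSplit (insert j γ) s ↔ IsSplit γ s ∧ Disjoint (s j) (γ.biUnion s) := by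
      rw [Finset.disjoint_biUnion_right]
      constructor
      · exact fun h => ⟨fun k hk l hl => h k (Finset.mem_insert_of_mem hk) l
          (Finset.mem_insert_of_mem hl), fun k hk => h j (Finset.mem_insert_self _ _) k
          (Finset.mem_insert_of_mem hk) fun e => hjγ (e ▸ hk)⟩
      · rintro ⟨h, h'⟩ k hk l hl hne
        rcases Finset.mem_insert.mp hk with hk1 | hk1 <;>
          rcases Finset.mem_insert.mp hl with hl1 | hl1
        · exact absurd (hk1.trans hl1.symm) hne
        · exact hk1 ▸ h' l hl1
        · exact hl1 ▸ (h' k hk1).symm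
        · exact h k hk1 l hl1 hne
    obtain ⟨u, hu, hu0, hlow⟩ := ih hsγ
    have hWlow := mul_low (wMon_fst_mem (K := K) (w := (j, s j)) hsj) hlow
    rw [add_comm 1, ← Finset.card_insert_of_notMem hjγ] at hWlow
    rw [ordProd_insert_min _ hj]
    by_cases hγ : IsSplit γ s
    swap
    · refine ⟨0, fun h => absurd (hsplit.mp h).1 hγ, fun _ => rfl, ?_⟩
      rw [hu0 hγ, zero_smul, sub_zero] at hWlow
      rwa [zero_smul, sub_zero]
    set t := γ.biUnion s with ht
    let R : Pairs K := eV K j * ordProd (eX K) t - ssign K 1 t.card • (ordProd (eX K) t * eV K j)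
    -- `R` is the supercommutator of $v_j$ with $x^t$. Its symbol component is zero, because formal
    -- sums supercommute.
    have hR : ordProd (eX K) (s j) * (R * ordProd (eV K) γ) ∈ low K (insert j γ).card := by
      rw [Finset.card_insert_of_notMem hjγ]
      refine low_of_fst_mem ?_ ?_
      -- The truncation only has to cover the letters of `t`; the Poisson component is discarded
      -- afterwards.
      · let N := t.sup id + 1
        let z := prodBr (scommB K 1 t.card) (brN K N) (eV K j) (ordProd (eX K) t)
        have hz : (ordProd (eX K) (s j) * (z * ordProd (eV K) γ)).1 ∈ filt K γ.card := by
          have := Submodule.mem_map_of_mem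
            (f := (LinearMap.fst K _ _).comp ((LinearMap.mulLeft K (ordProd (eX K) (s j))).comp
              (LinearMap.mulRight K (ordProd (eV K) γ))))
            ((pivotSys_pairs K N).br_v_ordProd_mem (n := j) (b := t) fun i hi =>
              Nat.lt_succ_of_le (Finset.le_sup (f := id) hi))
          rw [Submodule.map_span] at this
          refine Submodule.span_le.mpr ?_ this
          rintro _ ⟨_, ⟨r, hr, rfl⟩, rfl⟩
          refine fst_subst_mem hsj hsγ hγ hr fun s' h1 h3 => ?_
          obtain ⟨u', hu', -, hl⟩ := ih h1
          exact (fst_eMon_mem_of_sub h1 (hu' h3) hl).2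
        exact hz
      · have h1 : R.2 = 0 := by
          have hmem : (ordProd (eX K) t).2 ∈ serPar K t.card :=
            ((pivotSys_pairs K 0).toSuperBr.ordProd_mem (pivotSys_pairs K 0).x_mem t).2
          change serV K j * (ordProd (eX K) t).2 -
            ssign K 1 t.card • ((ordProd (eX K) t).2 * serV K j) = 0
          rw [Ser.mul_supercomm (serV_mem_serPar j) hmem, sub_self]
        rw [Prod.snd_mul, Prod.snd_mul, h1, zero_mul, mul_zero]
    have hW : wMon K (j, s j) * eMon K (t, γ) = ordProd (eX K) (s j) * (R * ordProd (eV K) γ) +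
        ssign K 1 t.card • (ordProd (eX K) (s j) * ordProd (eX K) t *
          ordProd (eV K) (insert j γ)) := by
      rw [wMon_eq, stdMon, eMon, ordProd_insert_min _ hj]
      simp only [R, sub_mul, mul_sub, smul_mul_assoc, mul_smul_comm, mul_assoc]
      abel
    have hsq := (pivotSys_pairs K 0).x_sq
    have hac := (pivotSys_pairs K 0).x_anti
    have hun : (insert j γ).biUnion s = s j ∪ t := Finset.biUnion_insert
    by_cases hd : Disjoint (s j) t
    · obtain ⟨u', hu', e⟩ := exists_ordProd_mul (K := K) hac hd
      refine ⟨u * (ssign K 1 t.card * u'), fun _ => mul_ne_zero (hu hγ)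
        (mul_ne_zero (ssign_ne_zero _ _) hu'), fun h => absurd (hsplit.mpr ⟨hγ, hd⟩) h, ?_⟩
      have := Submodule.add_mem _ hWlow (Submodule.smul_mem _ u hR)
      convert this using 1
      rw [mul_sub, mul_smul_comm, hW, e, hun, eMon]
      simp only [smul_add, smul_smul, smul_mul_assoc]
      abel
    · refine ⟨0, fun h => absurd (hsplit.mp h).2 hd, fun _ => rfl, ?_⟩
      have := Submodule.add_mem _ hWlow (Submodule.smul_mem _ u hR)
      convert this using 1
      rw [mul_sub, mul_smul_comm, hW, ordProd_mul_eq_zero K hsq hac hd]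
      simp

/-- The exponents of the products of standard monomials of distinct lengths. -/
def StdPair (w : Finset ℕ × Finset ℕ) : Prop :=
  ∃ s : ℕ → Finset ℕ, (∀ j ∈ w.2, Standard j (s j)) ∧ IsSplit w.2 s ∧ w.1 = w.2.biUnion s

theorem eMon_mem_symSpan {w : Finset ℕ × Finset ℕ} (hw : StdPair w) :
    eMon K w ∈ symSpan K w.2.card := by
  obtain ⟨s, hs, hsp, e⟩ := hw
  obtain ⟨u, hu, -, hl⟩ := ordProd_wMon (K := K) hs
  rw [← e] at hl
  exact (fst_eMon_mem_of_sub hs (hu hsp) hl).1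

theorem exists_of_sorted (l : List (ℕ × Finset ℕ)) (hl : AllStd l)
    (hs : l.Pairwise fun w w' => w.1 < w'.1) : ∃ (γ : Finset ℕ) (s : ℕ → Finset ℕ),
      γ.card = l.length ∧ (∀ j ∈ γ, Standard j (s j)) ∧ (∀ j ∈ γ, ∃ w ∈ l, w.1 = j) ∧
      wProd K l = ordProd (fun j => wMon K (j, s j)) γ := by
  induction l with
  | nil => exact ⟨∅, fun _ => ∅, rfl, by simp, by simp, by rw [ordProd_empty, wProd_nil]⟩
  | cons w l ih =>
    obtain ⟨hw, hl'⟩ := hl.of_cons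
    obtain ⟨hr, hs'⟩ := List.pairwise_cons.mp hs
    obtain ⟨γ, s, h1, h2, h3, e⟩ := ih hl' hs'
    have hlt : ∀ j ∈ γ, w.1 < j := fun j hj => by
      obtain ⟨w', hw', rfl⟩ := h3 j hj
      exact hr w' hw'
    have hne : ∀ j ∈ γ, Function.update s w.1 w.2 j = s j := fun j hj =>
      Function.update_of_ne (hlt j hj).ne' _ _
    refine ⟨insert w.1 γ, Function.update s w.1 w.2, ?_, fun j hj => ?_, fun j hj => ?_, ?_⟩
    · rw [Finset.card_insert_of_notMem fun h => lt_irrefl _ (hlt _ h), h1, List.length_cons]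
    · rcases Finset.mem_insert.mp hj with rfl | hj
      · rwa [Function.update_self]
      · rw [hne j hj]
        exact h2 j hj
    · rcases Finset.mem_insert.mp hj with rfl | hj
      · exact ⟨w, List.mem_cons_self, rfl⟩
      · obtain ⟨w', hw', rfl⟩ := h3 j hj
        exact ⟨w', List.mem_cons_of_mem _ hw', rfl⟩
    · rw [wProd_cons, e, ordProd_insert_min _ hlt, Function.update_self]
      congr 1
      exact ordProd_congr fun j hj => by rw [hne j hj]

/-- Sorting, followed by the normal form of an ordered product; products with a repeated letter
contribute only to the lower part. -/
theorem symSpan_eq (h2 : (2 : K) ≠ 0) (m : ℕ) : symSpan K m =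
    Submodule.span K (eMon K '' {w | StdPair w ∧ w.2.card = m}) ⊔ low K m := by
  refine le_antisymm (sup_le ((listSpan_le_sortedSpan h2 (r := (· < ·))
    (fun _ _ _ => lt_trans) lt_trichotomy m).trans (sup_le ?_ le_sup_right)) le_sup_right)
    (sup_le (Submodule.span_le.mpr ?_) le_sup_right)
  · refine Submodule.span_le.mpr ?_
    rintro _ ⟨l, hl, rfl, hs, -, rfl⟩
    obtain ⟨γ, s, h1, h3, -, e⟩ := exists_of_sorted (K := K) l hl hs
    obtain ⟨u, -, hu0, hlow⟩ := ordProd_wMon (K := K) h3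
    rw [← h1, e, ← sub_add_cancel (ordProd (fun j => wMon K (j, s j)) γ)
      (u • eMon K (γ.biUnion s, γ))]
    refine Submodule.add_mem _ (Submodule.mem_sup_right hlow) (Submodule.mem_sup_left ?_)
    by_cases hsp : IsSplit γ s
    · exact Submodule.smul_mem _ _ (Submodule.subset_span ⟨_, ⟨⟨s, h3, hsp, rfl⟩, rfl⟩, rfl⟩)
    · rw [hu0 hsp, zero_smul]
      exact Submodule.zero_mem _
  · rintro _ ⟨w, ⟨hw, rfl⟩, rfl⟩
    exact eMon_mem_symSpan hw

end NormalForm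

/-! ### Bases -/

section Bases

variable {K : Type*} [Field K]

theorem linearIndependent_eMon_fst : LinearIndependent K fun w => (eMon K w).1 := by
  have e : (fun w => (eMon K w).1) = fun w : Finset ℕ × Finset ℕ =>
      ordProd (xOp K) w.1 * ordProd (pivot K) w.2 := funext fun w => eMon_fst K w
  rw [e]
  exact linearIndependent_end K

theorem linearIndependent_eMon_snd : LinearIndependent K fun w => (eMon K w).2 := by
  have e : (fun w => (eMon K w).2) = fun w : Finset ℕ × Finset ℕ =>
      ordProd (serX K) w.1 * ordProd (serV K) w.2 := funext fun w => eMon_snd K w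
  rw [e]
  exact linearIndependent_ser

theorem eq_zero_of_snd {z : Pairs K} (hz : z ∈ Submodule.span K (Set.range (eMon K)))
    (h : z.2 = 0) : z = 0 := by
  obtain ⟨c, rfl⟩ := (Finsupp.mem_span_range_iff_exists_finsupp (R := K)).mp hz
  change (Finsupp.linearCombination K (eMon K) c) = 0
  change (Finsupp.linearCombination K (eMon K) c).2 = 0 at h
  rw [linearCombination_eMon_snd] at h
  rw [linearIndependent_iff.mp linearIndependent_ser c h, map_zero]

theorem map_fst_low (m : ℕ) :
    (low K m).map (LinearMap.fst K _ _) = filtPred (filt K) m := by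
  ext a
  constructor
  · rintro ⟨z, hz, rfl⟩
    exact (mem_low.mp hz).1
  · exact fun ha => ⟨(a, 0), mem_low.mpr ⟨ha, rfl⟩, rfl⟩

theorem map_snd_low (m : ℕ) : (low K m).map (LinearMap.snd K _ _) = ⊥ := by
  refine le_bot_iff.mp ?_
  rintro _ ⟨z, hz, rfl⟩
  exact (mem_low.mp hz).2

theorem map_snd_listSpan (m : ℕ) : (listSpan K m).map (LinearMap.snd K _ _) = pPiece K m := by
  rw [listSpan, Submodule.map_span, pPiece]
  congr 1
  ext f
  constructor
  · rintro ⟨_, ⟨l, hl, hm, rfl⟩, rfl⟩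
    exact ⟨l, hm, hl, wProd_snd K l⟩
  · rintro ⟨l, hm, hl, rfl⟩
    exact ⟨_, ⟨l, hl, hm, rfl⟩, wProd_snd K l⟩

theorem map_fst_symSpan (m : ℕ) : (symSpan K m).map (LinearMap.fst K _ _) = filt K m := by
  rw [symSpan, Submodule.map_sup, map_fst_low]
  refine le_antisymm (sup_le ?_ (filtPred_le m)) (Submodule.span_le.mpr ?_)
  · rintro _ ⟨z, hz, rfl⟩
    exact fst_mem_filt hz
  · rintro _ ⟨l, hm, hl, rfl⟩
    rcases hm.eq_or_lt with rfl | hm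
    · exact Submodule.mem_sup_left ⟨_, wProd_mem_listSpan hl, wProd_fst K l⟩
    · refine Submodule.mem_sup_right ?_
      rw [filtPred, if_neg (by omega)]
      exact Submodule.subset_span ⟨l, by omega, hl, rfl⟩

theorem map_snd_symSpan (m : ℕ) : (symSpan K m).map (LinearMap.snd K _ _) = pPiece K m := by
  rw [symSpan, Submodule.map_sup, map_snd_low, sup_bot_eq, map_snd_listSpan]

/-- The span of the monomials that are products of `m` standard monomials. -/
theorem pPiece_eq_span (h2 : (2 : K) ≠ 0) (m : ℕ) :
    pPiece K m = Submodule.span K ((fun w => (eMon K w).2) '' {w | StdPair w ∧ w.2.card = m}) := by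
  rw [← map_snd_symSpan, symSpan_eq h2, Submodule.map_sup, map_snd_low, sup_bot_eq,
    Submodule.map_span, Set.image_image]
  rfl

theorem filt_eq_span (h2 : (2 : K) ≠ 0) (m : ℕ) :
    filt K m = Submodule.span K ((fun w => (eMon K w).1) '' {w | StdPair w ∧ w.2.card ≤ m}) := by
  have hstep : ∀ m, filt K m =
      Submodule.span K ((fun w => (eMon K w).1) '' {w | StdPair w ∧ w.2.card = m}) ⊔
        filtPred (filt K) m := fun m => by
    rw [← map_fst_symSpan, symSpan_eq h2, Submodule.map_sup, map_fst_low, Submodule.map_span,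
      Set.image_image]
    rfl
  induction m with
  | zero =>
    rw [hstep, filtPred, if_pos rfl, sup_bot_eq]
    simp only [Nat.le_zero]
  | succ m ih =>
    rw [hstep, filtPred, if_neg m.succ_ne_zero, Nat.add_sub_cancel, ih, ← Submodule.span_union,
      ← Set.image_union]
    congr 2
    ext w
    constructor
    · rintro (⟨h, h'⟩ | ⟨h, h'⟩)
      · exact ⟨h, h'.le⟩
      · exact ⟨h, Nat.le_succ_of_le h'⟩
    · rintro ⟨h, h'⟩
      rcases Nat.le_succ_iff.mp h' with h' | h'
      · exact Or.inr ⟨h, h'⟩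
      · exact Or.inl ⟨h, h'⟩

theorem filtPred_eq_span (h2 : (2 : K) ≠ 0) (m : ℕ) : filtPred (filt K) m =
    Submodule.span K ((fun w => (eMon K w).1) '' {w | StdPair w ∧ w.2.card < m}) := by
  unfold filtPred
  split_ifs with h
  · subst h
    simp
  · rw [filt_eq_span h2]
    congr 2
    ext w
    exact and_congr_right fun _ => by omega

/-- An element of the filtration with symbol zero lies in the previous term. -/
theorem fst_mem_filtPred (h2 : (2 : K) ≠ 0) {m : ℕ} {z : Pairs K} (hz : z ∈ symSpan K m)
    (h : z.2 = 0) : z.1 ∈ filtPred (filt K) m := by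
  rw [symSpan_eq h2] at hz
  obtain ⟨a, ha, b, hb, rfl⟩ := Submodule.mem_sup.mp hz
  have h0 : a = 0 := eq_zero_of_snd (Submodule.span_mono (Set.image_subset_range _ _) ha) (by
    have := (mem_low.mp hb).2
    rwa [Prod.snd_add, this, add_zero] at h)
  rw [h0, zero_add]
  exact (mem_low.mp hb).1

/-- The symbol of an element of the previous term of the filtration is zero. -/
theorem snd_eq_zero_of_fst (h2 : (2 : K) ≠ 0) {m : ℕ} {z : Pairs K} (hz : z ∈ symSpan K m)
    (h : z.1 ∈ filtPred (filt K) m) : z.2 = 0 := by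
  rw [symSpan_eq h2] at hz
  obtain ⟨a, ha, b, hb, rfl⟩ := Submodule.mem_sup.mp hz
  have h1 : a.1 ∈ filtPred (filt K) m := by
    have := Submodule.sub_mem _ h (mem_low.mp hb).1
    rwa [Prod.fst_add, add_sub_cancel_right] at this
  have h3 : a.1 ∈ Submodule.span K
      ((fun w => (eMon K w).1) '' {w | StdPair w ∧ w.2.card = m}) := by
    have := Submodule.mem_map_of_mem (f := LinearMap.fst K (Module.End K (Lam K)) (Ser K)) ha
    rwa [Submodule.map_span, Set.image_image] at this
  rw [filtPred_eq_span h2] at h1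
  have hd := linearIndependent_eMon_fst (K := K).disjoint_span_image
    (s := {w | StdPair w ∧ w.2.card = m}) (t := {w | StdPair w ∧ w.2.card < m})
    (Set.disjoint_left.mpr fun w hw hw' => by
      have := hw.2; have := hw'.2; omega)
  have h0 : a = 0 := eq_zero_of_fst K (Submodule.span_mono (Set.image_subset_range _ _) ha)
    (Submodule.disjoint_def.mp hd _ h3 h1)
  rw [h0, zero_add, (mem_low.mp hb).2]

/-- The pieces are spanned by disjoint parts of one independent family, separated by the number of
letters $V_j$. -/
theorem iSupIndep_pPiece (h2 : (2 : K) ≠ 0) : iSupIndep (pPiece K) := by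
  refine fun m => ?_
  have e : ⨆ j, ⨆ (_ : j ≠ m), pPiece K j ≤ Submodule.span K
      ((fun w => (eMon K w).2) '' {w | StdPair w ∧ w.2.card ≠ m}) := by
    refine iSup₂_le fun j hj => ?_
    rw [pPiece_eq_span h2]
    refine Submodule.span_mono (Set.image_mono fun w hw => ⟨hw.1, ?_⟩)
    rw [hw.2]
    exact hj
  rw [pPiece_eq_span h2]
  refine Disjoint.mono_right e (linearIndependent_eMon_snd.disjoint_span_image ?_)
  exact Set.disjoint_left.mpr fun w hw hw' => hw'.2 hw.2

/-- The exponents of the unit and of the admissible monomials. -/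
def exponents : Option {m : Mono // m.Admissible} → Finset ℕ × Finset ℕ
  | none => (∅, ∅)
  | some m => (m.1.α, insert m.1.n m.1.β)

theorem basisFamily_eq {E : Type*} [Monoid E] (x v : ℕ → E) (o : Option {m : Mono // m.Admissible}) :
    basisFamily x v o = ordProd x (exponents o).1 * ordProd v (exponents o).2 := by
  cases o with
  | none => rw [exponents, ordProd_empty, ordProd_empty, mul_one]; rfl
  | some m => exact monoProd_eq_insert x v m.1.hβ

theorem exponents_injective : Function.Injective exponents := by
  have hsup : ∀ m : Mono, (insert m.n m.β).sup id = m.n := fun m => by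
    rw [Finset.sup_insert, id, sup_eq_left]
    exact Finset.sup_le fun j hj => (m.hβ j hj).le
  rintro (_ | ⟨m, hm⟩) (_ | ⟨m', hm'⟩) h
  · rfl
  · exact absurd (Prod.ext_iff.mp h).2.symm (Finset.insert_ne_empty _ _)
  · exact absurd (Prod.ext_iff.mp h).2 (Finset.insert_ne_empty _ _)
  · obtain ⟨h1, h3⟩ := Prod.ext_iff.mp h
    simp only [exponents] at h1 h3
    have hn : m.n = m'.n := by rw [← hsup m, h3, hsup m']
    have hβ : m.β = m'.β := by
      rw [← Finset.erase_insert (a := m.n) (s := m.β) fun h => lt_irrefl _ (m.hβ _ h), h3, hn,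
        Finset.erase_insert fun h => lt_irrefl _ (m'.hβ _ h)]
    have : m = m' := Mono.ext hn h1 hβ
    subst this
    rfl

/-- The length of a monomial is the largest index among its pivot letters, so splitting off the
maximum identifies nonempty exponents with monomials. The rest is `Mono.admissible_iff`. -/
theorem range_exponents : Set.range exponents = {w | StdPair w} := by
  ext ⟨a, γ⟩
  constructor
  · rintro ⟨o, ho⟩
    rw [← ho]
    cases o with
    | none => exact ⟨fun _ => ∅, by simp [exponents], fun j hj => by simp [exponents] at hj, rfl⟩
    | some m => exact (Mono.admissible_iff m.1).mp m.2
  · rintro ⟨s, hs, hsp, e⟩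
    simp only at hs hsp e
    rcases γ.eq_empty_or_nonempty with rfl | hne
    · exact ⟨none, by rw [e]; rfl⟩
    · have hins : insert (γ.max' hne) (γ.erase (γ.max' hne)) = γ :=
        Finset.insert_erase (γ.max'_mem hne)
      let m : Mono :=
        { n := γ.max' hne
          α := a
          β := γ.erase (γ.max' hne)
          hα := fun i hi => by
            rw [e] at hi
            obtain ⟨j, hj, hi⟩ := Finset.mem_biUnion.mp hi
            have := (hs j hj).add_two_le i hi
            have := γ.le_max' j hj
            omega
          hβ := fun j hj => γ.lt_max'_of_mem_erase_max' hne hj }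
      refine ⟨some ⟨m, (Mono.admissible_iff m).mpr ⟨s, ?_⟩⟩, Prod.ext rfl hins⟩
      change (∀ j ∈ insert (γ.max' hne) (γ.erase (γ.max' hne)), _) ∧
        (∀ j ∈ insert (γ.max' hne) (γ.erase (γ.max' hne)),
          ∀ k ∈ insert (γ.max' hne) (γ.erase (γ.max' hne)), _) ∧
        a = (insert (γ.max' hne) (γ.erase (γ.max' hne))).biUnion s
      rw [hins]
      exact ⟨hs, hsp, e⟩

/-- The generation of standard monomials by brackets gives one inclusion. For the other, the union
of the directed filtration is multiplicatively closed and contains the generators. -/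
theorem iSup_filt (h2 : (2 : K) ≠ 0) : iSup (filt K) = Subalgebra.toSubmodule (hull K) := by
  have hone : ∀ m, (1 : Module.End K (Lam K)) ∈ filt K m := fun m =>
    filt_mono K (Nat.zero_le m) (one_mem_filt K)
  refine le_antisymm (iSup_le fun m => Submodule.span_le.mpr ?_) fun a ha => ?_
  · rintro _ ⟨l, -, hl, rfl⟩
    refine (hull K).list_prod_mem fun a ha => ?_
    obtain ⟨w, hw, rfl⟩ := List.mem_map.mp ha
    exact aMon_mem_hull h2 (hl w hw)
  · have hdir : Directed (· ≤ ·) (filt K) := Monotone.directed_le fun _ _ h => filt_mono K h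
    have hv : ∀ i, pivot K i ∈ iSup (filt K) := fun i => by
      refine Submodule.mem_iSup_of_mem 1 ?_
      have := wMon_fst_mem (K := K) (w := (i, ∅)) (standard_empty i)
      change aMon K (i, ∅) ∈ _ at this
      rwa [aMon_eq, stdMon, ordProd_empty, one_mul] at this
    induction ha using Algebra.adjoin_induction with
    | mem x hx =>
      rcases hx with rfl | rfl | rfl
      · exact hv 0
      · exact hv 1
      · exact hv 2
    | algebraMap r =>
      rw [Algebra.algebraMap_eq_smul_one]
      exact Submodule.smul_mem _ _ (Submodule.mem_iSup_of_mem 0 (hone 0))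
    | add x y _ _ hx hy => exact Submodule.add_mem _ hx hy
    | mul x y _ _ hx hy =>
      obtain ⟨m, hm⟩ := (Submodule.mem_iSup_of_directed _ hdir).mp hx
      obtain ⟨n, hn⟩ := (Submodule.mem_iSup_of_directed _ hdir).mp hy
      exact Submodule.mem_iSup_of_mem (m + n) (filt_mul K hm hn)

theorem isBasisOf_hull (h2 : (2 : K) ≠ 0) :
    IsBasisOf K (basisFamily (xOp K) (pivot K)) (Subalgebra.toSubmodule (hull K)) := by
  have e : basisFamily (xOp K) (pivot K) = (fun w => (eMon K w).1) ∘ exponents :=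
    funext fun o => (basisFamily_eq _ _ o).trans (eMon_fst K _).symm
  rw [e]
  refine ⟨linearIndependent_eMon_fst.comp _ exponents_injective, ?_⟩
  rw [Set.range_comp, range_exponents, ← iSup_filt h2]
  refine le_antisymm (Submodule.span_le.mpr ?_) (iSup_le fun m => ?_)
  · rintro _ ⟨w, hw, rfl⟩
    refine Submodule.mem_iSup_of_mem w.2.card ?_
    rw [← map_fst_symSpan]
    exact ⟨_, eMon_mem_symSpan hw, rfl⟩
  · rw [filt_eq_span h2]
    exact Submodule.span_mono (Set.image_mono fun w hw => hw.1)

theorem filt_eq_decr_sup (h2 : (2 : K) ≠ 0) {m : ℕ} (hm : 1 ≤ m) :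
    filt K m = decr K m ⊔ filt K (m - 1) := by
  refine le_antisymm ?_ (sup_le (Submodule.span_mono ?_) (filt_mono K (by omega)))
  · rw [← map_fst_symSpan]
    have h1 := listSpan_le_sortedSpan h2 (r := (· > ·)) (fun i j k h h' => lt_trans h' h)
      (fun i j => by omega) m
    refine (Submodule.map_mono (sup_le h1 le_sup_right)).trans ?_
    rw [Submodule.map_sup, map_fst_low, filtPred, if_neg (by omega)]
    refine sup_le_sup_right ?_ _
    rw [sortedSpan, Submodule.map_span]
    refine Submodule.span_mono ?_
    rintro _ ⟨_, ⟨l, hl, hlm, hs, -, rfl⟩, rfl⟩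
    exact ⟨l, hlm, hl, hs, wProd_fst K l⟩
  · rintro _ ⟨l, hl, hs, -, rfl⟩
    exact ⟨l, hl.le, hs, rfl⟩

end Bases

/-! ### The brackets of products of standard monomials -/

section Brackets

variable {K : Type*} [Field K]

/-- The parity of a product of standard monomials. -/
def lPar (l : List (ℕ × Finset ℕ)) : ZMod 2 := (l.map wPar).sum

theorem lPar_nil : lPar [] = 0 := rfl

theorem lPar_cons (w : ℕ × Finset ℕ) (l : List (ℕ × Finset ℕ)) :
    lPar (w :: l) = wPar w + lPar l := by
  rw [lPar, List.map_cons, List.sum_cons, lPar]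

theorem wProd_mem_ePar {l : List (ℕ × Finset ℕ)} (hl : AllStd l) : wProd K l ∈ ePar K (lPar l) := by
  induction l with
  | nil => exact superBr_pairs.one_mem
  | cons w l ih =>
    rw [wProd_cons, lPar_cons]
    exact superBr_pairs.mul_mem _ _ _ _ (wMon_mem_ePar hl.of_cons.1) (ih hl.of_cons.2)

theorem eBr_wMon_wProd (h2 : (2 : K) ≠ 0) {w : ℕ × Finset ℕ} {l : List (ℕ × Finset ℕ)}
    (hw : Standard w.1 w.2) (hl : AllStd l) :
    eBr K (wPar w) (lPar l) (wMon K w) (wProd K l) ∈ listSpan K l.length := by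
  induction l with
  | nil =>
    rw [lPar_nil, wProd_nil, superBr_pairs.one_right (wMon_mem_ePar hw)]
    exact Submodule.zero_mem _
  | cons w' l ih =>
    obtain ⟨hw', hl'⟩ := hl.of_cons
    rw [wProd_cons, lPar_cons, superBr_pairs.leib_right (wMon_mem_ePar hw) (wMon_mem_ePar hw')
      (wProd_mem_ePar hl'), List.length_cons]
    have h1 : wMon K w' ∈ listSpan K 1 := by
      have := wProd_mem_listSpan (K := K) (l := [w']) (by simpa [AllStd] using hw')
      rwa [wProd_cons, wProd_nil, mul_one] at this
    have h3 := eBr_wMon_mem h2 hw hw'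
    rw [listSpan_one] at h3
    rw [add_comm l.length]
    exact Submodule.add_mem _ (listSpan_mul h3 (wProd_mem_listSpan hl'))
      (Submodule.smul_mem _ _ (listSpan_mul h1 (ih hl')))

/-- The Leibniz rule in both arguments reduces to brackets of two standard monomials, which are
combinations of single ones. Here `filtPred` only lowers the index by one, with zero if both lists
are empty; `listSpan` is not an increasing family. -/
theorem eBr_wProd (h2 : (2 : K) ≠ 0) {l l' : List (ℕ × Finset ℕ)} (hl : AllStd l)
    (hl' : AllStd l') : eBr K (lPar l) (lPar l') (wProd K l) (wProd K l') ∈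
      filtPred (listSpan K) (l.length + l'.length) := by
  induction l with
  | nil =>
    rw [lPar_nil, wProd_nil, superBr_pairs.one_left (wProd_mem_ePar hl')]
    exact Submodule.zero_mem _
  | cons w l ih =>
    obtain ⟨hw, hl⟩ := hl.of_cons
    have ih := ih hl
    rw [wProd_cons, lPar_cons, superBr_pairs.leib _ _ _ _ _ _ (wMon_mem_ePar hw)
      (wProd_mem_ePar hl) (wProd_mem_ePar hl'), List.length_cons]
    refine Submodule.add_mem _ ?_ (Submodule.smul_mem _ _ ?_)
    · have h1 : wMon K w ∈ listSpan K 1 := by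
        have := wProd_mem_listSpan (K := K) (l := [w]) (by simpa [AllStd] using hw)
        rwa [wProd_cons, wProd_nil, mul_one] at this
      have := filtPred_mul_right (listSpan K) (fun _ _ _ _ => listSpan_mul) h1 ih
      rwa [show 1 + (l.length + l'.length) = l.length + 1 + l'.length by omega] at this
    · rw [filtPred, if_neg (by omega),
        show l.length + 1 + l'.length - 1 = l'.length + l.length by omega]
      exact listSpan_mul (eBr_wMon_wProd h2 hw hl') (wProd_mem_listSpan hl)

/-- Homogeneous components: if `A ≤ B 0 ⊔ B 1`, where `B i ≤ C i` and `C 0`, `C 1` are disjoint,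
then the part of `A` in `C i` lies in `B i`. -/
theorem inf_le_of_le_sup {E : Type*} [AddCommGroup E] [Module K E] {A : Submodule K E}
    {B C : ZMod 2 → Submodule K E} (hA : A ≤ B 0 ⊔ B 1) (hBC : ∀ i, B i ≤ C i)
    (hC : C 0 ⊓ C 1 = ⊥) (i : ZMod 2) : A ⊓ C i ≤ B i := by
  rintro a ⟨ha, hi⟩
  obtain ⟨b, hb, c, hc, rfl⟩ := Submodule.mem_sup.mp (hA ha)
  rcases zmod_two_cases i with rfl | rfl
  · have h : c ∈ C 0 ⊓ C 1 := ⟨by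
      have := Submodule.sub_mem _ hi (hBC 0 hb)
      rwa [add_sub_cancel_left] at this, hBC 1 hc⟩
    rw [hC] at h
    rwa [(Submodule.mem_bot K).mp h, add_zero]
  · have h : b ∈ C 0 ⊓ C 1 := ⟨hBC 0 hb, by
      have := Submodule.sub_mem _ hi (hBC 1 hc)
      rwa [add_sub_cancel_right] at this⟩
    rw [hC] at h
    rwa [(Submodule.mem_bot K).mp h, zero_add]

theorem endPar_inf : endPar K 0 ⊓ endPar K 1 = ⊥ := by
  refine le_bot_iff.mp fun φ hφ => ?_
  have hc := CliffordAlgebra.evenOdd_isCompl (0 : QuadraticForm K (ℕ →₀ K))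
  have hpar : ∀ j, ∀ f ∈ lamPar K j, φ f = 0 := fun j f hf => by
    have h0 := hφ.1 j f hf
    have h1 := hφ.2 j f hf
    rw [zero_add] at h0
    rcases zmod_two_cases j with rfl | rfl
    · exact Submodule.disjoint_def.mp hc.disjoint _ h0 h1
    · exact Submodule.disjoint_def.mp hc.disjoint _ h1 h0
  refine LinearMap.ext fun f => ?_
  have hf : f ∈ lamPar K 0 ⊔ lamPar K 1 := hc.sup_eq_top.ge (x := f) trivial
  obtain ⟨a, ha, b, hb, rfl⟩ := Submodule.mem_sup.mp hf
  rw [map_add, hpar 0 a ha, hpar 1 b hb]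
  exact add_zero _

theorem serPar_inf : serPar K 0 ⊓ serPar K 1 = ⊥ := by
  refine le_bot_iff.mp fun f hf => Ser.ext fun a => ?_
  by_contra h
  have := (hf.1 a h).symm.trans (hf.2 a h)
  exact absurd this (by decide)

/-- The span of the at most `n`-fold products of standard monomials of parity `p`. -/
def filtHom (K : Type*) [Field K] (n : ℕ) (p : ZMod 2) : Submodule K (Module.End K (Lam K)) :=
  Submodule.span K {a | ∃ l, AllStd l ∧ l.length ≤ n ∧ lPar l = p ∧ a = (wProd K l).1}

theorem filtHom_le (n : ℕ) (p : ZMod 2) : filtHom K n p ≤ filt K n ⊓ endPar K p := by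
  refine Submodule.span_le.mpr ?_
  rintro _ ⟨l, hl, hn, rfl, rfl⟩
  exact ⟨Submodule.subset_span ⟨l, hn, hl, wProd_fst K l⟩, (wProd_mem_ePar hl).1⟩

theorem filt_le_filtHom (n : ℕ) : filt K n ≤ filtHom K n 0 ⊔ filtHom K n 1 := by
  refine Submodule.span_le.mpr ?_
  rintro _ ⟨l, hn, hl, rfl⟩
  rcases zmod_two_cases (lPar l) with h | h
  · exact Submodule.mem_sup_left (Submodule.subset_span ⟨l, hl, hn, h, (wProd_fst K l).symm⟩)
  · exact Submodule.mem_sup_right (Submodule.subset_span ⟨l, hl, hn, h, (wProd_fst K l).symm⟩)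

/-- Products of standard monomials are homogeneous, so the filtration is compatible with parity, and
homogeneous elements are combinations of products of their own parity. -/
theorem filtHom_eq (n : ℕ) (p : ZMod 2) : filtHom K n p = filt K n ⊓ endPar K p :=
  le_antisymm (filtHom_le n p) (inf_le_of_le_sup (B := filtHom K n) (filt_le_filtHom n)
    (fun i => (filtHom_le n i).trans inf_le_right) endPar_inf p)

/-- The supercommutator lowers the degree. -/
theorem scomm_mem_filtPred (h2 : (2 : K) ≠ 0) {n m : ℕ} {p q : ZMod 2}
    {a b : Module.End K (Lam K)} (ha : a ∈ filt K n) (hb : b ∈ filt K m) (hap : a ∈ endPar K p)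
    (hbq : b ∈ endPar K q) : scomm K p q a b ∈ filtPred (filt K) (n + m) := by
  have ha' : a ∈ filtHom K n p := filtHom_eq (K := K) n p ▸ ⟨ha, hap⟩
  have hb' : b ∈ filtHom K m q := filtHom_eq (K := K) m q ▸ ⟨hb, hbq⟩
  rw [← scommB_apply]
  refine Submodule.span_induction₂ (s := {a | ∃ l, AllStd l ∧ l.length ≤ n ∧ lPar l = p ∧
    a = (wProd K l).1}) (t := {a | ∃ l, AllStd l ∧ l.length ≤ m ∧ lPar l = q ∧
    a = (wProd K l).1}) (p := fun a b _ _ => scommB K p q a b ∈ filtPred (filt K) (n + m))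
    ?_ ?_ ?_ ?_ ?_ ?_ ?_ ha' hb'
  · rintro _ _ ⟨l, hl, hn, rfl, rfl⟩ ⟨l', hl', hm, rfl, rfl⟩
    have h := eBr_wProd h2 hl hl'
    unfold filtPred at h ⊢
    split_ifs at h with h0
    · have h3 : scommB K (lPar l) (lPar l') (wProd K l).1 (wProd K l').1 = 0 :=
        (Prod.ext_iff.mp ((Submodule.mem_bot K).mp h)).1
      rw [h3]
      exact Submodule.zero_mem _
    · rw [if_neg (by omega)]
      have h3 := fst_mem_filt h
      exact filt_mono K (by omega) h3
  · intro b _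
    rw [map_zero, LinearMap.zero_apply]
    exact Submodule.zero_mem _
  · intro a _
    rw [map_zero]
    exact Submodule.zero_mem _
  · intro a a' b _ _ _ h h'
    rw [map_add, LinearMap.add_apply]
    exact Submodule.add_mem _ h h'
  · intro a b b' _ _ _ h h'
    rw [map_add]
    exact Submodule.add_mem _ h h'
  · intro c a b _ _ h
    rw [map_smul, LinearMap.smul_apply]
    exact Submodule.smul_mem _ _ h
  · intro c a b _ _ h
    rw [map_smul]
    exact Submodule.smul_mem _ _ h

theorem scomm_mem_filt (h2 : (2 : K) ≠ 0) (n m : ℕ) (p q : ZMod 2)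
    (a b : Module.End K (Lam K)) (ha : a ∈ filt K n) (hb : b ∈ filt K m) (hap : a ∈ endPar K p)
    (hbq : b ∈ endPar K q) : scomm K p q a b ∈ filt K (n + m - 1) := by
  have h := scomm_mem_filtPred h2 ha hb hap hbq
  unfold filtPred at h
  split_ifs at h with h0
  · rw [(Submodule.mem_bot K).mp h]
    exact Submodule.zero_mem _
  · exact h

/-- The span of the pairs of `n`-fold products of standard monomials of parity `p`. -/
def listHom (K : Type*) [Field K] (n : ℕ) (p : ZMod 2) : Submodule K (Pairs K) :=
  Submodule.span K {z | ∃ l, AllStd l ∧ l.length = n ∧ lPar l = p ∧ z = wProd K l}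

/-- The pairs of an element of the filtration and its symbol, both of parity `p`. -/
def symHom (K : Type*) [Field K] (n : ℕ) (p : ZMod 2) : Submodule K (Pairs K) :=
  listHom K n p ⊔ (filtPred (filt K) n ⊓ endPar K p).prod ⊥

theorem listHom_le (n : ℕ) (p : ZMod 2) : listHom K n p ≤ listSpan K n ⊓ ePar K p := by
  refine Submodule.span_le.mpr ?_
  rintro _ ⟨l, hl, rfl, rfl, rfl⟩
  exact ⟨wProd_mem_listSpan hl, wProd_mem_ePar hl⟩

theorem symHom_le (n : ℕ) (p : ZMod 2) : symHom K n p ≤ symSpan K n ⊓ ePar K p := by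
  refine sup_le ((listHom_le n p).trans (inf_le_inf_right _ le_sup_left)) fun z hz => ?_
  refine ⟨Submodule.mem_sup_right ⟨hz.1.1, hz.2⟩, hz.1.2, ?_⟩
  rw [(Submodule.mem_bot K).mp hz.2]
  exact Submodule.zero_mem _

theorem symSpan_le_symHom (n : ℕ) : symSpan K n ≤ symHom K n 0 ⊔ symHom K n 1 := by
  refine sup_le (Submodule.span_le.mpr ?_) fun z hz => ?_
  · rintro _ ⟨l, hl, rfl, rfl⟩
    rcases zmod_two_cases (lPar l) with h | h
    · exact Submodule.mem_sup_left (Submodule.mem_sup_left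
        (Submodule.subset_span ⟨l, hl, rfl, h, rfl⟩))
    · exact Submodule.mem_sup_right (Submodule.mem_sup_left
        (Submodule.subset_span ⟨l, hl, rfl, h, rfl⟩))
  · have h : z.1 ∈ (filtPred (filt K) n ⊓ endPar K 0) ⊔ (filtPred (filt K) n ⊓ endPar K 1) := by
      have := hz.1
      unfold filtPred at this ⊢
      split_ifs at this ⊢ with h0
      · rw [(Submodule.mem_bot K).mp this]
        exact Submodule.zero_mem _
      · rw [← filtHom_eq, ← filtHom_eq]
        exact filt_le_filtHom _ this
    obtain ⟨a, ha, b, hb, e⟩ := Submodule.mem_sup.mp h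
    refine Submodule.mem_sup.mpr ⟨(a, 0), Submodule.mem_sup_right ⟨ha, Submodule.zero_mem _⟩,
      (b, 0), Submodule.mem_sup_right ⟨hb, Submodule.zero_mem _⟩, ?_⟩
    refine Prod.ext e ?_
    rw [(Submodule.mem_bot K).mp hz.2]
    exact add_zero 0

theorem ePar_inf : ePar K 0 ⊓ ePar K 1 = ⊥ := by
  refine le_bot_iff.mp fun z hz => ?_
  have h1 : z.1 ∈ endPar K 0 ⊓ endPar K 1 := ⟨hz.1.1, hz.2.1⟩
  have h3 : z.2 ∈ serPar K 0 ⊓ serPar K 1 := ⟨hz.1.2.1, hz.2.2.1⟩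
  rw [endPar_inf] at h1
  rw [serPar_inf] at h3
  exact Prod.ext ((Submodule.mem_bot K).mp h1) ((Submodule.mem_bot K).mp h3)

theorem symHom_eq (n : ℕ) (p : ZMod 2) : symHom K n p = symSpan K n ⊓ ePar K p :=
  le_antisymm (symHom_le n p) (inf_le_of_le_sup (B := symHom K n) (symSpan_le_symHom n)
    (fun i => (symHom_le n i).trans inf_le_right) ePar_inf p)

/-- Every homogeneous element of the filtration has a symbol of the same parity. -/
theorem exists_symHom {n : ℕ} {p : ZMod 2} {a : Module.End K (Lam K)} (ha : a ∈ filt K n)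
    (hp : a ∈ endPar K p) : ∃ z ∈ symHom K n p, z.1 = a := by
  have hle : ∀ i, (symHom K n i).map (LinearMap.fst K _ _) ≤ endPar K i := fun i => by
    rintro _ ⟨z, hz, rfl⟩
    exact (symHom_le n i hz).2.1
  have hA : filt K n ≤ (symHom K n 0).map (LinearMap.fst K _ _) ⊔
      (symHom K n 1).map (LinearMap.fst K _ _) := by
    rw [← Submodule.map_sup, ← map_fst_symSpan]
    exact Submodule.map_mono (symSpan_le_symHom n)
  exact inf_le_of_le_sup (B := fun i => (symHom K n i).map (LinearMap.fst K _ _)) hA hle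
    endPar_inf p ⟨ha, hp⟩

theorem serBr_mem_serPar {i j : ZMod 2} {f g : Ser K} (hf : f ∈ serPar K i ⊓ hTilde K)
    (hg : g ∈ serPar K j ⊓ hTilde K) : serBr K f g ∈ serPar K (i + j) := by
  intro a h
  have hterm : ∀ n, brTerm K n f g ∈ serPar K (i + j) := fun n => by
    have e : i + j = i + 1 + (j + 1) := by
      rw [add_add_add_comm, CharTwo.add_self_eq_zero, add_zero]
    rw [brTerm_eq hf.1, e]
    refine Submodule.neg_mem _ (Submodule.smul_mem _ _ (Submodule.add_mem _ ?_ ?_))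
    · exact mul_mem_serPar ((isPartial_dx n).mem_serPar (isLetter_x n) hf.1)
        ((isPartial_dy n).mem_serPar (isLetter_y n) hg.1)
    · exact mul_mem_serPar ((isPartial_dy n).mem_serPar (isLetter_y n) hf.1)
        ((isPartial_dx n).mem_serPar (isLetter_x n) hg.1)
  rw [serBr_apply hf.2 hg.2 (Nat.lt_succ_self _)] at h
  have hN : brN K (a.2.sup id + 1) f g ∈ serPar K (i + j) := by
    rw [brN_apply]
    exact Submodule.sum_mem _ fun n _ => hterm n
  exact hN a h

theorem eBr_mem_ePar {i j : ZMod 2} {a b : Pairs K} (ha : a ∈ ePar K i) (hb : b ∈ ePar K j) :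
    eBr K i j a b ∈ ePar K (i + j) := by
  refine ⟨?_, serBr_mem_serPar ha.2 hb.2, serBr_mem K ha.2.2 hb.2.2⟩
  refine Submodule.sub_mem _ (mul_mem_endPar K ha.1 hb.1) (Submodule.smul_mem _ _ ?_)
  rw [add_comm]
  exact mul_mem_endPar K hb.1 ha.1

/-- Brackets of list products are covered by `eBr_wProd`. If one argument has symbol zero and lower
filtration degree, the Poisson component vanishes and the supercommutator drops once more, into the
lower part. -/
theorem eBr_mem_filtPred_symSpan (h2 : (2 : K) ≠ 0) {n m : ℕ} {p q : ZMod 2} {z w : Pairs K}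
    (hz : z ∈ symHom K n p) (hw : w ∈ symHom K m q) :
    eBr K p q z w ∈ filtPred (symSpan K) (n + m) := by
  have hlow : ∀ {a b : Pairs K}, a.1 ∈ filtPred (filt K) n ⊓ endPar K p ∧ a.2 = 0 →
      b.1 ∈ filt K m ⊓ endPar K q → eBr K p q a b ∈ filtPred (symSpan K) (n + m) := by
    rintro ⟨a, _⟩ b ⟨⟨ha, hap⟩, h0 : _ = 0⟩ ⟨hb, hbq⟩
    subst h0
    unfold filtPred at ha
    split_ifs at ha with hn
    · obtain rfl : a = 0 := (Submodule.mem_bot K).mp ha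
      have : eBr K p q (0, 0) b = 0 := by
        change eBr K p q 0 b = 0
        rw [map_zero, LinearMap.zero_apply]
      rw [this]
      exact Submodule.zero_mem _
    · rw [filtPred, if_neg (by omega)]
      refine Submodule.mem_sup_right (mem_low.mpr ⟨?_, ?_⟩)
      · have := scomm_mem_filtPred h2 ha hb hap hbq
        rwa [show n - 1 + m = n + m - 1 by omega] at this
      · change serBr K 0 b.2 = 0
        rw [map_zero, LinearMap.zero_apply]
  have hlow' : ∀ {a b : Pairs K}, a.1 ∈ filt K n ⊓ endPar K p →
      b.1 ∈ filtPred (filt K) m ⊓ endPar K q ∧ b.2 = 0 →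
      eBr K p q a b ∈ filtPred (symSpan K) (n + m) := by
    rintro a ⟨b, _⟩ ⟨ha, hap⟩ ⟨⟨hb, hbq⟩, h0 : _ = 0⟩
    subst h0
    unfold filtPred at hb
    split_ifs at hb with hn
    · obtain rfl : b = 0 := (Submodule.mem_bot K).mp hb
      have : eBr K p q a (0, 0) = 0 := by
        change eBr K p q a 0 = 0
        rw [map_zero]
      rw [this]
      exact Submodule.zero_mem _
    · rw [filtPred, if_neg (by omega)]
      refine Submodule.mem_sup_right (mem_low.mpr ⟨?_, ?_⟩)
      · have := scomm_mem_filtPred h2 ha hb hap hbq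
        rwa [show n + (m - 1) = n + m - 1 by omega] at this
      · change serBr K a.2 0 = 0
        rw [map_zero]
  have hfst : ∀ {k i} {a : Pairs K}, a ∈ symHom K k i → a.1 ∈ filt K k ⊓ endPar K i := by
    intro k i a ha
    refine ⟨?_, (symHom_le k i ha).2.1⟩
    rw [← map_fst_symSpan]
    exact ⟨a, (symHom_le k i ha).1, rfl⟩
  obtain ⟨z', hz', z'', hz'', rfl⟩ := Submodule.mem_sup.mp hz
  obtain ⟨w', hw', w'', hw'', rfl⟩ := Submodule.mem_sup.mp hw
  have e : eBr K p q (z' + z'') (w' + w'') =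
      eBr K p q z' w' + eBr K p q z' w'' + eBr K p q z'' (w' + w'') := by
    rw [map_add (eBr K p q), LinearMap.add_apply, map_add (eBr K p q z')]
  rw [e]
  refine Submodule.add_mem _ (Submodule.add_mem _ ?_ ?_) (hlow hz'' (hfst hw))
  · refine Submodule.span_induction₂ (p := fun a b _ _ => eBr K p q a b ∈
      filtPred (symSpan K) (n + m)) ?_ ?_ ?_ ?_ ?_ ?_ ?_ hz' hw'
    · rintro _ _ ⟨l, hl, rfl, rfl, rfl⟩ ⟨l', hl', rfl, rfl, rfl⟩
      have h := eBr_wProd h2 hl hl'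
      unfold filtPred at h ⊢
      split_ifs at h ⊢ with h0
      · exact h
      · exact Submodule.mem_sup_left h
    · intro b _
      rw [map_zero, LinearMap.zero_apply]
      exact Submodule.zero_mem _
    · intro a _
      rw [map_zero]
      exact Submodule.zero_mem _
    · intro a a' b _ _ _ h h'
      rw [map_add, LinearMap.add_apply]
      exact Submodule.add_mem _ h h'
    · intro a b b' _ _ _ h h'
      rw [map_add]
      exact Submodule.add_mem _ h h'
    · intro c a b _ _ h
      rw [map_smul, LinearMap.smul_apply]
      exact Submodule.smul_mem _ _ h
    · intro c a b _ _ h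
      rw [map_smul]
      exact Submodule.smul_mem _ _ h
  · exact hlow' (hfst (Submodule.mem_sup_left hz')) hw''

/-- The bracket lowers the degree and adds the parities. -/
theorem eBr_mem_filtPred (h2 : (2 : K) ≠ 0) {n m : ℕ} {p q : ZMod 2} {z w : Pairs K}
    (hz : z ∈ symHom K n p) (hw : w ∈ symHom K m q) :
    eBr K p q z w ∈ filtPred (fun k => symHom K k (p + q)) (n + m) := by
  have h := eBr_mem_filtPred_symSpan h2 hz hw
  have h' := eBr_mem_ePar (symHom_le n p hz).2 (symHom_le m q hw).2
  unfold filtPred at h ⊢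
  split_ifs at h ⊢ with h0
  · exact h
  · exact (symHom_eq (K := K) _ _).ge ⟨h, h'⟩

end Brackets

/-! ### The Poisson superalgebra -/

section Poisson

variable {K : Type*} [Field K]

/-- The sum of the pieces contains the generators and is closed under products and, by `eBr_wProd`,
under brackets; the standard monomials themselves lie in the generated subalgebra. -/
theorem iSup_pPiece (h2 : (2 : K) ≠ 0) : iSup (pPiece K) = poisson K := by
  refine le_antisymm (iSup_le fun m => Submodule.span_le.mpr ?_) (sInf_le ?_)
  · rintro _ ⟨l, -, hl, rfl⟩
    induction l with
    | nil => exact (poisson_closed K).1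
    | cons w l ih =>
      rw [List.map_cons, List.prod_cons]
      exact ((poisson_closed K).2.2.2.2 _ (pMon_mem_poisson h2 (hl w List.mem_cons_self)) _
        (ih fun w' h => hl w' (List.mem_cons_of_mem _ h))).1
  · have hprod : ∀ l, AllStd l → (wProd K l).2 ∈ iSup (pPiece K) := fun l hl =>
      Submodule.mem_iSup_of_mem l.length (Submodule.subset_span ⟨l, rfl, hl, wProd_snd K l⟩)
    have hV : ∀ i, serV K i ∈ iSup (pPiece K) := fun i => by
      have := hprod [(i, ∅)] (by simpa [AllStd] using standard_empty i)
      rw [wProd_snd, List.map_singleton, List.prod_singleton, pMon_eq, stdMon, ordProd_empty,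
        one_mul] at this
      exact this
    have hspan : iSup (pPiece K) = Submodule.span K {f | ∃ l, AllStd l ∧ f = (wProd K l).2} := by
      refine le_antisymm (iSup_le fun m => Submodule.span_mono ?_) (Submodule.span_le.mpr ?_)
      · rintro _ ⟨l, -, hl, rfl⟩
        exact ⟨l, hl, (wProd_snd K l).symm⟩
      · rintro _ ⟨l, hl, rfl⟩
        exact hprod l hl
    refine ⟨hprod [] (by simp [AllStd]), hV 0, hV 1, hV 2, fun f hf g hg => ?_⟩
    rw [hspan] at hf hg
    refine Submodule.span_induction₂ (p := fun f g _ _ => serMul K f g ∈ iSup (pPiece K) ∧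
      serBr K f g ∈ iSup (pPiece K)) ?_ ?_ ?_ ?_ ?_ ?_ ?_ hf hg
    · rintro _ _ ⟨l, hl, rfl⟩ ⟨l', hl', rfl⟩
      constructor
      · have := hprod (l ++ l') fun w hw => (List.mem_append.mp hw).elim (hl w) (hl' w)
        rwa [wProd_append] at this
      · have h := eBr_wProd (K := K) h2 hl hl'
        unfold filtPred at h
        split_ifs at h
        · have h0 : serBr K (wProd K l).2 (wProd K l').2 = 0 :=
            (Prod.ext_iff.mp ((Submodule.mem_bot K).mp h)).2
          rw [h0]
          exact Submodule.zero_mem _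
        · refine Submodule.mem_iSup_of_mem (l.length + l'.length - 1) ?_
          rw [← map_snd_listSpan]
          exact ⟨_, h, rfl⟩
    · intro b _
      simp only [map_zero, LinearMap.zero_apply]
      exact ⟨Submodule.zero_mem _, Submodule.zero_mem _⟩
    · intro a _
      simp only [map_zero]
      exact ⟨Submodule.zero_mem _, Submodule.zero_mem _⟩
    · intro a a' b _ _ _ h h'
      simp only [map_add, LinearMap.add_apply]
      exact ⟨Submodule.add_mem _ h.1 h'.1, Submodule.add_mem _ h.2 h'.2⟩
    · intro a b b' _ _ _ h h'
      simp only [map_add]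
      exact ⟨Submodule.add_mem _ h.1 h'.1, Submodule.add_mem _ h.2 h'.2⟩
    · intro c a b _ _ h
      simp only [map_smul, LinearMap.smul_apply]
      exact ⟨Submodule.smul_mem _ _ h.1, Submodule.smul_mem _ _ h.2⟩
    · intro c a b _ _ h
      simp only [map_smul]
      exact ⟨Submodule.smul_mem _ _ h.1, Submodule.smul_mem _ _ h.2⟩

theorem isBasisOf_poisson (h2 : (2 : K) ≠ 0) :
    IsBasisOf K (basisFamily (serX K) (serV K)) (poisson K) := by
  have e : basisFamily (serX K) (serV K) = (fun w => (eMon K w).2) ∘ exponents :=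
    funext fun o => (basisFamily_eq _ _ o).trans (eMon_snd K _).symm
  rw [e]
  refine ⟨linearIndependent_eMon_snd.comp _ exponents_injective, ?_⟩
  rw [Set.range_comp, range_exponents, ← iSup_pPiece h2]
  refine le_antisymm (Submodule.span_le.mpr ?_) (iSup_le fun m => ?_)
  · rintro _ ⟨w, hw, rfl⟩
    refine Submodule.mem_iSup_of_mem w.2.card ?_
    rw [← map_snd_symSpan]
    exact ⟨_, eMon_mem_symSpan hw, rfl⟩
  · rw [pPiece_eq_span h2]
    exact Submodule.span_mono (Set.image_mono fun w hw => hw.1)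

/-- The span of the products of standard monomials of parity `p`. -/
def poissonHom (K : Type*) [Field K] (p : ZMod 2) : Submodule K (Ser K) :=
  Submodule.span K {f | ∃ n, ∃ z ∈ symHom K n p, f = z.2}

theorem poissonHom_le (h2 : (2 : K) ≠ 0) (p : ZMod 2) :
    poissonHom K p ≤ poisson K ⊓ serPar K p := by
  refine Submodule.span_le.mpr ?_
  rintro _ ⟨n, z, hz, rfl⟩
  refine ⟨?_, (symHom_le n p hz).2.2.1⟩
  rw [← iSup_pPiece h2]
  refine Submodule.mem_iSup_of_mem n ?_
  rw [← map_snd_symSpan]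
  exact ⟨z, (symHom_le n p hz).1, rfl⟩

theorem poisson_le_poissonHom (h2 : (2 : K) ≠ 0) :
    poisson K ≤ poissonHom K 0 ⊔ poissonHom K 1 := by
  rw [← iSup_pPiece h2]
  refine iSup_le fun m => ?_
  rw [← map_snd_symSpan]
  refine (Submodule.map_mono (symSpan_le_symHom m)).trans ?_
  rw [Submodule.map_sup]
  refine sup_le_sup ?_ ?_ <;>
  · rintro _ ⟨z, hz, rfl⟩
    exact Submodule.subset_span ⟨m, z, hz, rfl⟩

theorem poissonHom_eq (h2 : (2 : K) ≠ 0) (p : ZMod 2) :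
    poissonHom K p = poisson K ⊓ serPar K p :=
  le_antisymm (poissonHom_le h2 p) (inf_le_of_le_sup (B := poissonHom K)
    (poisson_le_poissonHom h2) (fun i => (poissonHom_le h2 i).trans inf_le_right) serPar_inf p)

/-- An identity for the brackets that holds for the supercommutator holds for the symbols. -/
theorem snd_eq_zero_of_filtPred (h2 : (2 : K) ≠ 0) {n : ℕ} {z : Pairs K}
    (hz : z ∈ filtPred (filtPred (symSpan K)) n) (h : z.1 = 0) : z.2 = 0 := by
  -- The doubled predecessor stands for degree $n-2$, and for zero if $n\le 1$; this is where
  -- twofold brackets land.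
  unfold filtPred at hz
  split_ifs at hz
  · rw [(Submodule.mem_bot K).mp hz]; rfl
  · rw [(Submodule.mem_bot K).mp hz]; rfl
  · exact snd_eq_zero_of_fst h2 hz (h ▸ Submodule.zero_mem _)

theorem eBr_eBr_mem (h2 : (2 : K) ≠ 0) {n m r : ℕ} {i j k : ZMod 2} {a b c : Pairs K}
    (ha : a ∈ symHom K n i) (hb : b ∈ symHom K m j) (hc : c ∈ symHom K r k) :
    eBr K i (j + k) a (eBr K j k b c) ∈ filtPred (filtPred (symSpan K)) (n + m + r) := by
  have h := eBr_mem_filtPred h2 hb hc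
  rw [filtPred] at h
  split_ifs at h with h0
  · rw [(Submodule.mem_bot K).mp h, map_zero]
    exact Submodule.zero_mem _
  · rw [filtPred, if_neg (by omega), show n + m + r - 1 = n + (m + r - 1) by omega]
    exact eBr_mem_filtPred_symSpan h2 ha h

theorem eBr_eBr_mem' (h2 : (2 : K) ≠ 0) {n m r : ℕ} {i j k : ZMod 2} {a b c : Pairs K}
    (ha : a ∈ symHom K n i) (hb : b ∈ symHom K m j) (hc : c ∈ symHom K r k) :
    eBr K (i + j) k (eBr K i j a b) c ∈ filtPred (filtPred (symSpan K)) (n + m + r) := by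
  have h := eBr_mem_filtPred h2 ha hb
  rw [filtPred] at h
  split_ifs at h with h0
  · rw [(Submodule.mem_bot K).mp h, map_zero, LinearMap.zero_apply]
    exact Submodule.zero_mem _
  · rw [filtPred, if_neg (by omega), show n + m + r - 1 = n + m - 1 + r by omega]
    exact eBr_mem_filtPred_symSpan h2 h hc

theorem scomm_jacobi (i j k : ZMod 2) (a b c : Module.End K (Lam K)) :
    scomm K i (j + k) a (scomm K j k b c) = scomm K (i + j) k (scomm K i j a b) c +
      ssign K i j • scomm K j (i + k) b (scomm K i k a c) := by
  have h1 := ssign_mul_self (K := K) i j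
  simp only [scomm, ssign_add_right, ssign_add_left, mul_sub, sub_mul, smul_sub, mul_smul_comm,
    smul_mul_assoc, smul_smul, ← mul_assoc, ssign_comm j i]
  linear_combination (norm := module)
    h1 • (ssign K j k • (a * c * b) - (ssign K j k * ssign K i k) • (c * a * b))

/-- The Jacobi identity. -/
theorem serBr_jacobi (h2 : (2 : K) ≠ 0) {i j k : ZMod 2} {a b c : Ser K}
    (ha : a ∈ poissonHom K i) (hb : b ∈ poissonHom K j) (hc : c ∈ poissonHom K k) :
    serBr K a (serBr K b c) = serBr K (serBr K a b) c +
      ssign K i j • serBr K b (serBr K a c) := by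
  induction ha using Submodule.span_induction with
  | zero => simp only [map_zero, LinearMap.zero_apply, smul_zero, add_zero]
  | add a a' _ _ h h' =>
    simp only [map_add, LinearMap.add_apply, h, h', smul_add]; abel
  | smul r a _ h =>
    simp only [map_smul, LinearMap.smul_apply, h, smul_add]; rw [smul_comm r]
  | mem a ha =>
  induction hb using Submodule.span_induction with
  | zero => simp only [map_zero, LinearMap.zero_apply, smul_zero, add_zero]
  | add b b' _ _ h h' =>
    simp only [map_add, LinearMap.add_apply, h, h', smul_add]; abel
  | smul r b _ h =>
    simp only [map_smul, LinearMap.smul_apply, h, smul_add]; rw [smul_comm r]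
  | mem b hb =>
  induction hc using Submodule.span_induction with
  | zero => simp only [map_zero, smul_zero, add_zero]
  | add c c' _ _ h h' => simp only [map_add, h, h', smul_add]; abel
  | smul r c _ h => simp only [map_smul, h, smul_add]; rw [smul_comm r]
  | mem c hc =>
  obtain ⟨n, a, ha, rfl⟩ := ha
  obtain ⟨m, b, hb, rfl⟩ := hb
  obtain ⟨r, c, hc, rfl⟩ := hc
  have h1 := eBr_eBr_mem h2 ha hb hc
  have h3 := eBr_eBr_mem' h2 ha hb hc
  have h4 := eBr_eBr_mem h2 hb ha hc
  rw [add_comm m n] at h4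
  -- The Jacobi expression of the pairs has operator component zero, as supercommutators satisfy the
  -- identity, and it lies two degrees lower. Hence its symbol is zero.
  have h5 := snd_eq_zero_of_filtPred h2
    (Submodule.sub_mem _ h1 (Submodule.add_mem _ h3 (Submodule.smul_mem _ (ssign K i j) h4)))
    (sub_eq_zero.mpr (scomm_jacobi i j k a.1 b.1 c.1))
  exact sub_eq_zero.mp h5

/-- The Lie axiom needed in characteristic three. -/
theorem serBr_br_self (h2 : (2 : K) ≠ 0) {a : Ser K} (ha : a ∈ poissonHom K 1) :
    serBr K a (serBr K a a) = 0 := by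
  induction ha using Submodule.span_induction with
  | zero => simp only [map_zero]
  | smul r a _ h => simp only [map_smul, LinearMap.smul_apply, h, smul_zero]
  | mem a ha =>
    obtain ⟨n, a, ha, rfl⟩ := ha
    refine snd_eq_zero_of_filtPred h2 (eBr_eBr_mem h2 ha ha ha) ?_
    change scomm K 1 (1 + 1) a.1 (scomm K 1 1 a.1 a.1) = 0
    rw [scomm_one_one, CharTwo.add_self_eq_zero, scomm, ssign_zero_right, one_smul, mul_add,
      add_mul, mul_assoc, sub_self]
  | add a b ha hb h h' =>
    -- Polarisation: the mixed terms of the cubic expression in a sum vanish by the Jacobi identity,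
    -- so the axiom passes from symbols to their span.
    have key : ∀ {a b : Ser K}, a ∈ poissonHom K 1 → b ∈ poissonHom K 1 →
        serBr K b (serBr K a a) + (serBr K a (serBr K a b) + serBr K a (serBr K b a)) = 0 := by
      intro a b ha hb
      have hJ := serBr_jacobi h2 ha ha hb
      rw [ssign_one_one, neg_one_smul] at hJ
      have ha' := poissonHom_le h2 1 ha
      have hb' := poissonHom_le h2 1 hb
      have ha'' : a ∈ serPar K 1 ⊓ hTilde K := ⟨ha'.2, poisson_le_hTilde K ha'.1⟩
      have hb'' : b ∈ serPar K 1 ⊓ hTilde K := ⟨hb'.2, poisson_le_hTilde K hb'.1⟩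
      have haa : serBr K a a ∈ serPar K (1 + 1) ⊓ hTilde K :=
        ⟨serBr_mem_serPar ha'' ha'', serBr_mem K ha''.2 ha''.2⟩
      have e1 := superBr_serBr.anti 1 1 b a hb'' ha''
      rw [ssign_one_one, neg_one_smul, neg_neg] at e1
      have e3 := superBr_serBr.anti 1 (1 + 1) b (serBr K a a) hb'' haa
      rw [CharTwo.add_self_eq_zero, ssign_zero_right, one_smul] at e3
      rw [e1, e3, ← sub_eq_zero.mpr hJ]
      abel
    have h1 := key ha hb
    have h3 := key hb ha
    simp only [map_add, LinearMap.add_apply, h, h']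
    calc _ = (serBr K b (serBr K a a) + (serBr K a (serBr K a b) + serBr K a (serBr K b a))) +
          (serBr K a (serBr K b b) + (serBr K b (serBr K b a) + serBr K b (serBr K a b))) := by abel
      _ = 0 := by rw [h1, h3, add_zero]

theorem mem_pPar {i : ZMod 2} {a : poisson K} : a ∈ pPar K i ↔ a.1 ∈ serPar K i := Iff.rfl

theorem isPoissonSuperalgebra_poisson (h2 : (2 : K) ≠ 0) :
    IsPoissonSuperalgebra (pOne K) (pMul K) (pBr K) (pPar K) := by
  have hT : ∀ {i} {a : poisson K}, a ∈ pPar K i → a.1 ∈ serPar K i ⊓ hTilde K :=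
    fun {i a} ha => ⟨ha, poisson_le_hTilde K a.2⟩
  have hH : ∀ {i} {a : poisson K}, a ∈ pPar K i → a.1 ∈ poissonHom K i := fun {i a} ha => by
    rw [poissonHom_eq h2]
    exact ⟨a.2, ha⟩
  have hsplit : ∀ a : poisson K, ∃ b ∈ pPar K 0, ∃ c ∈ pPar K 1, b + c = a := fun a => by
    obtain ⟨b, hb, c, hc, e⟩ := Submodule.mem_sup.mp (poisson_le_poissonHom h2 a.2)
    have hb := poissonHom_le h2 0 hb
    have hc := poissonHom_le h2 1 hc
    exact ⟨⟨b, hb.1⟩, hb.2, ⟨c, hc.1⟩, hc.2, Subtype.ext e⟩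
  exact
    { isCompl := by
        refine ⟨Submodule.disjoint_def.mpr fun a h0 h1 => Subtype.ext ?_,
          codisjoint_iff_le_sup.mpr fun a _ => ?_⟩
        · have h : a.1 ∈ serPar K 0 ⊓ serPar K 1 := ⟨h0, h1⟩
          rw [serPar_inf] at h
          exact (Submodule.mem_bot K).mp h
        · obtain ⟨b, hb, c, hc, e⟩ := hsplit a
          exact Submodule.mem_sup.mpr ⟨b, hb, c, hc, e⟩
      one_mem := one_mem_serPar
      mul_mem := fun i j a b ha hb => mul_mem_serPar (mem_pPar.mp ha) (mem_pPar.mp hb)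
      one_mul := fun a => Subtype.ext (one_mul a.1)
      mul_one := fun a => Subtype.ext (mul_one a.1)
      mul_assoc := fun a b c => Subtype.ext (mul_assoc a.1 b.1 c.1)
      mul_supercomm := fun i j a b ha hb =>
        Subtype.ext (Ser.mul_supercomm (mem_pPar.mp ha) (mem_pPar.mp hb))
      br_mem := fun i j a b ha hb => serBr_mem_serPar (hT ha) (hT hb)
      br_antisupercomm := fun i j a b ha hb =>
        Subtype.ext (superBr_serBr.anti i j _ _ (hT ha) (hT hb))
      jacobi := fun i j a b c ha hb => by
        obtain ⟨c0, h0, c1, h1, rfl⟩ := hsplit c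
        have e0 : pBr K a (pBr K b c0) = pBr K (pBr K a b) c0 + ssign K i j • pBr K b (pBr K a c0) :=
          Subtype.ext (serBr_jacobi h2 (hH ha) (hH hb) (hH h0))
        have e1 : pBr K a (pBr K b c1) = pBr K (pBr K a b) c1 + ssign K i j • pBr K b (pBr K a c1) :=
          Subtype.ext (serBr_jacobi h2 (hH ha) (hH hb) (hH h1))
        simp only [map_add, e0, e1, smul_add]
        abel
      br_br_self := fun a ha => Subtype.ext (serBr_br_self h2 (hH ha))
      leibniz := fun j k a b c hb hc => by
        obtain ⟨a0, h0, a1, h1, rfl⟩ := hsplit a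
        have e0 : pBr K (pMul K a0 b) c = pMul K a0 (pBr K b c) + ssign K j k • pMul K (pBr K a0 c) b :=
          Subtype.ext (superBr_serBr.leib 0 j k _ _ _ (hT h0) (hT hb) (hT hc))
        have e1 : pBr K (pMul K a1 b) c = pMul K a1 (pBr K b c) + ssign K j k • pMul K (pBr K a1 c) b :=
          Subtype.ext (superBr_serBr.leib 1 j k _ _ _ (hT h1) (hT hb) (hT hc))
        simp only [map_add, LinearMap.add_apply, e0, e1, smul_add]
        abel }

end Poisson

/-! ### The symbol map -/

section Symbols

/-- Surjective linear maps with equal kernels have isomorphic targets. -/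
theorem exists_equiv_of_ker_eq {K E A B : Type*} [Field K] [AddCommGroup E] [Module K E]
    [AddCommGroup A] [Module K A] [AddCommGroup B] [Module K B] (f : E →ₗ[K] A) (g : E →ₗ[K] B)
    (hf : Function.Surjective f) (hg : Function.Surjective g)
    (h : LinearMap.ker f = LinearMap.ker g) : ∃ e : A ≃ₗ[K] B, ∀ z, e (f z) = g z := by
  refine ⟨(f.quotKerEquivOfSurjective hf).symm ≪≫ₗ Submodule.quotEquivOfEq _ _ h ≪≫ₗ
    g.quotKerEquivOfSurjective hg, fun z => ?_⟩
  have e : (f.quotKerEquivOfSurjective hf).symm (f z) = Submodule.Quotient.mk z := by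
    rw [LinearEquiv.symm_apply_eq]
    rfl
  rw [LinearEquiv.trans_apply, LinearEquiv.trans_apply, e]
  rfl

variable {K : Type*} [Field K]

theorem fst_mem_filt_of_symSpan {m : ℕ} {z : Pairs K} (hz : z ∈ symSpan K m) :
    z.1 ∈ filt K m := by
  rw [← map_fst_symSpan]
  exact ⟨z, hz, rfl⟩

theorem snd_mem_pPiece {m : ℕ} {z : Pairs K} (hz : z ∈ symSpan K m) : z.2 ∈ pPiece K m := by
  rw [← map_snd_symSpan]
  exact ⟨z, hz, rfl⟩

/-- The isomorphism of the components: the class of an element goes to its symbol. -/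
theorem exists_symbolEquiv (h2 : (2 : K) ≠ 0) (m : ℕ) : ∃ ρ : GrPiece (filt K) m ≃ₗ[K] pPiece K m,
    ∀ z (hz : z ∈ symSpan K m),
      (ρ (pieceCls (filt K) m ⟨z.1, fst_mem_filt_of_symSpan hz⟩) : Ser K) = z.2 := by
  let f : symSpan K m →ₗ[K] GrPiece (filt K) m := (pieceCls (filt K) m).comp
    (((LinearMap.fst K _ _).comp (symSpan K m).subtype).codRestrict (filt K m)
      fun z => fst_mem_filt_of_symSpan z.2)
  let g : symSpan K m →ₗ[K] pPiece K m :=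
    ((LinearMap.snd K _ _).comp (symSpan K m).subtype).codRestrict (pPiece K m)
      fun z => snd_mem_pPiece z.2
  have hf : Function.Surjective f := fun x => by
    obtain ⟨⟨a, ha⟩, rfl⟩ := pieceCls_surjective (filt K) m x
    obtain ⟨z, hz, rfl⟩ := (map_fst_symSpan (K := K) m).ge ha
    exact ⟨⟨z, hz⟩, rfl⟩
  have hg : Function.Surjective g := fun x => by
    obtain ⟨s, hs⟩ := x
    obtain ⟨z, hz, rfl⟩ := (map_snd_symSpan (K := K) m).ge hs
    exact ⟨⟨z, hz⟩, rfl⟩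
  -- The symbol is zero precisely when the operator lies in the previous term of the filtration. One
  -- direction uses independence of the formal sums, the other that of the operators.
  have hker : LinearMap.ker f = LinearMap.ker g := by
    ext ⟨z, hz⟩
    rw [LinearMap.mem_ker, LinearMap.mem_ker]
    constructor
    · intro h
      exact Subtype.ext (snd_eq_zero_of_fst h2 hz ((pieceCls_eq_zero _).mp h))
    · intro h
      exact (pieceCls_eq_zero _).mpr (fst_mem_filtPred h2 hz (congrArg Subtype.val h))
  obtain ⟨e, he⟩ := exists_equiv_of_ker_eq f g hf hg hker
  exact ⟨e, fun z hz => congrArg Subtype.val (he ⟨z, hz⟩)⟩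

theorem iSupIndep.exists_equiv {K M : Type*} [Field K] [AddCommGroup M] [Module K M]
    {G : ℕ → Type*} [∀ m, AddCommGroup (G m)] [∀ m, Module K (G m)] {p : ℕ → Submodule K M}
    (hp : iSupIndep p) {P : Submodule K M} (hP : iSup p = P) (ρ : ∀ m, G m ≃ₗ[K] p m) :
    ∃ Φ : (⨁ m, G m) ≃ₗ[K] P, ∀ m z, (Φ (DirectSum.lof K ℕ G m z) : M) = ρ m z := by
  let S : (Π₀ m, p m) →ₗ[K] M := DFinsupp.lsum ℕ fun m => (p m).subtype
  have hS : Function.Injective S := hp.dfinsupp_lsum_injective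
  have hr : LinearMap.range S = P := by
    rw [← hP, Submodule.iSup_eq_range_dfinsupp_lsum]
  refine ⟨DFinsupp.mapRange.linearEquiv ρ ≪≫ₗ LinearEquiv.ofInjective S hS ≪≫ₗ
    LinearEquiv.ofEq _ _ hr, fun m z => ?_⟩
  change S (DFinsupp.mapRange.linearEquiv ρ (DFinsupp.single m z)) = _
  have : DFinsupp.mapRange.linearEquiv ρ (DFinsupp.single m z) = DFinsupp.single m (ρ m z) :=
    DFinsupp.mapRange_single (hf := fun i => map_zero (ρ i))
  rw [this]
  exact DFinsupp.lsum_single _ _ _ _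

theorem IsPoissonSuperalgebra.of_equiv {A B : Type*} [AddCommGroup A] [Module K A]
    [AddCommGroup B] [Module K B] {one : A} {mul br : A →ₗ[K] A →ₗ[K] A}
    {par : ZMod 2 → Submodule K A} (h : IsPoissonSuperalgebra one mul br par) (e : B ≃ₗ[K] A)
    {one' : B} {mul' br' : B →ₗ[K] B →ₗ[K] B} {par' : ZMod 2 → Submodule K B}
    (hone : e one' = one) (hmul : ∀ a b, e (mul' a b) = mul (e a) (e b))
    (hbr : ∀ a b, e (br' a b) = br (e a) (e b))
    (hpar : ∀ i, (par' i).map (e : B →ₗ[K] A) = par i) :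
    IsPoissonSuperalgebra one' mul' br' par' := by
  have hm : ∀ {i a}, a ∈ par' i ↔ e a ∈ par i := fun {i a} => by
    rw [← hpar]
    constructor
    · exact fun h => ⟨a, h, rfl⟩
    · rintro ⟨b, hb, hba⟩
      exact e.injective hba ▸ hb
  exact
    { isCompl := by
        have hc := h.isCompl
        rw [← hpar, ← hpar] at hc
        refine ⟨Submodule.disjoint_def.mpr fun a h0 h1 => e.injective ?_,
          codisjoint_iff_le_sup.mpr fun a _ => ?_⟩
        · rw [map_zero]
          exact Submodule.disjoint_def.mp hc.disjoint _ ⟨a, h0, rfl⟩ ⟨a, h1, rfl⟩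
        · have : e a ∈ (par' 0 ⊔ par' 1).map (e : B →ₗ[K] A) := by
            rw [Submodule.map_sup, hc.sup_eq_top]
            exact Submodule.mem_top
          obtain ⟨b, hb, hba⟩ := this
          exact e.injective hba ▸ hb
      one_mem := hm.mpr (hone ▸ h.one_mem)
      mul_mem := fun i j a b ha hb => hm.mpr (by
        rw [hmul]; exact h.mul_mem _ _ _ _ (hm.mp ha) (hm.mp hb))
      one_mul := fun a => e.injective (by rw [hmul, hone, h.one_mul])
      mul_one := fun a => e.injective (by rw [hmul, hone, h.mul_one])
      mul_assoc := fun a b c => e.injective (by simp only [hmul, h.mul_assoc])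
      mul_supercomm := fun i j a b ha hb => e.injective (by
        rw [map_smul, hmul, hmul]; exact h.mul_supercomm _ _ _ _ (hm.mp ha) (hm.mp hb))
      br_mem := fun i j a b ha hb => hm.mpr (by
        rw [hbr]; exact h.br_mem _ _ _ _ (hm.mp ha) (hm.mp hb))
      br_antisupercomm := fun i j a b ha hb => e.injective (by
        rw [map_neg, map_smul, hbr, hbr]
        exact h.br_antisupercomm _ _ _ _ (hm.mp ha) (hm.mp hb))
      jacobi := fun i j a b c ha hb => e.injective (by
        simp only [map_add, map_smul, hbr]
        exact h.jacobi _ _ _ _ _ (hm.mp ha) (hm.mp hb))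
      br_br_self := fun a ha => e.injective (by
        simp only [map_zero, hbr]
        exact h.br_br_self _ (hm.mp ha))
      leibniz := fun j k a b c hb hc => e.injective (by
        simp only [map_add, map_smul, hbr, hmul]
        exact h.leibniz _ _ _ _ _ (hm.mp hb) (hm.mp hc)) }

/-- The associated graded space is spanned by the classes. -/
theorem hullGr_induction {p : HullGr K → Prop} (hcls : ∀ m a, p (cls (filt K) m a))
    (hadd : ∀ x y, p x → p y → p (x + y)) (x : HullGr K) : p x := by
  induction x using DirectSum.induction_on with
  | zero =>
    have := hcls 0 0
    rwa [map_zero] at this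
  | of m z =>
    obtain ⟨a, rfl⟩ := pieceCls_surjective (filt K) m z
    exact hcls m a
  | add x y hx hy => exact hadd x y hx hy

theorem hullGr_hom_induction {p : HullGr K → Prop}
    (hcls : ∀ m i (a : filt K m), a.1 ∈ endPar K i → p (cls (filt K) m a))
    (hadd : ∀ x y, p x → p y → p (x + y)) (x : HullGr K) : p x := by
  refine hullGr_induction (fun m a => ?_) hadd x
  obtain ⟨b, hb, c, hc, e⟩ := Submodule.mem_sup.mp (filt_le_filtHom m a.2)
  have hb := filtHom_le m 0 hb
  have hc := filtHom_le m 1 hc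
  have e' : a = ⟨b, hb.1⟩ + ⟨c, hc.1⟩ := Subtype.ext e.symm
  rw [e', map_add]
  exact hadd _ _ (hcls m 0 _ hb.2) (hcls m 1 _ hc.2)

/-- Classes of homogeneous elements span the graded space, and the supercommutator of
representatives has the required degree, so the bracket is forced on them. -/
theorem isInducedBracket_unique (h2 : (2 : K) ≠ 0) {br br' : HullGr K →ₗ[K] HullGr K →ₗ[K] HullGr K}
    (h : IsInducedBracket K br) (h' : IsInducedBracket K br') : br' = br := by
  refine LinearMap.ext₂ fun x y => ?_
  refine hullGr_hom_induction (p := fun x => br' x y = br x y) (fun n i a ha => ?_)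
    (fun x x' h h' => by simp only [map_add, LinearMap.add_apply, h, h']) x
  refine hullGr_hom_induction (p := fun y => br' (cls (filt K) n a) y = br (cls (filt K) n a) y)
    (fun m j b hb => ?_) (fun y y' h h' => by simp only [map_add, h, h']) y
  let c : filt K (n + m - 1) := ⟨_, scomm_mem_filt h2 n m i j a.1 b.1 a.2 b.2 ha hb⟩
  rw [h n m i j a b c ha hb rfl, h' n m i j a b c ha hb rfl]

/-- The isomorphism of the associated graded space with the Poisson superalgebra. -/
theorem exists_grEquiv (h2 : (2 : K) ≠ 0) : ∃ ρ : ∀ m, GrPiece (filt K) m ≃ₗ[K] pPiece K m,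
    ∃ Φ : HullGr K ≃ₗ[K] poisson K,
      (∀ m z, (Φ (DirectSum.lof K ℕ (GrPiece (filt K)) m z) : Ser K) = ρ m z) ∧
      ∀ m z (a : filt K m), z ∈ symSpan K m → a.1 = z.1 →
        (ρ m (pieceCls (filt K) m a) : Ser K) = z.2 := by
  choose ρ hρ using exists_symbolEquiv (K := K) h2
  obtain ⟨Φ, hΦ⟩ := iSupIndep.exists_equiv (iSupIndep_pPiece h2) (iSup_pPiece h2) ρ
  refine ⟨ρ, Φ, hΦ, fun m z a hz ha => ?_⟩
  rw [← hρ m z hz]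
  congr 3
  exact Subtype.ext ha

variable {Φ : HullGr K ≃ₗ[K] poisson K}

/-- The map takes the class of an element to its symbol. -/
def IsSymbolMap (Φ : HullGr K ≃ₗ[K] poisson K) : Prop :=
  ∀ m z (a : filt K m), z ∈ symSpan K m → a.1 = z.1 → (Φ (cls (filt K) m a) : Ser K) = z.2

theorem IsSymbolMap.map_one (hΦ : IsSymbolMap Φ) : Φ (hullGrOne K) = pOne K :=
  Subtype.ext (hΦ 0 1 _ (Submodule.mem_sup_left (wProd_mem_listSpan (l := []) (by simp [AllStd])))
    rfl)

theorem IsSymbolMap.map_mul (hΦ : IsSymbolMap Φ) (x y : HullGr K) :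
    Φ (hullGrMul K x y) = pMul K (Φ x) (Φ y) := by
  refine hullGr_induction (p := fun x => Φ (hullGrMul K x y) = pMul K (Φ x) (Φ y))
    (fun n a => ?_) (fun x x' h h' => by simp only [map_add, LinearMap.add_apply, h, h']) x
  refine hullGr_induction (p := fun y => Φ (hullGrMul K (cls (filt K) n a) y) =
    pMul K (Φ (cls (filt K) n a)) (Φ y)) (fun m b => ?_)
    (fun y y' h h' => by simp only [map_add, h, h']) y
  obtain ⟨z, hz, hza⟩ := (map_fst_symSpan (K := K) n).ge a.2
  obtain ⟨w, hw, hwb⟩ := (map_fst_symSpan (K := K) m).ge b.2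
  refine Subtype.ext ?_
  rw [hullGrMul, grMul_cls, hΦ (n + m) (z * w) _ (symSpan_mul hz hw)
    (congrArg₂ (· * ·) hza.symm hwb.symm)]
  change z.2 * w.2 = serMul K (Φ (cls (filt K) n a)) (Φ (cls (filt K) m b))
  rw [hΦ n z a hz hza.symm, hΦ m w b hw hwb.symm]
  rfl

theorem IsSymbolMap.map_par (h2 : (2 : K) ≠ 0) (hΦ : IsSymbolMap Φ) (i : ZMod 2) :
    (hullGrPar K i).map (Φ : HullGr K →ₗ[K] poisson K) = pPar K i := by
  refine le_antisymm ?_ fun f hf => ?_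
  · rw [hullGrPar, Submodule.map_iSup]
    refine iSup_le fun m => ?_
    rintro _ ⟨_, ⟨a, ha, rfl⟩, rfl⟩
    obtain ⟨z, hz, hza⟩ := exists_symHom a.2 ha
    have hz := symHom_le m i hz
    refine mem_pPar.mpr ?_
    rw [LinearEquiv.coe_coe, hΦ m z a hz.1 hza.symm]
    exact hz.2.2.1
  · have h : f.1 ∈ poissonHom K i := by
      rw [poissonHom_eq h2]
      exact ⟨f.2, hf⟩
    have hle : poissonHom K i ≤
        ((hullGrPar K i).map (Φ : HullGr K →ₗ[K] poisson K)).map (poisson K).subtype := by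
      refine Submodule.span_le.mpr ?_
      rintro _ ⟨m, z, hz, rfl⟩
      have hz := symHom_le m i hz
      let a : filt K m := ⟨z.1, fst_mem_filt_of_symSpan hz.1⟩
      refine ⟨_, ⟨cls (filt K) m a, ?_, rfl⟩, hΦ m z a hz.1 rfl⟩
      exact Submodule.mem_iSup_of_mem m ⟨a, hz.2.1, rfl⟩
    obtain ⟨g, hg, hgf⟩ := hle h
    rwa [← Subtype.ext hgf]

/-- Homogeneous elements lift to pairs of the same parity. The bracket of these pairs has the
supercommutator as its operator and the Poisson bracket of the symbols as its symbol. -/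
theorem IsSymbolMap.isInducedBracket (h2 : (2 : K) ≠ 0) (hΦ : IsSymbolMap Φ)
    {br : HullGr K →ₗ[K] HullGr K →ₗ[K] HullGr K}
    (hbr : ∀ x y, Φ (br x y) = pBr K (Φ x) (Φ y)) : IsInducedBracket K br := by
  intro n m p q a b c ha hb hc
  obtain ⟨z, hz, hza⟩ := exists_symHom a.2 ha
  obtain ⟨w, hw, hwb⟩ := exists_symHom b.2 hb
  have hlhs : (Φ (br (cls (filt K) n a) (cls (filt K) m b)) : Ser K) = (eBr K p q z w).2 := by
    rw [hbr]
    change serBr K (Φ (cls (filt K) n a)) (Φ (cls (filt K) m b)) = _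
    rw [hΦ n z a (symHom_le n p hz).1 hza.symm, hΦ m w b (symHom_le m q hw).1 hwb.symm]
    rfl
  have hc' : c.1 = (eBr K p q z w).1 := by
    rw [hc, ← hza, ← hwb]
    rfl
  refine Φ.injective (Subtype.ext ?_)
  rw [hlhs]
  have h := eBr_mem_filtPred_symSpan h2 hz hw
  unfold filtPred at h
  split_ifs at h with h0
  · have h1 := (Submodule.mem_bot K).mp h
    have hc0 : c = 0 := Subtype.ext (by rw [hc', h1]; rfl)
    rw [h1, hc0, map_zero, map_zero]
    rfl
  · exact (hΦ _ _ c h hc').symm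

end Symbols

end PivotAlg

end

open PivotAlg

theorem mainTheorem7 (K : Type*) [Field K] (hK : ringChar K ≠ 2) :
    -- the exceptional monomials are finitely many, of length at most ten, and the admissible
    -- monomials are those that are products of standard monomials
    ({m : Mono | m.Excluded}.Finite ∧ (∀ m : Mono, m.Excluded → m.n ≤ 10) ∧
      ∀ m : Mono, m.Admissible ↔ m.IsStandardProduct) ∧
    -- the monomial bases
    IsBasisOf K (basisFamily (serX K) (serV K)) (poisson K) ∧
    IsBasisOf K (basisFamily (xOp K) (pivot K)) (Subalgebra.toSubmodule (hull K)) ∧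
    -- the filtration of the associative hull, and the decomposition of the Poisson superalgebra
    (iSup (filt K) = Subalgebra.toSubmodule (hull K)) ∧
    (∀ m, 1 ≤ m → filt K m = decr K m ⊔ filt K (m - 1)) ∧
    (iSupIndep (pPiece K) ∧ iSup (pPiece K) = poisson K) ∧
    -- the Poisson superalgebra generated by the pivot elements
    IsPoissonSuperalgebra (pOne K) (pMul K) (pBr K) (pPar K) ∧
    -- the supercommutator induces a bracket on the associated graded algebra
    (∀ (n m : ℕ) (p q : ZMod 2) (a b : Module.End K (Lam K)),
      a ∈ filt K n → b ∈ filt K m → a ∈ endPar K p → b ∈ endPar K q →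
        scomm K p q a b ∈ filt K (n + m - 1)) ∧
    ∃ br : HullGr K →ₗ[K] HullGr K →ₗ[K] HullGr K,
      IsInducedBracket K br ∧ (∀ br', IsInducedBracket K br' → br' = br) ∧
      IsPoissonSuperalgebra (hullGrOne K) (hullGrMul K) br (hullGrPar K) ∧
      -- the natural isomorphisms of the components
      ∃ ρ : ∀ m, GrPiece (filt K) m ≃ₗ[K] pPiece K m,
        (∀ (l : List (ℕ × Finset ℕ)) (a : filt K l.length), (∀ w ∈ l, Standard w.1 w.2) →
          (a : Module.End K (Lam K)) = (l.map (aMon K)).prod →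
          (ρ l.length (pieceCls (filt K) l.length a) : Ser K) = (l.map (pMon K)).prod) ∧
        -- they constitute an isomorphism of Poisson superalgebras
        ∃ Φ : HullGr K ≃ₗ[K] poisson K,
          (∀ m z, (Φ (DirectSum.lof K ℕ (GrPiece (filt K)) m z) : Ser K) = ρ m z) ∧
          Φ (hullGrOne K) = pOne K ∧
          (∀ a b, Φ (hullGrMul K a b) = pMul K (Φ a) (Φ b)) ∧
          (∀ a b, Φ (br a b) = pBr K (Φ a) (Φ b)) ∧
          ∀ i, (hullGrPar K i).map (Φ : HullGr K →ₗ[K] poisson K) = pPar K i := by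
  have h2 : (2 : K) ≠ 0 := Ring.two_ne_zero hK
  refine ⟨⟨finite_excluded, fun _ h => h.n_le, Mono.admissible_iff⟩, isBasisOf_poisson h2,
    isBasisOf_hull h2, iSup_filt h2, fun m hm => filt_eq_decr_sup h2 hm,
    ⟨iSupIndep_pPiece h2, iSup_pPiece h2⟩, isPoissonSuperalgebra_poisson h2,
    scomm_mem_filt h2, ?_⟩
  obtain ⟨ρ, Φ, hΦ, hρ⟩ := exists_grEquiv (K := K) h2
  have hsym : IsSymbolMap Φ := fun m z a hz ha => (hΦ m _).trans (hρ m z a hz ha)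
  -- The bracket is transported from $\mathbf P$, so the Poisson axioms come for free; what remains
  -- is that it is induced by the supercommutator.
  let br : HullGr K →ₗ[K] HullGr K →ₗ[K] HullGr K :=
    ((pBr K).compl₁₂ (Φ : HullGr K →ₗ[K] poisson K) (Φ : HullGr K →ₗ[K] poisson K)).compr₂
      (Φ.symm : poisson K →ₗ[K] HullGr K)
  have hbr : ∀ x y, Φ (br x y) = pBr K (Φ x) (Φ y) := fun x y => Φ.apply_symm_apply _
  have hind := hsym.isInducedBracket h2 hbr
  refine ⟨br, hind, fun br' h => isInducedBracket_unique h2 hind h,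
    (isPoissonSuperalgebra_poisson h2).of_equiv Φ hsym.map_one hsym.map_mul hbr (hsym.map_par h2),
    ρ, fun l a hl ha => ?_, Φ, hΦ, hsym.map_one, hsym.map_mul, hbr, hsym.map_par h2⟩
  rw [hρ l.length (wProd K l) a (Submodule.mem_sup_left (wProd_mem_listSpan hl))
    (ha.trans (wProd_fst K l).symm), wProd_snd]
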